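/- Notation. Let $\mathcal H$ be a separable complex Hilbert space and $u(x)=x-i$ for $x\in\mathbb R$. Let $W_0(\mathbb R)$ be the set of $f\in C_0(\mathbb R)$ of the form $f(x)=\int_{\mathbb R}e^{ixy}\,d\mu(y)$ with $\mu$ a finite complex Borel measure on $\mathbb R$, and for $n\ge 0$ let $$\mathcal W_n=\{f\in C^n(\mathbb R): (fu^p)^{(p)}\in W_0(\mathbb R)\text{ for }p=0,\dots,n\}.$$ For $f\in C^n(\mathbb R)$ the divided differences are $f^{[0]}=f$ and $f^{[n]}(\lambda_0,\dots,\lambda_n)=\frac{f^{[n-1]}(\lambda_0,\dots,\lambda_{n-1})-f^{[n-1]}(\lambda_1,\dots,\lambda_n)}{\lambda_0-\lambda_n}$, continuously extended to $\lambda_0=\lambda_n$. Let $H$ be a (possibly unbounded) self-adjoint operator in $\mathcal H$. An operator $V$ is relatively $H$-bounded if $\operatorname{dom}H\subseteq\operatorname{dom}V$ and there are $a,b\ge0$ with $\|V\psi\|\le a\|H\psi\|+b\|\psi\|$ for all $\psi\in\operatorname{dom}H$; the infimum of such $a$ is the $H$-bound of $V$. By convention $(-\frac1a,\frac1a)=\mathbb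 R$ if $a=0$. Let $\mathfrak{BS}(\mathbb R^{n+1})$ be the set of $\phi:\mathbb R^{n+1}\to\mathbb C$ of the form $\phi(\lambda_0,\dots,\lambda_n)=\int_\Omega a_0(\lambda_0,\omega)\cdots a_n(\lambda_n,\omega)\,d\omega$ with a finite measure space $\Omega$ and bounded measurable $a_j:\mathbb R\times\Omega\to\mathbb C$. For self-adjoint $H_0,\dots,H_n$ and bounded $W_1,\dots,W_n$ put $$T_\phi^{H_0,\dots,H_n}(W_1,\dots,W_n)\psi=\int_\Omega a_0(H_0,\omega)W_1a_1(H_1,\omega)\cdots W_na_n(H_n,\omega)\psi\,d\omega\qquad(\psi\in\mathcal H),$$ which is independent of the representation of $\phi$. If $V_j$ is relatively $H_j$-bounded for $j=1,\dots,n$, and $\alpha\in\mathbb Z_{\ge0}^n$ is such that all $V_j(H_j-i)^{-\alpha_j}$ are bounded (and everywhere defined) and $\phi\,u^\alpha\in\mathfrak{BS}(\mathbb R^{n+1})$, where $u^\alpha(\lambda)=\prod_{j=1}^n(\lambda_j-i)^{\alpha_j}$, put $$\mathbf T_\phi^{H_0,\dots,H_n}(V_1,\dots,V_n)=T_{\phi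 u^\alpha}^{H_0,\dots,H_n}\big(V_1(H_1-i)^{-\alpha_1},\dots,V_n(H_n-i)^{-\alpha_n}\big),$$ which is independent of $\alpha$. Theorem. Let $n\ge1$, $f\in\mathcal W_n$, let $H$ be self-adjoint in $\mathcal H$ and let $V$ be symmetric and relatively $H$-bounded with $H$-bound $a\in[0,\infty)$. For every $t\in(-\frac1a,\frac1a)$ the operator $H+tV$ is self-adjoint and $\mathbf T^{H+tV,\dots,H+tV}_{f^{[n]}}(V,\dots,V)$ is well defined. The map $t\mapsto f(H+tV)$ is $n$ times differentiable in the strong operator topology on $(-\frac1a,\frac1a)$, and for every $t_0\in(-\frac1a,\frac1a)$ $$\frac1{n!}\frac{d^n}{dt^n}f(H+tV)\Big|_{t=t_0}=\mathbf T^{H+t_0V,\dots,H+t_0V}_{f^{[n]}}(V,\dots,V);$$ in particular $\frac1{n!}\frac{d^n}{dt^n}f(H+tV)\big|_{t=0}=\mathbf T^{H,\dots,H}_{f^{[n]}}(V,\dots,V)$. If moreover $V(H-i)^{-1}$ is compact, or $f\in\mathcal W_{n+1}$, then $t\mapsto f(H+tV)$ is $n$ times differentiable in operator norm on $(-\frac1a,\frac1a)$,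 with the same derivatives. -/

import Mathlib

open MeasureTheory Filter Topology

noncomputable section

namespace RelMOI

/-! ### Function spaces -/

/-- `f ∈ W₀(ℝ)`: `f ∈ C₀(ℝ)` and `f x = ∫ exp (i x y) dμ(y)` for a complex Borel measure `μ`. -/
def MemW0 (f : ℝ → ℂ) : Prop :=
  Continuous f ∧ Tendsto f (cocompact ℝ) (𝓝 0) ∧
    ∃ μ : ComplexMeasure ℝ, ∀ x : ℝ,
      f x = VectorMeasure.integral μ (fun y : ℝ => Complex.exp (Complex.I * x * y))
        (ContinuousLinearMap.mul ℝ ℂ)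

/-- `u x = x - i`. -/
def u (x : ℝ) : ℂ := (x : ℂ) - Complex.I

/-- `f ∈ 𝒲ₙ(ℝ)`: `f ∈ Cⁿ(ℝ)` and `(f uᵖ)⁽ᵖ⁾ ∈ W₀(ℝ)` for `p = 0, …, n`. -/
def MemW (n : ℕ) (f : ℝ → ℂ) : Prop :=
  ContDiff ℝ n f ∧ ∀ p ≤ n, MemW0 (iteratedDeriv p (fun x => f x * u x ^ p))

/-- The divided difference `f^{[n]}(l₀, …, lₙ)`; the quotient is continuously extended to
`l₀ = lₙ` as a limit along points with distinct first and last coordinates. -/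
def divDiff (f : ℝ → ℂ) : (n : ℕ) → (Fin (n + 1) → ℝ) → ℂ
  | 0, l => f (l 0)
  | n + 1, l =>
    open Classical in
    let q : (Fin (n + 2) → ℝ) → ℂ := fun m =>
      (divDiff f n (Fin.init m) - divDiff f n (Fin.tail m)) /
        ((m 0 - m (Fin.last (n + 1)) : ℝ) : ℂ)
    if l 0 ≠ l (Fin.last (n + 1)) then q l
    else limUnder (𝓝[{m | m 0 ≠ m (Fin.last (n + 1))}] l) q

/-! ### Unbounded operators -/

variable {𝓗 : Type*} [NormedAddCommGroup 𝓗] [InnerProductSpace ℂ 𝓗]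

/-- The numbers `a ≥ 0` such that `‖V ψ‖ ≤ a ‖H ψ‖ + b ‖ψ‖` on `dom H` for some `b ≥ 0`
(where `dom H ⊆ dom V`). -/
def relBoundSet (H V : 𝓗 →ₗ.[ℂ] 𝓗) : Set ℝ :=
  {a | 0 ≤ a ∧ ∃ b : ℝ, 0 ≤ b ∧ ∀ (x : H.domain) (y : V.domain), (x : 𝓗) = y →
    ‖V y‖ ≤ a * ‖H x‖ + b * ‖(x : 𝓗)‖}

/-- `V` is relatively `H`-bounded. -/
def IsRelBounded (H V : 𝓗 →ₗ.[ℂ] 𝓗) : Prop :=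
  H.domain ≤ V.domain ∧ (relBoundSet H V).Nonempty

/-- The `H`-bound of `V`. -/
def relBound (H V : 𝓗 →ₗ.[ℂ] 𝓗) : ℝ := sInf (relBoundSet H V)

/-- The interval `(-1/a, 1/a)`, which is all of `ℝ` if `a = 0`. -/
def symmInterval (a : ℝ) : Set ℝ := {t | |t| * a < 1}

/-- `R = (H - i)⁻¹`, an everywhere defined bounded two-sided inverse of `H - i : dom H → 𝓗`. -/
def IsResolvent (H : 𝓗 →ₗ.[ℂ] 𝓗) (R : 𝓗 →L[ℂ] 𝓗) : Prop :=
  (∀ ψ : 𝓗, (R ψ, ψ + Complex.I • R ψ) ∈ H.graph) ∧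
    ∀ x : H.domain, R (H x - Complex.I • (x : 𝓗)) = x

open Classical in
/-- `(H - i)⁻¹` (it exists and is unique if `H` is self-adjoint). -/
def resolvent (H : 𝓗 →ₗ.[ℂ] 𝓗) : 𝓗 →L[ℂ] 𝓗 :=
  if h : ∃ R, IsResolvent H R then h.choose else 0

/-- `W = V R` as operators: `R` maps `𝓗` into `dom V`, and the product, which is bounded and
everywhere defined, is `W`. -/
def IsBoundedProduct (V : 𝓗 →ₗ.[ℂ] 𝓗) (R W : 𝓗 →L[ℂ] 𝓗) : Prop :=
  ∀ ψ : 𝓗, (R ψ, W ψ) ∈ V.graph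

/-! ### Spectral measures and functional calculus -/

/-- A projection-valued measure on the Borel sets of `ℝ` (the values of `proj` on other sets are
irrelevant). -/
structure PVM (𝓗 : Type*) [NormedAddCommGroup 𝓗] [InnerProductSpace ℂ 𝓗] [CompleteSpace 𝓗] where
  proj : Set ℝ → 𝓗 →L[ℂ] 𝓗
  isStarProjection : ∀ s, MeasurableSet s → IsStarProjection (proj s)
  proj_empty : proj ∅ = 0
  proj_univ : proj Set.univ = 1
  proj_inter : ∀ s t, MeasurableSet s → MeasurableSet t → proj (s ∩ t) = proj s * proj t
  hasSum_proj : ∀ s : ℕ → Set ℝ, (∀ i, MeasurableSet (s i)) →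
    Pairwise (Function.onFun Disjoint s) →
      ∀ ψ : 𝓗, HasSum (fun i => proj (s i) ψ) (proj (⋃ i, s i) ψ)

variable [CompleteSpace 𝓗]

theorem PVM.inner_proj (P : PVM 𝓗) {s : Set ℝ} (hs : MeasurableSet s) (ψ : 𝓗) :
    inner ℂ ψ (P.proj s ψ) = ((‖P.proj s ψ‖ ^ 2 : ℝ) : ℂ) := by
  have h1 : P.proj s (P.proj s ψ) = P.proj s ψ :=
    congrArg (fun A : 𝓗 →L[ℂ] 𝓗 => A ψ) (P.isStarProjection s hs).isIdempotentElem
  have h2 := (ContinuousLinearMap.isSelfAdjoint_iff_isSymmetric.mp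
    (P.isStarProjection s hs).isSelfAdjoint) ψ (P.proj s ψ)
  simp only [ContinuousLinearMap.coe_coe] at h2
  rw [h1] at h2
  rw [← h2, inner_self_eq_norm_sq_to_K]
  simp

/-- The scalar spectral measure `s ↦ ⟪ψ, P(s) ψ⟫ = ‖P(s) ψ‖²`. -/
def PVM.scalar (P : PVM 𝓗) (ψ : 𝓗) : Measure ℝ :=
  Measure.ofMeasurable (fun s _ => ENNReal.ofReal (‖P.proj s ψ‖ ^ 2))
    (by simp [P.proj_empty])
    (by
      intro s hs hd
      have h := ((P.hasSum_proj s hs hd ψ).mapL (innerSL ℂ ψ)).mapL Complex.reCLM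
      simp only [innerSL_apply_apply, P.inner_proj (hs _), P.inner_proj (MeasurableSet.iUnion hs),
        Complex.reCLM_apply, Complex.ofReal_re] at h
      rw [← h.tsum_eq, ENNReal.ofReal_tsum_of_nonneg (fun _ => sq_nonneg _) h.summable])

/-- `P` is the spectral measure of `H`, i.e. `H = ∫ x dP(x)`: the domain of `H` consists of all `ψ`
with `∫ x² d⟪ψ, P(x) ψ⟫ < ∞`, and `⟪ψ, H ψ⟫ = ∫ x d⟪ψ, P(x) ψ⟫` for these `ψ`. -/
def PVM.IsSpectralMeasureOf (P : PVM 𝓗) (H : 𝓗 →ₗ.[ℂ] 𝓗) : Prop :=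
  (∀ ψ : 𝓗, ψ ∈ H.domain ↔ Integrable (fun x : ℝ => x ^ 2) (P.scalar ψ)) ∧
    ∀ ψ : H.domain, inner ℂ (ψ : 𝓗) (H ψ) = ((∫ x : ℝ, x ∂(P.scalar (ψ : 𝓗)) : ℝ) : ℂ)

/-- `A = ∫ g dP`, in the weak sense. -/
def PVM.IsIntegral (P : PVM 𝓗) (g : ℝ → ℂ) (A : 𝓗 →L[ℂ] 𝓗) : Prop :=
  ∀ ψ : 𝓗, inner ℂ ψ (A ψ) = ∫ x, g x ∂(P.scalar ψ)

open Classical in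
/-- `∫ g dP`, for bounded Borel functions `g`. -/
def PVM.integral (P : PVM 𝓗) (g : ℝ → ℂ) : 𝓗 →L[ℂ] 𝓗 :=
  if h : ∃ A, P.IsIntegral g A then h.choose else 0

open Classical in
/-- The functional calculus `g(H) = ∫ g dP`, where `P` is the spectral measure of the self-adjoint
operator `H` and `g` is a bounded Borel function. -/
def funCalc (H : 𝓗 →ₗ.[ℂ] 𝓗) (g : ℝ → ℂ) : 𝓗 →L[ℂ] 𝓗 :=
  if h : ∃ P : PVM 𝓗, P.IsSpectralMeasureOf H then h.choose.integral g else 0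

/-! ### Multiple operator integrals -/

/-- A representation `φ(l₀, …, lₙ) = ∫ a₀(l₀, ω) ⋯ aₙ(lₙ, ω) dω` over a finite measure space with
bounded measurable `a₀, …, aₙ`. The class `𝔅𝔖(ℝⁿ⁺¹)` consists of the functions that have one. -/
structure BSRep {n : ℕ} (φ : (Fin (n + 1) → ℝ) → ℂ) where
  Ω : Type
  [mΩ : MeasurableSpace Ω]
  ν : Measure Ω
  [finite_ν : IsFiniteMeasure ν]
  a : Fin (n + 1) → ℝ → Ω → ℂ
  measurable_a : ∀ j, Measurable (Function.uncurry (a j))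
  bounded_a : ∃ C : ℝ, ∀ j x ω, ‖a j x ω‖ ≤ C
  eq_integral : ∀ l, φ l = ∫ ω, ∏ j, a j (l j) ω ∂ν

/-- The vector `∫ a₀(H₀, ω) V₁ a₁(H₁, ω) ⋯ Vₙ aₙ(Hₙ, ω) ψ dω`, a Bochner integral. Here `W j`
is the argument with index `j + 1`. -/
def BSRep.moiVec {n : ℕ} {φ : (Fin (n + 1) → ℝ) → ℂ} (r : BSRep φ)
    (H : Fin (n + 1) → 𝓗 →ₗ.[ℂ] 𝓗) (W : Fin n → 𝓗 →L[ℂ] 𝓗) (ψ : 𝓗) : 𝓗 :=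
  letI := r.mΩ
  ∫ ω, (funCalc (H 0) (fun x => r.a 0 x ω) *
    (List.ofFn fun j : Fin n => W j * funCalc (H j.succ) (fun x => r.a j.succ x ω)).prod) ψ ∂r.ν

/-- `T = T_φ^{H₀, …, Hₙ}(W₁, …, Wₙ)` for `φ ∈ 𝔅𝔖(ℝⁿ⁺¹)` and bounded arguments. -/
def IsMOI {n : ℕ} (H : Fin (n + 1) → 𝓗 →ₗ.[ℂ] 𝓗) (φ : (Fin (n + 1) → ℝ) → ℂ)
    (W : Fin n → 𝓗 →L[ℂ] 𝓗) (T : 𝓗 →L[ℂ] 𝓗) : Prop :=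
  ∃ r : BSRep φ, ∀ ψ, T ψ = r.moiVec H W ψ

/-- `T = 𝐓_φ^{H₀, …, Hₙ}(V₁, …, Vₙ)`, i.e.
`T = T_{φ u^α}^{H₀, …, Hₙ}(V₁ (H₁ - i)^{-α₁}, …, Vₙ (Hₙ - i)^{-αₙ})` for some multi-index `α` such
that all `Vⱼ (Hⱼ - i)^{-αⱼ}` are bounded and everywhere defined and `φ u^α ∈ 𝔅𝔖(ℝⁿ⁺¹)`. -/
def IsGenMOI {n : ℕ} (H : Fin (n + 1) → 𝓗 →ₗ.[ℂ] 𝓗) (φ : (Fin (n + 1) → ℝ) → ℂ)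
    (V : Fin n → 𝓗 →ₗ.[ℂ] 𝓗) (T : 𝓗 →L[ℂ] 𝓗) : Prop :=
  ∃ (α : Fin n → ℕ) (W : Fin n → 𝓗 →L[ℂ] 𝓗),
    (∀ j, IsBoundedProduct (V j) (resolvent (H j.succ) ^ α j) (W j)) ∧
      IsMOI H (fun l => φ l * ∏ j : Fin n, u (l j.succ) ^ α j) W T

open Classical in
/-- The generalized multiple operator integral `𝐓_φ^{H₀, …, Hₙ}(V₁, …, Vₙ)`. -/
def genMOI {n : ℕ} (H : Fin (n + 1) → 𝓗 →ₗ.[ℂ] 𝓗) (φ : (Fin (n + 1) → ℝ) → ℂ)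
    (V : Fin n → 𝓗 →ₗ.[ℂ] 𝓗) : 𝓗 →L[ℂ] 𝓗 :=
  if h : ∃ T, IsGenMOI H φ V T then h.choose else 0

/-! ### Higher derivatives -/

/-- On the open set `I`, `F` is `n` times differentiable in the strong operator topology, with
`n`-th derivative `G`. -/
def HasNthDerivSOT (F : ℝ → 𝓗 →L[ℂ] 𝓗) (I : Set ℝ) : ℕ → (ℝ → 𝓗 →L[ℂ] 𝓗) → Prop
  | 0, G => ∀ t ∈ I, G t = F t
  | n + 1, G => ∃ G' : ℝ → 𝓗 →L[ℂ] 𝓗, HasNthDerivSOT F I n G' ∧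
      ∀ t ∈ I, ∀ ψ : 𝓗, HasDerivAt (fun s => G' s ψ) (G t ψ) t

/-- On the open set `I`, `F` is `n` times differentiable in operator norm, with `n`-th
derivative `G`. -/
def HasNthDerivNorm (F : ℝ → 𝓗 →L[ℂ] 𝓗) (I : Set ℝ) : ℕ → (ℝ → 𝓗 →L[ℂ] 𝓗) → Prop
  | 0, G => ∀ t ∈ I, G t = F t
  | n + 1, G => ∃ G' : ℝ → 𝓗 →L[ℂ] 𝓗, HasNthDerivNorm F I n G' ∧
      ∀ t ∈ I, HasDerivAt G' (G t) t

end RelMOI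

end

open MeasureTheory Filter Topology
set_option linter.unusedSectionVars false

noncomputable section
namespace RelMOI

/-! ### Bounded measurable functions and σ-continuous functionals -/

/-! Write H_t = H + tV, R_t = (H_t - i)⁻¹ and W_t = V R_t. By Kato–Rellich (`isSelfAdjoint_pert`)
H_t is self-adjoint for |t|a < 1, and V stays relatively bounded with respect to it, so W_t is
bounded. With the exponents α = (1, …, 1) the generalized integral at t becomes the ordinary
multiple operator integral T_n with symbol f^{[n]} u(λ₁)⋯u(λₙ) (`weightedDiff`) and arguments W_t.

This symbol has a separated representation. The Leibniz rule `avgDiff_mul_u`, (gu)^{[m+1]} = u(λ_i)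
g^{[m+1]} + g^{[m]} without λ_i, peels off the weights until only functions (f u^p)^{[p]} of fewer
variables remain (`hasContRep_avgDiff_mul`). By Hermite–Genocchi these are averages of the p-th
derivative of f u^p, which is the Fourier transform of a complex measure; the exponential of a
linear combination of the λ_j factors over the variables.

The engine is the perturbation formula `Perturbation.pertMoi_sub`: changing the operator in one slot
from H_t to H_s changes T_k by s - t times T_{k+1}, with both operators side by side. It combines
(λ_i - λ_{i+1}) f^{[k+1]} = difference of two f^{[k]} with the second resolvent identity, which
turns u(H_s) R_t into 1 + (s - t) W_t. As u(H_s) is unbounded, it is truncated by spectral cutoffs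
that are removed strongly. Telescoping over the slots writes T_k(s, …, s) - T_k(t, …, t) as s - t
times a sum of k + 1 values of T_{k+1} at mixed points, all with the same limit. Hence the
derivative of T_k is (k + 1) T_{k+1}, and from T_0 = f(H_t) the n-th derivative is n! T_n.

The limits rest on norm resolvent convergence H_s → H_t. It gives strong convergence g(H_s) → g(H_t)
for bounded continuous g (`Perturbation.sConv_funCalc`), hence of T_k by dominated convergence,
provided the representation is continuous in the real variables. Norm limits come either from
compactness of V(H - i)⁻¹, which upgrades strong convergence of operators and adjoints
(`tendsto_chain_of_compact`), or, for f in W_{n+1}, from the perturbation formula one order higher,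
which makes T_n Lipschitz.

Two foundations are needed. The Borel calculus of H comes from its normal resolvent through
Riesz–Markov, polarization and transport along z ↦ Re(1/z); `PVM.IsSpectralMeasureOf.integral_inv_u`
ties any chosen spectral measure to the resolvent. And `BSRep.moi_congr` shows that the integral
depends on the symbol only: for rank one arguments its matrix elements are integrals of φ against
products of spectral measures, and other arguments are strong limits of finite rank ones. -/

/-- Bounded measurable complex functions. -/
def BddMeas {Y : Type*} [MeasurableSpace Y] (g : Y → ℂ) : Prop :=
  Measurable g ∧ ∃ C : ℝ, ∀ x, ‖g x‖ ≤ C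

namespace BddMeas

variable {Y : Type*} [MeasurableSpace Y] {g h : Y → ℂ}

theorem const (c : ℂ) : BddMeas (fun _ : Y => c) := ⟨measurable_const, ‖c‖, fun _ => le_rfl⟩

theorem add (hg : BddMeas g) (hh : BddMeas h) : BddMeas (fun x => g x + h x) := by
  obtain ⟨mg, C, hC⟩ := hg
  obtain ⟨mh, D, hD⟩ := hh
  exact ⟨mg.add mh, C + D, fun x => (norm_add_le _ _).trans (add_le_add (hC x) (hD x))⟩

theorem mul (hg : BddMeas g) (hh : BddMeas h) : BddMeas (fun x => g x * h x) := by
  obtain ⟨mg, C, hC⟩ := hg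
  obtain ⟨mh, D, hD⟩ := hh
  refine ⟨mg.mul mh, C * D, fun x => ?_⟩
  rw [norm_mul]
  exact mul_le_mul (hC x) (hD x) (norm_nonneg _) ((norm_nonneg _).trans (hC x))

theorem sub (hg : BddMeas g) (hh : BddMeas h) : BddMeas (fun x => g x - h x) := by
  obtain ⟨mg, C, hC⟩ := hg
  obtain ⟨mh, D, hD⟩ := hh
  exact ⟨mg.sub mh, C + D, fun x => (norm_sub_le _ _).trans (add_le_add (hC x) (hD x))⟩

theorem star (hg : BddMeas g) : BddMeas (fun x => starRingEnd ℂ (g x)) := by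
  obtain ⟨mg, C, hC⟩ := hg
  exact ⟨Complex.continuous_conj.measurable.comp mg, C, fun x => by simpa using hC x⟩

theorem comp {Z : Type*} [MeasurableSpace Z] (hg : BddMeas g) {k : Z → Y} (hk : Measurable k) :
    BddMeas (fun x => g (k x)) := by
  obtain ⟨mg, C, hC⟩ := hg
  exact ⟨mg.comp hk, C, fun x => hC _⟩

theorem indicator {s : Set Y} (hs : MeasurableSet s) :
    BddMeas (s.indicator (fun _ => (1 : ℂ))) := by
  refine ⟨measurable_const.indicator hs, 1, fun x => ?_⟩
  by_cases hx : x ∈ s <;> simp [hx]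

theorem integrable (hg : BddMeas g) (m : Measure Y) [IsFiniteMeasure m] : Integrable g m := by
  obtain ⟨mg, C, hC⟩ := hg
  exact Integrable.of_bound mg.aestronglyMeasurable C (Eventually.of_forall hC)

theorem exists_nonneg (hg : BddMeas g) : ∃ C : ℝ, 0 ≤ C ∧ ∀ x, ‖g x‖ ≤ C := by
  obtain ⟨_, C, hC⟩ := hg
  exact ⟨max C 0, le_max_right _ _, fun x => (hC x).trans (le_max_left _ _)⟩

end BddMeas

theorem norm_integral_le_of_bound {Y : Type*} [MeasurableSpace Y] (m : Measure Y)
    [IsFiniteMeasure m] {g : Y → ℂ} {C : ℝ} (hC : ∀ x, ‖g x‖ ≤ C) :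
    ‖∫ x, g x ∂m‖ ≤ C * m.real Set.univ :=
  norm_integral_le_of_norm_le_const (Eventually.of_forall hC)

/-- Linear functionals on bounded measurable functions that are continuous along bounded
pointwise convergent sequences. -/
structure IsSigma {Y : Type*} [MeasurableSpace Y] (L : (Y → ℂ) → ℂ) : Prop where
  add : ∀ g h, BddMeas g → BddMeas h → L (fun x => g x + h x) = L g + L h
  smul : ∀ (c : ℂ) g, BddMeas g → L (fun x => c * g x) = c * L g
  lim : ∀ (g : ℕ → Y → ℂ) (h : Y → ℂ) (C : ℝ), (∀ n, Measurable (g n)) → (∀ n x, ‖g n x‖ ≤ C) →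
    (∀ x, Tendsto (fun n => g n x) atTop (𝓝 (h x))) → Tendsto (fun n => L (g n)) atTop (𝓝 (L h))

namespace IsSigma

variable {Y : Type*} [MeasurableSpace Y] {L L' : (Y → ℂ) → ℂ}

theorem of_integral (m : Measure Y) [IsFiniteMeasure m] : IsSigma fun g : Y → ℂ => ∫ x, g x ∂m where
  add _ _ hg hh := integral_add (hg.integrable m) (hh.integrable m)
  smul c _ _ := integral_const_mul c _
  lim _ _ C hm hC hl := tendsto_integral_of_dominated_convergence (fun _ => C)
    (fun n => (hm n).aestronglyMeasurable) (integrable_const C)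
    (fun n => Eventually.of_forall (hC n)) (Eventually.of_forall hl)

theorem sum_add (hL : IsSigma L) (hL' : IsSigma L') : IsSigma fun g => L g + L' g where
  add g h hg hh := by simp only [hL.add g h hg hh, hL'.add g h hg hh]; ring
  smul c g hg := by simp only [hL.smul c g hg, hL'.smul c g hg]; ring
  lim g h C hm hC hl := (hL.lim g h C hm hC hl).add (hL'.lim g h C hm hC hl)

theorem const_mul (hL : IsSigma L) (c : ℂ) : IsSigma fun g => c * L g where
  add g h hg hh := by simp only [hL.add g h hg hh]; ring
  smul d g hg := by simp only [hL.smul d g hg]; ring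
  lim g h C hm hC hl := (hL.lim g h C hm hC hl).const_mul c

theorem sum_sub (hL : IsSigma L) (hL' : IsSigma L') : IsSigma fun g => L g - L' g := by
  have := hL.sum_add (hL'.const_mul (-1))
  simpa [sub_eq_add_neg] using this

theorem precomp_mul (hL : IsSigma L) {w : Y → ℂ} (hw : BddMeas w) :
    IsSigma fun g => L (fun x => w x * g x) where
  add g h hg hh := by
    rw [← hL.add _ _ (hw.mul hg) (hw.mul hh)]
    congr 1; ext x; ring
  smul c g hg := by
    rw [← hL.smul _ _ (hw.mul hg)]
    congr 1; ext x; ring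
  lim g h C hm hC hl := by
    obtain ⟨D, hD0, hD⟩ := hw.exists_nonneg
    refine hL.lim _ _ (D * C) (fun n => hw.1.mul (hm n)) (fun n x => ?_)
      fun x => (hl x).const_mul _
    rw [norm_mul]
    exact mul_le_mul (hD x) (hC n x) (norm_nonneg _) hD0

theorem map_zero (hL : IsSigma L) : L (fun _ => 0) = 0 := by
  simpa using hL.smul 0 (fun _ => 0) (BddMeas.const 0)

theorem map_sub (hL : IsSigma L) {g h : Y → ℂ} (hg : BddMeas g) (hh : BddMeas h) :
    L (fun x => g x - h x) = L g - L h := by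
  have h1 := hL.add g (fun x => -1 * h x) hg ((BddMeas.const (-1)).mul hh)
  have h2 := hL.smul (-1) h hh
  rw [h2] at h1
  rw [show (fun x => g x - h x) = fun x => g x + -1 * h x by ext; ring, h1]
  ring

theorem eq_zero_of_simpleFunc (hL : IsSigma L)
    (h0 : ∀ s, MeasurableSet s → L (s.indicator fun _ => 1) = 0) (f : SimpleFunc Y ℂ) :
    L f = 0 := by
  induction f using SimpleFunc.induction with
  | const c hs =>
    rename_i s
    have := hL.smul c _ (BddMeas.indicator hs)
    rw [h0 s hs, mul_zero] at this
    refine Eq.trans (congrArg L ?_) this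
    ext x
    by_cases hx : x ∈ s <;> simp [hx]
  | add hd hf hg =>
    rename_i f g
    have bd : ∀ k : SimpleFunc Y ℂ, BddMeas k := fun k =>
      ⟨k.measurable, k.exists_forall_norm_le⟩
    have := hL.add f g (bd f) (bd g)
    rw [hf, hg, add_zero] at this
    exact this

/-- A σ-continuous functional that vanishes on indicators vanishes. -/
theorem eq_zero_of_indicator (hL : IsSigma L)
    (h0 : ∀ s, MeasurableSet s → L (s.indicator fun _ => 1) = 0) {g : Y → ℂ} (hg : BddMeas g) :
    L g = 0 := by
  obtain ⟨C, hC0, hC⟩ := hg.exists_nonneg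
  have sm := hg.1.stronglyMeasurable
  refine tendsto_nhds_unique (hL.lim (fun n => sm.approxBounded C n) g C
    (fun n => (sm.approxBounded C n).measurable)
    (fun n x => sm.norm_approxBounded_le hC0 n x)
    fun x => sm.tendsto_approxBounded_of_norm_le (hC x)) ?_
  simp only [hL.eq_zero_of_simpleFunc h0]
  exact tendsto_const_nhds

/-- A σ-continuous functional that vanishes on continuous functions vanishes. -/
theorem eq_zero_of_continuous {X : Type*} [TopologicalSpace X] [MeasurableSpace X] [BorelSpace X]
    [HasOuterApproxClosed X] {L : (X → ℂ) → ℂ} (hL : IsSigma L)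
    (h0 : ∀ f : BoundedContinuousFunction X NNReal, L (fun x => ((f x : ℝ) : ℂ)) = 0)
    {g : X → ℂ} (hg : BddMeas g) : L g = 0 := by
  refine hL.eq_zero_of_indicator (fun s hs => ?_) hg
  have hone : L (fun _ => 1) = 0 := by
    have := h0 (BoundedContinuousFunction.const X 1)
    simpa using this
  -- Dynkin's π-λ argument. Closed sets form a π-system generating the Borel sets, and the indicator
  -- of a closed set is a bounded pointwise limit of the continuous `apprSeq`. Disjoint unions use
  -- `lim` along partial unions.
  induction s, hs using MeasurableSpace.induction_on_inter
    (h_eq := (BorelSpace.measurable_eq (α := X)).trans borel_eq_generateFrom_isClosed)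
    (h_inter := isPiSystem_isClosed) with
  | empty => simpa using hL.map_zero
  | basic F hF =>
    have hF : IsClosed F := hF
    refine tendsto_nhds_unique (hL.lim (fun n x => ((hF.apprSeq n x : ℝ) : ℂ)) _ 1
      (fun n => ?_) (fun n x => ?_) fun x => ?_) ?_
    · have : Continuous fun x => ((hF.apprSeq n x : ℝ) : ℂ) := by fun_prop
      exact this.measurable
    · simp only [Complex.norm_real, NNReal.norm_eq]
      exact_mod_cast HasOuterApproxClosed.apprSeq_apply_le_one hF n x
    · have h1 := tendsto_pi_nhds.mp (HasOuterApproxClosed.tendsto_apprSeq hF) x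
      have h2 : Continuous fun r : NNReal => ((r : ℝ) : ℂ) := by fun_prop
      have h3 := (h2.tendsto _).comp h1
      have h4 : F.indicator (fun _ => (1 : ℂ)) x
          = (((F.indicator (fun _ => (1 : NNReal)) x : NNReal) : ℝ) : ℂ) := by
        by_cases hx : x ∈ F <;> simp [hx]
      rw [h4]
      exact h3
    · simp only [h0]
      exact tendsto_const_nhds
  | compl t ht ih =>
    have := hL.map_sub (BddMeas.const 1) (BddMeas.indicator ht)
    rw [ih, hone, sub_zero] at this
    rw [← this]
    congr 1
    ext x
    by_cases hx : x ∈ t <;> simp [hx]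
  | iUnion s hd hs ih =>
    have key : ∀ n, L ((⋃ i ∈ Finset.range n, s i).indicator fun _ => 1) = 0 := by
      intro n
      induction n with
      | zero => simpa using hL.map_zero
      | succ n ihn =>
        have := hL.add _ _ (BddMeas.indicator (Finset.measurableSet_biUnion (Finset.range n)
          fun i _ => hs i)) (BddMeas.indicator (hs n))
        rw [ihn, ih n, add_zero] at this
        rw [← this]
        congr 1
        have hdis : Disjoint (⋃ i ∈ Finset.range n, s i) (s n) := by
          simp only [Set.disjoint_iUnion_left, Finset.mem_range]
          intro i hi
          exact hd hi.ne
        have := Set.indicator_union_of_disjoint hdis (fun _ : X => (1 : ℂ))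
        rw [Finset.range_add_one, Finset.set_biUnion_insert, Set.union_comm, this]
    refine tendsto_nhds_unique (hL.lim _ _ 1 (fun n => (BddMeas.indicator
      (Finset.measurableSet_biUnion (Finset.range n) fun i _ => hs i)).1) (fun n x => ?_)
      fun x => ?_) (by simp only [key]; exact tendsto_const_nhds)
    · by_cases hx : x ∈ ⋃ i ∈ Finset.range n, s i
      · rw [Set.indicator_of_mem hx]; simp
      · rw [Set.indicator_of_notMem hx]; simp
    · by_cases hx : x ∈ ⋃ i, s i
      · obtain ⟨i, hi⟩ := Set.mem_iUnion.mp hx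
        refine tendsto_const_nhds.congr' ?_
        filter_upwards [eventually_gt_atTop i] with n hn
        rw [Set.indicator_of_mem hx, Set.indicator_of_mem]
        exact Set.mem_biUnion (Finset.mem_coe.mpr (Finset.mem_range.mpr hn)) hi
      · refine tendsto_const_nhds.congr fun n => ?_
        rw [Set.indicator_of_notMem hx, Set.indicator_of_notMem]
        intro h
        obtain ⟨i, _, hi⟩ := Set.mem_iUnion₂.mp h
        exact hx (Set.mem_iUnion.mpr ⟨i, hi⟩)

end IsSigma

/-! ### Operators from quadratic families of measures -/

variable {𝓗 : Type*} [NormedAddCommGroup 𝓗] [InnerProductSpace ℂ 𝓗]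

/-- The polarization of a function on a complex vector space. -/
def polar (Q : 𝓗 → ℂ) (y x : 𝓗) : ℂ :=
  (1 / 4) * ((Q (x + y) - Q (x - y)) + Complex.I * (Q (x + Complex.I • y) - Q (x - Complex.I • y)))

/-- Over complex scalars the four diagonal values determine the form without any symmetry of `A`, so
an operator is determined by its quadratic form. -/
theorem polar_inner (A : 𝓗 →ₗ[ℂ] 𝓗) (y x : 𝓗) :
    polar (fun ψ => inner ℂ ψ (A ψ)) y x = inner ℂ y (A x) := by
  simp only [polar, map_add, map_sub, map_smul, inner_add_left, inner_add_right, inner_sub_left,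
    inner_sub_right, inner_smul_left, inner_smul_right, Complex.conj_I]
  linear_combination (-(1 / 2) * inner ℂ x (A y) + (1 / 2) * inner ℂ y (A x)) * -Complex.I_sq

/-- Expanding the diagonal at x + y gives Q x y + Q y x = 0, and at x + iy it gives Q x y - Q y x =
0. No continuity is asked for: one application has an operator not yet known to be bounded. -/
theorem polar_diag_eq_zero {Q : 𝓗 → 𝓗 → ℂ} (h : ∀ x, Q x x = 0)
    (add_left : ∀ x y z, Q (x + y) z = Q x z + Q y z)
    (add_right : ∀ x y z, Q x (y + z) = Q x y + Q x z)
    (smul_left : ∀ x y, Q (Complex.I • x) y = -Complex.I * Q x y)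
    (smul_right : ∀ x y, Q x (Complex.I • y) = Complex.I * Q x y) (y x : 𝓗) : Q y x = 0 := by
  have h1 := h (x + y)
  have h2 := h (x + Complex.I • y)
  simp only [add_left, add_right, smul_left, smul_right, h] at h1 h2
  linear_combination (1 / 2) * h1 + (1 / 2) * Complex.I * h2 +
    (-(1 / 2) * Q x y + (1 / 2) * Q y x) * Complex.I_sq

theorem ext_inner_diag {A B : 𝓗 →L[ℂ] 𝓗} (h : ∀ ψ, inner ℂ ψ (A ψ) = inner ℂ ψ (B ψ)) : A = B := by
  ext x
  refine ext_inner_left ℂ fun y => ?_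
  have h1 := polar_inner A.toLinearMap y x
  have h2 := polar_inner B.toLinearMap y x
  simp only [ContinuousLinearMap.coe_coe] at h1 h2
  rw [← h1, ← h2]
  simp only [h]

theorem isSigma_polar {Y : Type*} [MeasurableSpace Y] {μ : 𝓗 → Measure Y}
    (hfin : ∀ ψ, IsFiniteMeasure (μ ψ)) (y x : 𝓗) :
    IsSigma fun h : Y → ℂ => polar (fun ψ => ∫ z, h z ∂(μ ψ)) y x := by
  have H := fun ψ => @IsSigma.of_integral Y _ (μ ψ) (hfin ψ)
  exact (((H _).sum_sub (H _)).sum_add (((H _).sum_sub (H _)).const_mul Complex.I)).const_mul _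

variable [CompleteSpace 𝓗]

/-- A family of measures whose integrals are quadratic forms of operators for a generating class of
functions has this property for all bounded measurable functions. -/
theorem exists_operator_of_generating {Y : Type*} [MeasurableSpace Y] {μ : 𝓗 → Measure Y}
    (hfin : ∀ ψ, IsFiniteMeasure (μ ψ)) (hmass : ∀ ψ, (μ ψ).real Set.univ ≤ ‖ψ‖ ^ 2)
    (S : Set (Y → ℂ))
    (gen : ∀ L : (Y → ℂ) → ℂ, IsSigma L → (∀ g ∈ S, L g = 0) → ∀ h, BddMeas h → L h = 0)
    (hS : ∀ g ∈ S, ∃ A : 𝓗 →L[ℂ] 𝓗, ∀ ψ, inner ℂ ψ (A ψ) = ∫ z, g z ∂(μ ψ))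
    {h : Y → ℂ} (hh : BddMeas h) :
    ∃ A : 𝓗 →L[ℂ] 𝓗, ∀ ψ, inner ℂ ψ (A ψ) = ∫ z, h z ∂(μ ψ) := by
  set B : (Y → ℂ) → 𝓗 → 𝓗 → ℂ := fun h y x => polar (fun ψ => ∫ z, h z ∂(μ ψ)) y x with hB
  have hσ : ∀ y x, IsSigma fun h => B h y x := isSigma_polar hfin
  have hBS : ∀ g ∈ S, ∃ A : 𝓗 →L[ℂ] 𝓗, ∀ y x, B g y x = inner ℂ y (A x) := by
    intro g hg
    obtain ⟨A, hA⟩ := hS g hg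
    refine ⟨A, fun y x => ?_⟩
    rw [← ContinuousLinearMap.coe_coe A, ← polar_inner]
    simp only [hB, ContinuousLinearMap.coe_coe, hA]
  -- For fixed vectors, the defect in each sesquilinearity identity is a σ-continuous functional of
  -- `h`. It vanishes on `S`, where `B` is the form of an operator, so `gen` extends the identity to
  -- all `h`.
  have add_right : ∀ y x x', B h y (x + x') = B h y x + B h y x' := by
    intro y x x'
    have := gen _ ((hσ y (x + x')).sum_sub ((hσ y x).sum_add (hσ y x'))) (fun g hg => by
      obtain ⟨A, hA⟩ := hBS g hg
      simp [hA]) h hh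
    exact sub_eq_zero.mp this
  have smul_right : ∀ (c : ℂ) y x, B h y (c • x) = c * B h y x := by
    intro c y x
    have := gen _ ((hσ y (c • x)).sum_sub ((hσ y x).const_mul c)) (fun g hg => by
      obtain ⟨A, hA⟩ := hBS g hg
      simp [hA]) h hh
    exact sub_eq_zero.mp this
  have add_left : ∀ y y' x, B h (y + y') x = B h y x + B h y' x := by
    intro y y' x
    have := gen _ ((hσ (y + y') x).sum_sub ((hσ y x).sum_add (hσ y' x))) (fun g hg => by
      obtain ⟨A, hA⟩ := hBS g hg
      simp [hA]) h hh
    exact sub_eq_zero.mp this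
  have smul_left : ∀ (c : ℂ) y x, B h (c • y) x = starRingEnd ℂ c * B h y x := by
    intro c y x
    have := gen _ ((hσ (c • y) x).sum_sub ((hσ y x).const_mul (starRingEnd ℂ c))) (fun g hg => by
      obtain ⟨A, hA⟩ := hBS g hg
      simp [hA, mul_comm]) h hh
    exact sub_eq_zero.mp this
  have diag : ∀ x, B h x x = ∫ z, h z ∂(μ x) := by
    intro x
    have := gen _ ((hσ x x).sum_sub (@IsSigma.of_integral Y _ (μ x) (hfin x))) (fun g hg => by
      obtain ⟨A, hA⟩ := hS g hg
      rw [← hA]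
      have := polar_inner A.toLinearMap x x
      simp only [ContinuousLinearMap.coe_coe] at this
      simp only [hB, ← this, hA, sub_self]) h hh
    exact sub_eq_zero.mp this
  obtain ⟨C, hC0, hC⟩ := hh.exists_nonneg
  have bQ : ∀ x, ‖∫ z, h z ∂(μ x)‖ ≤ C * ‖x‖ ^ 2 := fun x =>
    (@norm_integral_le_of_bound Y _ (μ x) (hfin x) h C hC).trans
      (mul_le_mul_of_nonneg_left (hmass x) hC0)
  -- The four vectors in the polarization have norm at most 2, so each integral is at most 4C, and
  -- the prefactor 1/4 averages the four of them.
  have bound1 : ∀ y x, ‖y‖ = 1 → ‖x‖ = 1 → ‖B h y x‖ ≤ 4 * C := by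
    intro y x hy hx
    have hb : ∀ v : 𝓗, ‖v‖ ≤ 2 → ‖∫ z, h z ∂(μ v)‖ ≤ C * 4 := fun v hv =>
      (bQ v).trans (mul_le_mul_of_nonneg_left (by nlinarith [norm_nonneg v]) hC0)
    have hIy : ‖Complex.I • y‖ = 1 := by rw [norm_smul, Complex.norm_I, hy, one_mul]
    have h1 := hb (x + y) ((norm_add_le _ _).trans (by rw [hx, hy]; norm_num))
    have h2 := hb (x - y) ((norm_sub_le _ _).trans (by rw [hx, hy]; norm_num))
    have h3 := hb (x + Complex.I • y) ((norm_add_le _ _).trans (by rw [hx, hIy]; norm_num))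
    have h4 := hb (x - Complex.I • y) ((norm_sub_le _ _).trans (by rw [hx, hIy]; norm_num))
    simp only [hB, polar]
    rw [norm_mul]
    refine (mul_le_mul_of_nonneg_left ((norm_add_le _ _).trans (add_le_add (norm_sub_le _ _)
      (((norm_mul _ _).trans (by rw [Complex.norm_I, one_mul])).le.trans
        (norm_sub_le _ _)))) (norm_nonneg _)).trans ?_
    norm_num
    linarith
  have bound : ∀ y x, ‖B h y x‖ ≤ 4 * C * ‖y‖ * ‖x‖ := by
    intro y x
    by_cases hy : y = 0
    · subst hy
      have : B h 0 x = 0 := by simpa using smul_left 0 0 x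
      simp [this]
    by_cases hx : x = 0
    · subst hx
      have : B h y 0 = 0 := by simpa using smul_right 0 y 0
      simp [this]
    have hy' : (‖y‖ : ℂ) ≠ 0 := by simpa using hy
    have hx' : (‖x‖ : ℂ) ≠ 0 := by simpa using hx
    have e1 : B h y x = (‖y‖ : ℂ) * ((‖x‖ : ℂ) *
        B h ((‖y‖ : ℂ)⁻¹ • y) ((‖x‖ : ℂ)⁻¹ • x)) := by
      rw [smul_right, smul_left]
      simp only [map_inv₀, Complex.conj_ofReal]
      field_simp
    have hn : ∀ v : 𝓗, v ≠ 0 → ‖(‖v‖ : ℂ)⁻¹ • v‖ = 1 := by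
      intro v hv
      rw [norm_smul, norm_inv, Complex.norm_real, norm_norm, inv_mul_cancel₀ (norm_ne_zero_iff.mpr hv)]
    have := bound1 _ _ (hn y hy) (hn x hx)
    rw [e1, norm_mul, norm_mul, Complex.norm_real, Complex.norm_real, norm_norm, norm_norm]
    calc ‖y‖ * (‖x‖ * _) ≤ ‖y‖ * (‖x‖ * (4 * C)) := by gcongr
      _ = _ := by ring
  let B₂ : 𝓗 →ₗ⋆[ℂ] 𝓗 →ₗ[ℂ] ℂ := LinearMap.mk₂'ₛₗ (starRingEnd ℂ) (RingHom.id ℂ) (B h) add_left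
    smul_left add_right smul_right
  let B₃ : 𝓗 →L⋆[ℂ] 𝓗 →L[ℂ] ℂ := LinearMap.mkContinuous₂ B₂ (4 * C) bound
  -- `continuousLinearMapOfBilin` places its operator in the left argument of the inner product; the
  -- adjoint moves it to the right.
  refine ⟨ContinuousLinearMap.adjoint (InnerProductSpace.continuousLinearMapOfBilin B₃), fun ψ => ?_⟩
  rw [ContinuousLinearMap.adjoint_inner_right, InnerProductSpace.continuousLinearMapOfBilin_apply]
  exact diag ψ

end RelMOI
end

/-! ### Functional calculi of bounded Borel functions -/

noncomputable section
namespace RelMOI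

variable {𝓗 : Type*} [NormedAddCommGroup 𝓗] [InnerProductSpace ℂ 𝓗]

theorem IsSigma.congr {Y : Type*} [MeasurableSpace Y] {L L' : (Y → ℂ) → ℂ} (hL : IsSigma L)
    (h : ∀ g, BddMeas g → L' g = L g) : IsSigma L' where
  add g k hg hk := by rw [h _ (hg.add hk), h _ hg, h _ hk, hL.add _ _ hg hk]
  smul c g hg := by rw [h _ ((BddMeas.const c).mul hg), h _ hg, hL.smul _ _ hg]
  lim g k C hm hC hl := by
    have hk : BddMeas k := ⟨measurable_of_tendsto_metrizable hm (tendsto_pi_nhds.mpr hl), C,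
      fun x => le_of_tendsto (hl x).norm (Eventually.of_forall fun n => hC n x)⟩
    rw [h k hk]
    exact (hL.lim g k C hm hC hl).congr fun n => (h _ ⟨hm n, C, hC n⟩).symm

variable [CompleteSpace 𝓗]

/-- A functional calculus for bounded measurable functions with scalar spectral measures `μ`. -/
structure IsCalculus {Y : Type*} [MeasurableSpace Y] (μ : 𝓗 → Measure Y)
    (Op : (Y → ℂ) → 𝓗 →L[ℂ] 𝓗) : Prop where
  finite : ∀ ψ, IsFiniteMeasure (μ ψ)
  inner_diag : ∀ g, BddMeas g → ∀ ψ, inner ℂ ψ (Op g ψ) = ∫ z, g z ∂(μ ψ)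
  mul : ∀ g h, BddMeas g → BddMeas h → Op (fun x => g x * h x) = Op g * Op h
  one : Op (fun _ => 1) = 1

section

variable {Y : Type*} [MeasurableSpace Y] {μ : 𝓗 → Measure Y} {Op : (Y → ℂ) → 𝓗 →L[ℂ] 𝓗}

theorem inner_eq_polar_of_diag (inner_diag : ∀ g, BddMeas g → ∀ ψ, inner ℂ ψ (Op g ψ) = ∫ z, g z ∂(μ ψ))
    {g : Y → ℂ} (hg : BddMeas g) (y x : 𝓗) :
    inner ℂ y (Op g x) = polar (fun ψ => ∫ z, g z ∂(μ ψ)) y x := by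
  have := polar_inner (Op g).toLinearMap y x
  simp only [ContinuousLinearMap.coe_coe, inner_diag g hg] at this
  exact this.symm

theorem isSigma_inner (finite : ∀ ψ, IsFiniteMeasure (μ ψ))
    (inner_diag : ∀ g, BddMeas g → ∀ ψ, inner ℂ ψ (Op g ψ) = ∫ z, g z ∂(μ ψ)) (y x : 𝓗) :
    IsSigma fun g => inner ℂ y (Op g x) :=
  (isSigma_polar finite y x).congr fun _ hg => inner_eq_polar_of_diag inner_diag hg y x

theorem op_star (inner_diag : ∀ g, BddMeas g → ∀ ψ, inner ℂ ψ (Op g ψ) = ∫ z, g z ∂(μ ψ))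
    {g : Y → ℂ} (hg : BddMeas g) : Op (fun x => starRingEnd ℂ (g x)) = star (Op g) := by
  refine ext_inner_diag fun ψ => ?_
  rw [inner_diag _ hg.star, integral_conj, ← inner_diag g hg,
    ContinuousLinearMap.star_eq_adjoint, ContinuousLinearMap.adjoint_inner_right, inner_conj_symm]

/-- Multiplicativity on a generating class of real functions implies multiplicativity. -/
theorem isCalculus_of_generating (finite : ∀ ψ, IsFiniteMeasure (μ ψ))
    (inner_diag : ∀ g, BddMeas g → ∀ ψ, inner ℂ ψ (Op g ψ) = ∫ z, g z ∂(μ ψ))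
    (one : Op (fun _ => 1) = 1) (S : Set (Y → ℂ)) (hSb : ∀ g ∈ S, BddMeas g)
    (hSr : ∀ g ∈ S, ∀ x, starRingEnd ℂ (g x) = g x)
    (gen : ∀ L : (Y → ℂ) → ℂ, IsSigma L → (∀ g ∈ S, L g = 0) → ∀ h, BddMeas h → L h = 0)
    (hmul : ∀ g ∈ S, ∀ h ∈ S, Op (fun x => g x * h x) = Op g * Op h) : IsCalculus μ Op where
  finite := finite
  inner_diag := inner_diag
  one := one
  mul := by
    -- For fixed `g`, both sides are σ-continuous in `h` after taking matrix elements, so it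
    -- suffices to test `h` in `S`. Multiplicativity is extended first in the right factor and then
    -- in the left one.
    have key : ∀ (T : 𝓗 →L[ℂ] 𝓗) (g : Y → ℂ), BddMeas g →
        (∀ h ∈ S, Op (fun x => g x * h x) = T * Op h) →
          ∀ h, BddMeas h → Op (fun x => g x * h x) = T * Op h := by
      intro T g hg hS h hh
      ext x
      refine ext_inner_left ℂ fun y => ?_
      have := gen _ (((isSigma_inner finite inner_diag y x).precomp_mul hg).sum_sub
        (isSigma_inner finite inner_diag (ContinuousLinearMap.adjoint T y) x)) (fun k hk => by
          rw [hS k hk, ContinuousLinearMap.adjoint_inner_left]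
          simp) h hh
      rw [sub_eq_zero.mp this, ContinuousLinearMap.adjoint_inner_left]
      rfl
    have step : ∀ s ∈ S, ∀ h, BddMeas h → Op (fun x => s x * h x) = Op s * Op h :=
      fun s hs h hh => key (Op s) s (hSb s hs) (hmul s hs) h hh
    intro g h hg hh
    refine key (Op g) g hg (fun s hs => ?_) h hh
    -- Adjoints reverse the order of a product. Applied to `s` times the conjugate of `g`, with `s`
    -- real, this puts `g` on the left, as `key` requires.
    have h1 := congrArg star (step s hs _ hg.star)
    rw [star_mul, ← op_star inner_diag ((hSb s hs).mul hg.star), ← op_star inner_diag hg.star,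
      ← op_star inner_diag (hSb s hs)] at h1
    simp only [map_mul, Complex.conj_conj, hSr s hs] at h1
    rw [← h1]
    congr 1
    ext x
    ring

end

namespace IsCalculus

variable {Y : Type*} [MeasurableSpace Y] {μ : 𝓗 → Measure Y} {Op : (Y → ℂ) → 𝓗 →L[ℂ] 𝓗}

theorem inner_eq_polar (hc : IsCalculus μ Op) {g : Y → ℂ} (hg : BddMeas g) (y x : 𝓗) :
    inner ℂ y (Op g x) = polar (fun ψ => ∫ z, g z ∂(μ ψ)) y x :=
  inner_eq_polar_of_diag hc.inner_diag hg y x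

theorem star (hc : IsCalculus μ Op) {g : Y → ℂ} (hg : BddMeas g) :
    Op (fun x => starRingEnd ℂ (g x)) = Star.star (Op g) := op_star hc.inner_diag hg

theorem add (hc : IsCalculus μ Op) {g h : Y → ℂ} (hg : BddMeas g) (hh : BddMeas h) :
    Op (fun x => g x + h x) = Op g + Op h := by
  ext x
  refine ext_inner_left ℂ fun y => ?_
  rw [(isSigma_inner hc.finite hc.inner_diag y x).add g h hg hh, add_apply, inner_add_right]

theorem smul (hc : IsCalculus μ Op) (c : ℂ) {g : Y → ℂ} (hg : BddMeas g) :
    Op (fun x => c * g x) = c • Op g := by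
  ext x
  refine ext_inner_left ℂ fun y => ?_
  rw [(isSigma_inner hc.finite hc.inner_diag y x).smul c g hg, smul_apply, inner_smul_right]

theorem sub (hc : IsCalculus μ Op) {g h : Y → ℂ} (hg : BddMeas g) (hh : BddMeas h) :
    Op (fun x => g x - h x) = Op g - Op h := by
  ext x
  refine ext_inner_left ℂ fun y => ?_
  rw [(isSigma_inner hc.finite hc.inner_diag y x).map_sub hg hh, sub_apply, inner_sub_right]

theorem const (hc : IsCalculus μ Op) (c : ℂ) : Op (fun _ => c) = c • 1 := by
  rw [← hc.one, ← hc.smul c (BddMeas.const 1)]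
  simp

/-- Multiplicativity applied to the conjugate of `g` times `g`. Through this isometry, norm bounds
and strong limits in the calculus become statements about integrals. -/
theorem norm_sq (hc : IsCalculus μ Op) {g : Y → ℂ} (hg : BddMeas g) (ψ : 𝓗) :
    ‖Op g ψ‖ ^ 2 = ∫ z, ‖g z‖ ^ 2 ∂(μ ψ) := by
  have h1 := hc.inner_diag _ (hg.star.mul hg) ψ
  rw [hc.mul _ _ hg.star hg, hc.star hg, ContinuousLinearMap.star_eq_adjoint,
    mul_apply_eq_comp, ContinuousLinearMap.adjoint_inner_right,
    inner_self_eq_norm_sq_to_K] at h1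
  simp only [Complex.conj_mul'] at h1
  have h2 : ∫ z, ((‖g z‖ : ℂ)) ^ 2 ∂(μ ψ) = ((∫ z, ‖g z‖ ^ 2 ∂(μ ψ) : ℝ) : ℂ) := by
    rw [← integral_complex_ofReal]
    simp
  rw [h2] at h1
  exact Complex.ofReal_injective (by simpa using h1)

theorem mass (hc : IsCalculus μ Op) (ψ : 𝓗) : (μ ψ).real Set.univ = ‖ψ‖ ^ 2 := by
  have := hc.norm_sq (BddMeas.const 1) ψ
  rw [hc.one] at this
  simpa using this.symm

theorem norm_le (hc : IsCalculus μ Op) {g : Y → ℂ} (hg : Measurable g) {C : ℝ} (hC0 : 0 ≤ C)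
    (hC : ∀ x, ‖g x‖ ≤ C) : ‖Op g‖ ≤ C := by
  refine ContinuousLinearMap.opNorm_le_bound _ hC0 fun ψ => ?_
  have := hc.finite ψ
  refine (pow_le_pow_iff_left₀ (norm_nonneg _) (by positivity) two_ne_zero).mp ?_
  rw [hc.norm_sq ⟨hg, C, hC⟩, mul_pow, ← hc.mass ψ, mul_comm]
  calc ∫ z, ‖g z‖ ^ 2 ∂(μ ψ) ≤ ∫ _, C ^ 2 ∂(μ ψ) := by
        refine integral_mono_of_nonneg (Eventually.of_forall fun z => by positivity)
          (integrable_const _) (Eventually.of_forall fun z => ?_)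
        exact pow_le_pow_left₀ (norm_nonneg _) (hC z) 2
    _ = _ := by rw [integral_const, smul_eq_mul]

/-- By `norm_sq` the squared distance is ∫ |g_n - h|² dμ_ψ, and dominated convergence applies.
General countably generated filters are allowed because unconditional sums run over finite sets. -/
theorem tendsto (hc : IsCalculus μ Op) {ι : Type*} {l : Filter ι} [l.IsCountablyGenerated]
    {g : ι → Y → ℂ} {h : Y → ℂ} {C : ℝ} (hm : ∀ n, Measurable (g n)) (hh : BddMeas h)
    (hC : ∀ n x, ‖g n x‖ ≤ C)
    (hl : ∀ x, Tendsto (fun n => g n x) l (𝓝 (h x))) (ψ : 𝓗) :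
    Tendsto (fun n => Op (g n) ψ) l (𝓝 (Op h ψ)) := by
  have := hc.finite ψ
  obtain ⟨D, hD0, hD⟩ := hh.exists_nonneg
  have hgn : ∀ n, BddMeas (g n) := fun n => ⟨hm n, C, hC n⟩
  rw [tendsto_iff_norm_sub_tendsto_zero]
  have h1 : Tendsto (fun n => ‖Op (g n) ψ - Op h ψ‖ ^ 2) l (𝓝 0) := by
    have e : ∀ n, ‖Op (g n) ψ - Op h ψ‖ ^ 2 = ∫ z, ‖g n z - h z‖ ^ 2 ∂(μ ψ) := by
      intro n
      rw [← hc.norm_sq ((hgn n).sub hh), hc.sub (hgn n) hh]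
      rfl
    simp only [e]
    have := tendsto_integral_filter_of_dominated_convergence (μ := μ ψ) (l := l)
      (F := fun n z => ‖g n z - h z‖ ^ 2) (f := fun _ => (0 : ℝ)) (fun _ => (C + D) ^ 2)
      (Eventually.of_forall fun n => ((((hm n).sub hh.1).norm).pow_const 2).aestronglyMeasurable)
      (Eventually.of_forall fun n => Eventually.of_forall fun z => by
        rw [Real.norm_of_nonneg (by positivity)]
        exact pow_le_pow_left₀ (norm_nonneg _)
          ((norm_sub_le _ _).trans (add_le_add (hC n z) (hD z))) 2)
      (integrable_const _)
      (Eventually.of_forall fun z => by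
        have := ((hl z).sub_const (h z)).norm.pow 2
        simpa using this)
    simpa using this
  have h2 := h1.sqrt
  simpa [Real.sqrt_sq] using h2

/-- Pushing a calculus forward along a measurable map. -/
theorem map (hc : IsCalculus μ Op) {Z : Type*} [MeasurableSpace Z] {k : Y → Z}
    (hk : Measurable k) :
    IsCalculus (fun ψ => (μ ψ).map k) (fun g => Op (fun x => g (k x))) where
  finite ψ := by
    have := hc.finite ψ
    infer_instance
  inner_diag g hg ψ := by
    rw [hc.inner_diag _ (hg.comp hk), integral_map hk.aemeasurable hg.1.aestronglyMeasurable]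
  mul g h hg hh := hc.mul _ _ (hg.comp hk) (hh.comp hk)
  one := hc.one

end IsCalculus

/-! ### Integration against projection-valued measures -/

theorem isSigma_gen_indicator {Y : Type*} [MeasurableSpace Y] (L : (Y → ℂ) → ℂ) (hL : IsSigma L)
    (h : ∀ g ∈ {g : Y → ℂ | ∃ s, MeasurableSet s ∧ g = s.indicator fun _ => 1}, L g = 0)
    (k : Y → ℂ) (hk : BddMeas k) : L k = 0 :=
  hL.eq_zero_of_indicator (fun s hs => h _ ⟨s, hs, rfl⟩) hk

namespace PVM

theorem scalar_apply (P : PVM 𝓗) (ψ : 𝓗) {s : Set ℝ} (hs : MeasurableSet s) :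
    P.scalar ψ s = ENNReal.ofReal (‖P.proj s ψ‖ ^ 2) :=
  Measure.ofMeasurable_apply s hs

theorem scalar_finite (P : PVM 𝓗) (ψ : 𝓗) : IsFiniteMeasure (P.scalar ψ) :=
  ⟨by rw [P.scalar_apply ψ MeasurableSet.univ]; exact ENNReal.ofReal_lt_top⟩

theorem integral_indicator_scalar (P : PVM 𝓗) (ψ : 𝓗) {s : Set ℝ} (hs : MeasurableSet s) :
    ∫ x, s.indicator (fun _ => (1 : ℂ)) x ∂(P.scalar ψ) = inner ℂ ψ (P.proj s ψ) := by
  have := P.scalar_finite ψ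
  rw [integral_indicator hs, P.inner_proj hs]
  simp [Measure.real, P.scalar_apply ψ hs]

theorem exists_isIntegral (P : PVM 𝓗) {g : ℝ → ℂ} (hg : BddMeas g) : ∃ A, P.IsIntegral g A := by
  refine exists_operator_of_generating P.scalar_finite (fun ψ => ?_) _ isSigma_gen_indicator ?_ hg
  · simp [Measure.real, P.scalar_apply ψ MeasurableSet.univ, P.proj_univ]
  · rintro _ ⟨s, hs, rfl⟩
    exact ⟨P.proj s, fun ψ => (P.integral_indicator_scalar ψ hs).symm⟩

theorem isIntegral_integral (P : PVM 𝓗) {g : ℝ → ℂ} (hg : BddMeas g) :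
    P.IsIntegral g (P.integral g) := by
  have h := P.exists_isIntegral hg
  rw [PVM.integral, dif_pos h]
  exact h.choose_spec

theorem integral_indicator (P : PVM 𝓗) {s : Set ℝ} (hs : MeasurableSet s) :
    P.integral (s.indicator fun _ => 1) = P.proj s := by
  refine ext_inner_diag fun ψ => ?_
  rw [P.isIntegral_integral (BddMeas.indicator hs), P.integral_indicator_scalar ψ hs]

theorem isCalculus (P : PVM 𝓗) : IsCalculus P.scalar P.integral := by
  refine isCalculus_of_generating P.scalar_finite (fun g hg => P.isIntegral_integral hg) ?_ _ ?_ ?_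
    isSigma_gen_indicator ?_
  · rw [← P.proj_univ, ← P.integral_indicator MeasurableSet.univ]
    simp
  · rintro _ ⟨s, hs, rfl⟩
    exact BddMeas.indicator hs
  · rintro _ ⟨s, hs, rfl⟩ x
    by_cases hx : x ∈ s <;> simp [hx]
  · rintro _ ⟨s, hs, rfl⟩ _ ⟨t, ht, rfl⟩
    rw [P.integral_indicator hs, P.integral_indicator ht, ← P.proj_inter s t hs ht,
      ← P.integral_indicator (hs.inter ht)]
    congr 1
    ext x
    by_cases hx : x ∈ s <;> by_cases hx' : x ∈ t <;> simp [hx, hx']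

end PVM

/-- A calculus on the line comes from a projection-valued measure. -/
def IsCalculus.toPVM {μ : 𝓗 → Measure ℝ} {Op : (ℝ → ℂ) → 𝓗 →L[ℂ] 𝓗} (hc : IsCalculus μ Op) :
    PVM 𝓗 where
  proj s := Op (s.indicator fun _ => 1)
  isStarProjection s hs := by
    constructor
    · have := hc.mul _ _ (BddMeas.indicator hs) (BddMeas.indicator hs)
      rw [IsIdempotentElem, ← this]
      congr 1
      ext x
      by_cases hx : x ∈ s <;> simp [hx]
    · have := hc.star (BddMeas.indicator hs)
      rw [IsSelfAdjoint, ← this]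
      congr 1
      ext x
      by_cases hx : x ∈ s <;> simp [hx]
  proj_empty := by
    have := hc.const 0
    simpa using this
  proj_univ := by simpa using hc.one
  proj_inter s t hs ht := by
    rw [← hc.mul _ _ (BddMeas.indicator hs) (BddMeas.indicator ht)]
    congr 1
    ext x
    by_cases hx : x ∈ s <;> by_cases hx' : x ∈ t <;> simp [hx, hx']
  hasSum_proj s hs hd ψ := by
    -- Finite partial sums are single indicators of finite unions, so σ-additivity becomes bounded
    -- pointwise convergence along finite sets.
    have e : ∀ F : Finset ℕ, ∑ i ∈ F, Op ((s i).indicator fun _ => 1) ψ =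
        Op ((⋃ i ∈ F, s i).indicator fun _ => 1) ψ := by
      intro F
      induction F using Finset.induction_on with
      | empty =>
        have := hc.const 0
        simp only [zero_smul] at this
        simp [this]
      | insert a F ha ih =>
        rw [Finset.sum_insert ha, ih, ← add_apply,
          ← hc.add (BddMeas.indicator (hs a))
            (BddMeas.indicator (Finset.measurableSet_biUnion F fun i _ => hs i))]
        congr 2
        have hdis : Disjoint (s a) (⋃ i ∈ F, s i) := by
          simp only [Set.disjoint_iUnion_right]
          intro i hi
          exact hd (fun h => ha (h ▸ hi))
        rw [Finset.set_biUnion_insert, Set.indicator_union_of_disjoint hdis]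
    rw [HasSum]
    simp only [SummationFilter.unconditional_filter, e]
    refine hc.tendsto (C := 1) (fun F => (BddMeas.indicator
      (Finset.measurableSet_biUnion F fun i _ => hs i)).1) (BddMeas.indicator
      (MeasurableSet.iUnion hs)) (fun F x => ?_) (fun x => ?_) ψ
    · by_cases hx : x ∈ ⋃ i ∈ F, s i
      · rw [Set.indicator_of_mem hx]; simp
      · rw [Set.indicator_of_notMem hx]; simp
    · by_cases hx : x ∈ ⋃ i, s i
      · obtain ⟨i, hi⟩ := Set.mem_iUnion.mp hx
        refine tendsto_const_nhds.congr' ?_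
        filter_upwards [eventually_ge_atTop ({i} : Finset ℕ)] with F hF
        rw [Set.indicator_of_mem hx, Set.indicator_of_mem]
        exact Set.mem_biUnion (Finset.mem_coe.mpr (hF (Finset.mem_singleton_self i))) hi
      · refine tendsto_const_nhds.congr fun n => ?_
        rw [Set.indicator_of_notMem hx, Set.indicator_of_notMem]
        intro h
        obtain ⟨i, _, hi⟩ := Set.mem_iUnion₂.mp h
        exact hx (Set.mem_iUnion.mpr ⟨i, hi⟩)

theorem IsCalculus.toPVM_scalar {μ : 𝓗 → Measure ℝ} {Op : (ℝ → ℂ) → 𝓗 →L[ℂ] 𝓗}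
    (hc : IsCalculus μ Op) (ψ : 𝓗) : hc.toPVM.scalar ψ = μ ψ := by
  have := hc.finite ψ
  ext s hs
  rw [PVM.scalar_apply _ _ hs]
  change ENNReal.ofReal (‖Op (s.indicator fun _ => 1) ψ‖ ^ 2) = _
  rw [hc.norm_sq (BddMeas.indicator hs)]
  have : (fun z => ‖s.indicator (fun _ => (1 : ℂ)) z‖ ^ 2) = s.indicator fun _ => (1 : ℝ) := by
    ext x
    by_cases hx : x ∈ s <;> simp [hx]
  rw [this, integral_indicator_const _ hs]
  simp [Measure.real]

end RelMOI
end

noncomputable section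
namespace RelMOI

/-! ### Self-adjoint operators and relatively bounded perturbations -/

variable {𝓗 : Type*} [NormedAddCommGroup 𝓗] [InnerProductSpace ℂ 𝓗]

/-- `R = (H - iκ)⁻¹`. -/
def IsResolventAt (H : 𝓗 →ₗ.[ℂ] 𝓗) (κ : ℝ) (R : 𝓗 →L[ℂ] 𝓗) : Prop :=
  (∀ ψ : 𝓗, (R ψ, ψ + (Complex.I * κ) • R ψ) ∈ H.graph) ∧
    ∀ x : H.domain, R (H x - (Complex.I * κ) • (x : 𝓗)) = x

theorem isResolventAt_one_iff {H : 𝓗 →ₗ.[ℂ] 𝓗} {R : 𝓗 →L[ℂ] 𝓗} :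
    IsResolventAt H 1 R ↔ IsResolvent H R := by
  simp [IsResolventAt, IsResolvent]

theorem apply_eq_of_mem_graph {H : 𝓗 →ₗ.[ℂ] 𝓗} {x y : 𝓗} (h : (x, y) ∈ H.graph) :
    ∃ hx : x ∈ H.domain, H ⟨x, hx⟩ = y := by
  obtain ⟨z, hz1, hz2⟩ := (LinearPMap.mem_graph_iff H).mp h
  simp only at hz1 hz2
  subst hz1
  exact ⟨z.2, hz2⟩

theorem mem_graph_of_apply {H : 𝓗 →ₗ.[ℂ] 𝓗} {x y : 𝓗} (hx : x ∈ H.domain) (h : H ⟨x, hx⟩ = y) :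
    (x, y) ∈ H.graph := by
  rw [← h]
  exact H.mem_graph ⟨x, hx⟩

/-- By symmetry ⟪Hx, x⟫ is real, so the cross term has real part zero. Dropping either summand gives
the lower bounds behind injectivity, closed range and the estimate for V(H - iκ)⁻¹. -/
theorem norm_sq_sub_I_smul {H : 𝓗 →ₗ.[ℂ] 𝓗} (hs : H.IsFormalAdjoint H) (κ : ℝ) (x : H.domain) :
    ‖H x - (Complex.I * κ) • (x : 𝓗)‖ ^ 2 = ‖H x‖ ^ 2 + κ ^ 2 * ‖(x : 𝓗)‖ ^ 2 := by
  have h1 := hs x x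
  have h2 : (inner ℂ (H x) (x : 𝓗)).im = 0 := by
    have h3 := inner_conj_symm (𝕜 := ℂ) (H x) (x : 𝓗)
    rw [← h1] at h3
    exact Complex.conj_eq_iff_im.mp h3
  rw [@norm_sub_sq ℂ]
  rw [inner_smul_right, norm_smul]
  simp only [norm_mul, Complex.norm_I, Complex.norm_real, one_mul, RCLike.re_to_complex,
    Complex.mul_re, Complex.I_re, Complex.I_im, Complex.ofReal_re, Complex.ofReal_im, h2,
    Complex.mul_im]
  rw [mul_pow, Real.norm_eq_abs, sq_abs]
  ring

theorem norm_apply_le_of_symm {H : 𝓗 →ₗ.[ℂ] 𝓗} (hs : H.IsFormalAdjoint H) (κ : ℝ) (x : H.domain) :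
    ‖H x‖ ≤ ‖H x - (Complex.I * κ) • (x : 𝓗)‖ := by
  refine (pow_le_pow_iff_left₀ (norm_nonneg _) (norm_nonneg _) two_ne_zero).mp ?_
  rw [norm_sq_sub_I_smul hs]
  have := mul_nonneg (sq_nonneg κ) (sq_nonneg ‖(x : 𝓗)‖)
  linarith

theorem mul_norm_le_of_symm {H : 𝓗 →ₗ.[ℂ] 𝓗} (hs : H.IsFormalAdjoint H) (κ : ℝ) (x : H.domain) :
    |κ| * ‖(x : 𝓗)‖ ≤ ‖H x - (Complex.I * κ) • (x : 𝓗)‖ := by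
  refine (pow_le_pow_iff_left₀ (by positivity) (norm_nonneg _) two_ne_zero).mp ?_
  rw [norm_sq_sub_I_smul hs, mul_pow, sq_abs]
  have := sq_nonneg ‖H x‖
  linarith

theorem isResolventAt_of_surjective {H : 𝓗 →ₗ.[ℂ] 𝓗} (hs : H.IsFormalAdjoint H) {κ : ℝ}
    (hκ : κ ≠ 0) (h : ∀ ψ : 𝓗, ∃ x : H.domain, H x - (Complex.I * κ) • (x : 𝓗) = ψ) :
    ∃ R, IsResolventAt H κ R := by
  have hκ' : 0 < |κ| := abs_pos.mpr hκ
  let T : H.domain →ₗ[ℂ] 𝓗 := H.toFun - (Complex.I * κ) • H.domain.subtype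
  have hT : ∀ x, T x = H x - (Complex.I * κ) • (x : 𝓗) := fun x => rfl
  have hinj : Function.Injective T := by
    rw [← LinearMap.ker_eq_bot, LinearMap.ker_eq_bot']
    intro x hx
    have := mul_norm_le_of_symm hs κ x
    rw [← hT, hx, norm_zero] at this
    have h0 : ‖(x : 𝓗)‖ = 0 := le_antisymm (by nlinarith) (norm_nonneg _)
    exact Subtype.ext (norm_eq_zero.mp h0)
  let e := LinearEquiv.ofBijective T ⟨hinj, fun ψ => (h ψ).imp fun x hx => hx⟩
  have he : ∀ ψ, H (e.symm ψ) - (Complex.I * κ) • (e.symm ψ : 𝓗) = ψ := fun ψ =>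
    e.apply_symm_apply ψ
  let R : 𝓗 →L[ℂ] 𝓗 := LinearMap.mkContinuous (H.domain.subtype ∘ₗ e.symm.toLinearMap) |κ|⁻¹
    (fun ψ => by
      have := mul_norm_le_of_symm hs κ (e.symm ψ)
      rw [he] at this
      change ‖(e.symm ψ : 𝓗)‖ ≤ _
      rw [inv_mul_eq_div, le_div_iff₀ hκ', mul_comm]
      exact this)
  refine ⟨R, fun ψ => mem_graph_of_apply (e.symm ψ).2 ?_, fun x => ?_⟩
  · change H (e.symm ψ) = ψ + (Complex.I * κ) • (e.symm ψ : 𝓗)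
    exact sub_eq_iff_eq_add.mp (he ψ)
  · change (e.symm (T x) : 𝓗) = x
    rw [show T x = e x from rfl, e.symm_apply_apply]

variable [CompleteSpace 𝓗]

theorem isFormalAdjoint_self {H : 𝓗 →ₗ.[ℂ] 𝓗} (hH : IsSelfAdjoint H) : H.IsFormalAdjoint H := by
  have := LinearPMap.adjoint_isFormalAdjoint hH.dense_domain
  rwa [LinearPMap.isSelfAdjoint_def.mp hH] at this

/-- The range is closed, since H is closed and H - iκ is bounded below. A vector orthogonal to it
lies in the kernel of H* + iκ = H + iκ, which is trivial by the lower bound for -κ. -/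
theorem sub_I_smul_surjective {H : 𝓗 →ₗ.[ℂ] 𝓗} (hH : IsSelfAdjoint H) {κ : ℝ} (hκ : κ ≠ 0)
    (ψ : 𝓗) : ∃ x : H.domain, H x - (Complex.I * κ) • (x : 𝓗) = ψ := by
  have hs := isFormalAdjoint_self hH
  have hκ' : 0 < |κ| := abs_pos.mpr hκ
  let T : H.domain →ₗ[ℂ] 𝓗 := H.toFun - (Complex.I * κ) • H.domain.subtype
  have hT : ∀ x, T x = H x - (Complex.I * κ) • (x : 𝓗) := fun x => rfl
  have hclosed : IsClosed (LinearMap.range T : Set 𝓗) := by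
    refine isClosed_of_closure_subset fun φ hφ => ?_
    obtain ⟨v, hv, hlim⟩ := mem_closure_iff_seq_limit.mp hφ
    choose x hx using hv
    have hc : CauchySeq fun n => (x n : 𝓗) := by
      refine Metric.cauchySeq_iff.mpr fun ε hε => ?_
      obtain ⟨N, hN⟩ := Metric.cauchySeq_iff.mp hlim.cauchySeq (|κ| * ε) (by positivity)
      refine ⟨N, fun m hm n hn => ?_⟩
      have h1 := hN m hm n hn
      rw [dist_eq_norm, ← hx, ← hx, ← map_sub] at h1
      have h2 := mul_norm_le_of_symm hs κ (x m - x n)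
      rw [← hT] at h2
      rw [dist_eq_norm]
      exact lt_of_mul_lt_mul_left (lt_of_le_of_lt h2 h1) hκ'.le
    obtain ⟨y, hy⟩ := cauchySeq_tendsto_of_complete hc
    have h3 : Tendsto (fun n => ((x n : 𝓗), H (x n))) atTop (𝓝 (y, φ + (Complex.I * κ) • y)) := by
      refine hy.prodMk_nhds ((hlim.add (hy.const_smul (Complex.I * κ))).congr fun n => ?_)
      rw [← hx n, hT]
      abel
    have h4 := hH.isClosed.mem_of_tendsto h3 (Eventually.of_forall fun n => H.mem_graph (x n))
    obtain ⟨hy1, hy2⟩ := apply_eq_of_mem_graph h4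
    exact ⟨⟨y, hy1⟩, by rw [hT, hy2]; simp⟩
  have horth : (LinearMap.range T)ᗮ = ⊥ := by
    rw [Submodule.eq_bot_iff]
    intro y hy
    have h1 : ∀ x : H.domain, inner ℂ (-(Complex.I * κ) • y) (x : 𝓗) = inner ℂ y (H x) := by
      intro x
      have := (Submodule.mem_orthogonal' _ _).mp hy (T x) ⟨x, rfl⟩
      rw [hT, inner_sub_right, sub_eq_zero, inner_smul_right] at this
      rw [this, inner_smul_left]
      simp
    have h2 : y ∈ H.adjoint.domain := LinearPMap.mem_adjoint_domain_of_exists y ⟨_, h1⟩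
    have h3 : H.adjoint ⟨y, h2⟩ = -(Complex.I * κ) • y :=
      LinearPMap.adjoint_apply_eq hH.dense_domain ⟨y, h2⟩ h1
    have h4 : (y, -(Complex.I * κ) • y) ∈ H.adjoint.graph := mem_graph_of_apply h2 h3
    rw [LinearPMap.isSelfAdjoint_def.mp hH] at h4
    obtain ⟨h5, h6⟩ := apply_eq_of_mem_graph h4
    have h7 := mul_norm_le_of_symm hs (-κ) ⟨y, h5⟩
    rw [h6] at h7
    simp only [Complex.ofReal_neg, mul_neg, neg_smul, sub_self, norm_zero, abs_neg] at h7
    have h0 : ‖y‖ = 0 := le_antisymm (by nlinarith) (norm_nonneg _)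
    exact norm_eq_zero.mp h0
  have htop : LinearMap.range T = ⊤ := by
    have : CompleteSpace (LinearMap.range T) := hclosed.completeSpace_coe
    exact Submodule.orthogonal_eq_bot_iff.mp horth
  have : ψ ∈ LinearMap.range T := htop ▸ Submodule.mem_top
  exact this

theorem exists_isResolventAt {H : 𝓗 →ₗ.[ℂ] 𝓗} (hH : IsSelfAdjoint H) {κ : ℝ} (hκ : κ ≠ 0) :
    ∃ R, IsResolventAt H κ R :=
  isResolventAt_of_surjective (isFormalAdjoint_self hH) hκ (sub_I_smul_surjective hH hκ)

theorem isResolvent_resolvent {H : 𝓗 →ₗ.[ℂ] 𝓗} (hH : IsSelfAdjoint H) :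
    IsResolvent H (resolvent H) := by
  have h : ∃ R, IsResolvent H R := by
    obtain ⟨R, hR⟩ := exists_isResolventAt hH one_ne_zero
    exact ⟨R, isResolventAt_one_iff.mp hR⟩
  rw [resolvent, dif_pos h]
  exact h.choose_spec

/-- A symmetric operator such that both `A ∓ iκ` are onto is self-adjoint. -/
theorem isSelfAdjoint_of_surjective {A : 𝓗 →ₗ.[ℂ] 𝓗} (hs : A.IsFormalAdjoint A)
    (hd : Dense (A.domain : Set 𝓗)) (κ : ℝ)
    (h1 : ∀ ψ : 𝓗, ∃ x : A.domain, A x - (Complex.I * κ) • (x : 𝓗) = ψ)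
    (h2 : ∀ ψ : 𝓗, ∃ x : A.domain, A x + (Complex.I * κ) • (x : 𝓗) = ψ) : IsSelfAdjoint A := by
  rw [LinearPMap.isSelfAdjoint_def]
  have hle := LinearPMap.IsFormalAdjoint.le_adjoint hd hs
  refine (LinearPMap.eq_of_le_of_domain_eq hle (le_antisymm hle.1 fun y hy => ?_)).symm
  -- This choice makes A* - iκ annihilate y - x. So y - x is orthogonal to the range of A + iκ,
  -- which is everything, and y = x lies in the domain of A.
  obtain ⟨x, hx⟩ := h1 (A.adjoint ⟨y, hy⟩ - (Complex.I * κ) • y)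
  suffices h : y - (x : 𝓗) = 0 by
    rw [sub_eq_zero] at h
    rw [h]
    exact x.2
  obtain ⟨w, hw⟩ := h2 (y - x)
  rw [← inner_self_eq_zero (𝕜 := ℂ)]
  nth_rewrite 2 [← hw]
  have e1 := LinearPMap.adjoint_isFormalAdjoint hd ⟨y, hy⟩ w
  have e2 := hs x w
  simp only at e1 e2
  rw [inner_sub_left, inner_add_right, inner_add_right, ← e1, ← e2, inner_smul_right,
    inner_smul_right]
  have e3 := congrArg (fun v => inner ℂ v (w : 𝓗)) hx
  simp only [inner_sub_left, inner_smul_left, map_mul, Complex.conj_I, Complex.conj_ofReal] at e3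
  linear_combination -e3

/-! ### Relatively bounded perturbations -/

section Perturbation

variable {H V : 𝓗 →ₗ.[ℂ] 𝓗}

theorem pert_domain (hd : H.domain ≤ V.domain) (c : ℂ) : (H + c • V).domain = H.domain := by
  rw [LinearPMap.add_domain, LinearPMap.smul_domain]
  exact inf_eq_left.mpr hd

theorem pert_apply (hd : H.domain ≤ V.domain) (c : ℂ) {x : 𝓗} (hx : x ∈ H.domain)
    (hx' : x ∈ (H + c • V).domain) : (H + c • V) ⟨x, hx'⟩ = H ⟨x, hx⟩ + c • V ⟨x, hd hx⟩ := by
  rw [LinearPMap.add_apply, LinearPMap.smul_apply]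

theorem pert_zero (hd : H.domain ≤ V.domain) : H + (0 : ℂ) • V = H := by
  refine LinearPMap.ext (pert_domain hd 0) fun x hx hx' => ?_
  rw [pert_apply hd 0 hx']
  simp

theorem pert_symm (hd : H.domain ≤ V.domain) (hs : H.IsFormalAdjoint H) (hV : V.IsFormalAdjoint V)
    (t : ℝ) : (H + (t : ℂ) • V).IsFormalAdjoint (H + (t : ℂ) • V) := by
  rintro ⟨x, hx⟩ ⟨y, hy⟩
  have hx' := hx
  have hy' := hy
  rw [pert_domain hd] at hx' hy'
  rw [pert_apply hd _ hx', pert_apply hd _ hy']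
  have h1 := hs ⟨x, hx'⟩ ⟨y, hy'⟩
  have h2 := hV ⟨x, hd hx'⟩ ⟨y, hd hy'⟩
  simp only at h1 h2 ⊢
  rw [inner_add_left, inner_add_right, inner_smul_left, inner_smul_right, h1, h2]
  simp

/-- The relative bound is an infimum that need not be attained; the strict inequality leaves room
for an attained constant. At t = 0 any constant will do. -/
theorem exists_relBound_lt (hHV : IsRelBounded H V) {t : ℝ} (ht : t ∈ symmInterval (relBound H V)) :
    ∃ a b : ℝ, 0 ≤ a ∧ 0 ≤ b ∧ |t| * a < 1 ∧
      ∀ (x : 𝓗) (hx : x ∈ H.domain), ‖V ⟨x, hHV.1 hx⟩‖ ≤ a * ‖H ⟨x, hx⟩‖ + b * ‖x‖ := by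
  have key : ∃ a ∈ relBoundSet H V, |t| * a < 1 := by
    rcases eq_or_ne t 0 with rfl | h0
    · obtain ⟨a, ha⟩ := hHV.2
      exact ⟨a, ha, by simp⟩
    · have hpos : 0 < |t| := abs_pos.mpr h0
      have h1 : relBound H V < 1 / |t| := by
        rw [lt_div_iff₀ hpos, mul_comm]
        exact ht
      obtain ⟨a, ha, hlt⟩ := exists_lt_of_csInf_lt hHV.2 h1
      exact ⟨a, ha, by rwa [lt_div_iff₀ hpos, mul_comm] at hlt⟩
  obtain ⟨a, ⟨ha, b, hb, h⟩, hlt⟩ := key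
  exact ⟨a, b, ha, hb, hlt, fun x hx => h ⟨x, hx⟩ ⟨x, hHV.1 hx⟩ rfl⟩

/-- A relatively bounded operator times the resolvent is bounded. -/
theorem exists_product_resolventAt (hs : H.IsFormalAdjoint H) (hd : H.domain ≤ V.domain) {a b κ : ℝ}
    (ha : 0 ≤ a) (hb : 0 ≤ b) (hκ : κ ≠ 0)
    (h : ∀ (x : 𝓗) (hx : x ∈ H.domain), ‖V ⟨x, hd hx⟩‖ ≤ a * ‖H ⟨x, hx⟩‖ + b * ‖x‖)
    {R : 𝓗 →L[ℂ] 𝓗} (hR : IsResolventAt H κ R) :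
    ∃ W : 𝓗 →L[ℂ] 𝓗, IsBoundedProduct V R W ∧ ‖W‖ ≤ a + b / |κ| := by
  have hκ' : 0 < |κ| := abs_pos.mpr hκ
  have hdom : ∀ ψ, R ψ ∈ H.domain := fun ψ => (apply_eq_of_mem_graph (hR.1 ψ)).1
  let W₀ : 𝓗 →ₗ[ℂ] 𝓗 := V.toFun ∘ₗ (LinearMap.codRestrict V.domain R.toLinearMap
    fun ψ => hd (hdom ψ))
  have hb' : ∀ ψ, ‖W₀ ψ‖ ≤ (a + b / |κ|) * ‖ψ‖ := by
    intro ψ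
    obtain ⟨h1, h2⟩ := apply_eq_of_mem_graph (hR.1 ψ)
    have h3 : H ⟨R ψ, h1⟩ - (Complex.I * κ) • R ψ = ψ := by rw [h2]; simp
    have h4 := norm_apply_le_of_symm hs κ ⟨R ψ, h1⟩
    have h5 := mul_norm_le_of_symm hs κ ⟨R ψ, h1⟩
    simp only [h3] at h4 h5
    have h6 : ‖R ψ‖ ≤ ‖ψ‖ / |κ| := by rwa [le_div_iff₀ hκ', mul_comm]
    calc ‖W₀ ψ‖ ≤ a * ‖H ⟨R ψ, h1⟩‖ + b * ‖R ψ‖ := h (R ψ) h1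
      _ ≤ a * ‖ψ‖ + b * (‖ψ‖ / |κ|) := by gcongr
      _ = _ := by ring
  exact ⟨W₀.mkContinuous _ hb', fun ψ => mem_graph_of_apply (hd (hdom ψ)) rfl,
    LinearMap.mkContinuous_norm_le _ (by positivity) _⟩

/-- The Kato–Rellich theorem. -/
theorem isSelfAdjoint_pert (hH : IsSelfAdjoint H) (hV : V.IsFormalAdjoint V)
    (hHV : IsRelBounded H V) {t : ℝ} (ht : t ∈ symmInterval (relBound H V)) :
    IsSelfAdjoint (H + (t : ℂ) • V) := by
  have hs := isFormalAdjoint_self hH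
  have hd := hHV.1
  obtain ⟨a, b, ha, hb, hlt, hbd⟩ := exists_relBound_lt hHV ht
  -- The quantity a + b/κ bounds V(H ∓ iκ)⁻¹. For large κ it is close to a, so the Neumann series
  -- for 1 + tV(H ∓ iκ)⁻¹ converges; the summand 1 in the witness keeps κ positive and the
  -- inequality strict.
  obtain ⟨κ, hκ0, hκ⟩ : ∃ κ : ℝ, 0 < κ ∧ |t| * (a + b / κ) < 1 := by
    have hpos : 0 < 1 - |t| * a := by linarith
    refine ⟨|t| * b / (1 - |t| * a) + 1, by positivity, ?_⟩
    have h1 : |t| * (b / (|t| * b / (1 - |t| * a) + 1)) < 1 - |t| * a := by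
      rw [← mul_div_assoc, div_lt_iff₀ (by positivity), mul_add, mul_div_cancel₀ _ hpos.ne']
      linarith
    linarith
  -- With R = (H - iκ')⁻¹ and W = VR one has (H + tV - iκ')R = 1 + tW. The right side is invertible,
  -- so x = R(1 + tW)⁻¹ψ solves the equation. Both signs of κ' are needed.
  have surj : ∀ κ' : ℝ, |κ'| = κ → ∀ ψ : 𝓗, ∃ x : (H + (t : ℂ) • V).domain,
      (H + (t : ℂ) • V) x - (Complex.I * κ') • (x : 𝓗) = ψ := by
    intro κ' hκ' ψ
    have hne : κ' ≠ 0 := by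
      rintro rfl
      simp at hκ'
      linarith
    obtain ⟨R, hR⟩ := exists_isResolventAt hH hne
    obtain ⟨W, hW, hWn⟩ := exists_product_resolventAt hs hd ha hb hne hbd hR
    rw [hκ'] at hWn
    have hn : ‖-((t : ℂ) • W)‖ < 1 := by
      rw [norm_neg, norm_smul, Complex.norm_real, Real.norm_eq_abs]
      exact lt_of_le_of_lt (mul_le_mul_of_nonneg_left hWn (abs_nonneg t)) hκ
    obtain ⟨e, he⟩ := isUnit_one_sub_of_norm_lt_one hn
    let φ := (e⁻¹).1 ψ
    have hφ : φ + (t : ℂ) • W φ = ψ := by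
      have : (e.1 * (e⁻¹).1) ψ = ψ := by simp
      rw [he] at this
      simpa using this
    obtain ⟨h1, h2⟩ := apply_eq_of_mem_graph (hR.1 φ)
    obtain ⟨h3, h4⟩ := apply_eq_of_mem_graph (hW φ)
    have h5 : R φ ∈ (H + (t : ℂ) • V).domain := by rwa [pert_domain hd]
    refine ⟨⟨R φ, h5⟩, ?_⟩
    rw [pert_apply hd _ h1, h2, h4]
    refine Eq.trans ?_ hφ
    simp only
    abel
  refine isSelfAdjoint_of_surjective (pert_symm hd hs hV t) ?_ κ (surj κ (abs_of_pos hκ0))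
    fun ψ => ?_
  · rw [pert_domain hd]
    exact hH.dense_domain
  · obtain ⟨x, hx⟩ := surj (-κ) (by rw [abs_neg, abs_of_pos hκ0]) ψ
    refine ⟨x, ?_⟩
    rw [← hx]
    simp

/-- Inserting Hx = (H + tV)x - tVx into the bound and absorbing |t|a‖Vx‖ on the left leaves the
factor 1 - |t|a. This makes V(H + tV - i)⁻¹ bounded at every admissible t, not only at 0. -/
theorem isRelBounded_pert (hHV : IsRelBounded H V) {t : ℝ}
    (ht : t ∈ symmInterval (relBound H V)) : IsRelBounded (H + (t : ℂ) • V) V := by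
  have hd := hHV.1
  obtain ⟨a, b, ha, hb, hlt, hbd⟩ := exists_relBound_lt hHV ht
  have hpos : 0 < 1 - |t| * a := by linarith
  refine ⟨by rw [pert_domain hd]; exact hd, a / (1 - |t| * a), by positivity,
    b / (1 - |t| * a), by positivity, ?_⟩
  rintro ⟨x, hx⟩ ⟨y, hy⟩ hxy
  simp only at hxy
  subst hxy
  have hx' := hx
  rw [pert_domain hd] at hx'
  have h1 := hbd x hx'
  have h2 := pert_apply hd (t : ℂ) hx' hx
  have h3 : ‖H ⟨x, hx'⟩‖ ≤ ‖(H + (t : ℂ) • V) ⟨x, hx⟩‖ + |t| * ‖V ⟨x, hy⟩‖ := by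
    have : H ⟨x, hx'⟩ = (H + (t : ℂ) • V) ⟨x, hx⟩ - (t : ℂ) • V ⟨x, hy⟩ := by rw [h2]; simp
    rw [this]
    refine (norm_sub_le _ _).trans ?_
    rw [norm_smul, Complex.norm_real, Real.norm_eq_abs]
  rw [div_mul_eq_mul_div, div_mul_eq_mul_div, ← add_div, le_div_iff₀ hpos]
  nlinarith [mul_le_mul_of_nonneg_left h3 ha]

theorem exists_product_resolvent (hH : IsSelfAdjoint H) (hHV : IsRelBounded H V) :
    ∃ W : 𝓗 →L[ℂ] 𝓗, IsBoundedProduct V (resolvent H) W := by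
  obtain ⟨a, b, ha, hb, -, hbd⟩ := exists_relBound_lt hHV (t := 0) (by simp [symmInterval])
  obtain ⟨W, hW, -⟩ := exists_product_resolventAt (isFormalAdjoint_self hH) hHV.1 ha hb one_ne_zero
    hbd (isResolventAt_one_iff.mpr (isResolvent_resolvent hH))
  exact ⟨W, hW⟩

end Perturbation

end RelMOI
end

noncomputable section
namespace RelMOI

/-! ### The spectral theorem -/

theorem u_ne_zero (x : ℝ) : u x ≠ 0 := by
  intro h
  have := congrArg Complex.im h
  simp [u] at this

theorem continuous_u : Continuous u := by
  unfold u
  fun_prop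

theorem normSq_u (x : ℝ) : starRingEnd ℂ (u x) * u x = ((1 + x ^ 2 : ℝ) : ℂ) := by
  simp only [u, map_sub, Complex.conj_ofReal, Complex.conj_I]
  push_cast
  linear_combination -Complex.I_sq

theorem norm_u_sq (x : ℝ) : ‖u x‖ ^ 2 = 1 + x ^ 2 := by
  have := normSq_u x
  rw [Complex.conj_mul'] at this
  exact_mod_cast this

theorem one_le_norm_u (x : ℝ) : 1 ≤ ‖u x‖ := by
  have := norm_u_sq x
  nlinarith [sq_nonneg x, norm_nonneg (u x)]

theorem abs_le_norm_u (x : ℝ) : |x| ≤ ‖u x‖ := by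
  refine (pow_le_pow_iff_left₀ (abs_nonneg _) (norm_nonneg _) two_ne_zero).mp ?_
  rw [norm_u_sq, sq_abs]
  linarith

theorem bddMeas_inv_u : BddMeas fun x => (u x)⁻¹ := by
  refine ⟨continuous_u.measurable.inv, 1, fun x => ?_⟩
  rw [norm_inv]
  exact inv_le_one_of_one_le₀ (one_le_norm_u x)

theorem bddMeas_mul_inv_u : BddMeas fun x : ℝ => (x : ℂ) * (u x)⁻¹ := by
  refine ⟨Complex.measurable_ofReal.mul continuous_u.measurable.inv, 1, fun x => ?_⟩
  rw [norm_mul, norm_inv, Complex.norm_real, Real.norm_eq_abs, ← div_eq_mul_inv]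
  exact div_le_one_of_le₀ (abs_le_norm_u x) (norm_nonneg _)

/-- The indicator function of `[-N, N]`. -/
def cutoff (N : ℕ) : ℝ → ℂ := (Set.Icc (-(N : ℝ)) N).indicator fun _ => 1

theorem bddMeas_cutoff (N : ℕ) : BddMeas (cutoff N) := BddMeas.indicator measurableSet_Icc

theorem norm_cutoff_le (N : ℕ) (x : ℝ) : ‖cutoff N x‖ ≤ 1 := by
  unfold cutoff
  by_cases hx : x ∈ Set.Icc (-(N : ℝ)) N
  · rw [Set.indicator_of_mem hx]; simp
  · rw [Set.indicator_of_notMem hx]; simp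

theorem cutoff_eventually_eq_one (x : ℝ) : ∀ᶠ N in atTop, cutoff N x = 1 := by
  filter_upwards [eventually_ge_atTop ⌈|x|⌉₊] with N hN
  have : |x| ≤ N := (Nat.le_ceil _).trans (by exact_mod_cast hN)
  have hx : x ∈ Set.Icc (-(N : ℝ)) N := abs_le.mp this
  exact Set.indicator_of_mem hx _

theorem tendsto_cutoff (x : ℝ) : Tendsto (fun N => cutoff N x) atTop (𝓝 1) :=
  tendsto_const_nhds.congr' ((cutoff_eventually_eq_one x).mono fun _ h => h.symm)

theorem bddMeas_mul_cutoff {g : ℝ → ℂ} (hg : Continuous g) (N : ℕ) :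
    BddMeas fun x => g x * cutoff N x := by
  refine ⟨hg.measurable.mul (bddMeas_cutoff N).1, ?_⟩
  obtain ⟨C, hC⟩ := (isCompact_Icc (a := -(N : ℝ)) (b := N)).exists_bound_of_continuousOn
    hg.continuousOn
  refine ⟨max C 0, fun x => ?_⟩
  simp only [cutoff]
  by_cases hx : x ∈ Set.Icc (-(N : ℝ)) N
  · rw [Set.indicator_of_mem hx, mul_one]
    exact (hC x hx).trans (le_max_left _ _)
  · rw [Set.indicator_of_notMem hx]
    simp

variable {𝓗 : Type*} [NormedAddCommGroup 𝓗] [InnerProductSpace ℂ 𝓗] [CompleteSpace 𝓗]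

theorem inner_resolvent {H : 𝓗 →ₗ.[ℂ] 𝓗} (hs : H.IsFormalAdjoint H) {R : 𝓗 →L[ℂ] 𝓗}
    (hR : IsResolvent H R) (φ ψ : 𝓗) :
    inner ℂ φ (R ψ) - inner ℂ (R φ) ψ = 2 * Complex.I * inner ℂ (R φ) (R ψ) := by
  obtain ⟨h1, h2⟩ := apply_eq_of_mem_graph (hR.1 φ)
  obtain ⟨h3, h4⟩ := apply_eq_of_mem_graph (hR.1 ψ)
  have h5 := hs ⟨R φ, h1⟩ ⟨R ψ, h3⟩
  rw [h2, h4] at h5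
  simp only [inner_add_left, inner_add_right, inner_smul_left, inner_smul_right,
    Complex.conj_I] at h5
  linear_combination h5

/-- This is the symmetry of H written for R. On the spectrum it becomes z - z̄ = 2i|z|², the circle
traced by 1/(x - i) together with 0. -/
theorem resolvent_sub_star {H : 𝓗 →ₗ.[ℂ] 𝓗} (hs : H.IsFormalAdjoint H) {R : 𝓗 →L[ℂ] 𝓗}
    (hR : IsResolvent H R) : R - star R = (2 * Complex.I) • (star R * R) := by
  ext ψ
  refine ext_inner_left ℂ fun φ => ?_
  simp only [ContinuousLinearMap.star_eq_adjoint, sub_apply, smul_apply, inner_sub_right,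
    inner_smul_right, mul_apply_eq_comp, ContinuousLinearMap.adjoint_inner_right]
  exact inner_resolvent hs hR φ ψ

theorem resolvent_injective {H : 𝓗 →ₗ.[ℂ] 𝓗} {R : 𝓗 →L[ℂ] 𝓗} (hR : IsResolvent H R) {ψ : 𝓗}
    (h : R ψ = 0) : ψ = 0 := by
  have := hR.1 ψ
  rw [h, smul_zero, add_zero] at this
  exact H.graph_fst_eq_zero_snd this rfl

/-- The adjoint R* is the resolvent at -i. The first resolvent identity gives R - R* = 2i RR*,
symmetry gives R - R* = 2i R*R, and comparing the two yields commutation. -/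
theorem isStarNormal_resolvent {H : 𝓗 →ₗ.[ℂ] 𝓗} (hH : IsSelfAdjoint H) {R : 𝓗 →L[ℂ] 𝓗}
    (hR : IsResolvent H R) : IsStarNormal R := by
  have hs := isFormalAdjoint_self hH
  obtain ⟨S, hS⟩ := exists_isResolventAt hH (κ := -1) (by norm_num)
  have hSR : star R = S := by
    ext ψ
    refine ext_inner_left ℂ fun φ => ?_
    rw [ContinuousLinearMap.star_eq_adjoint, ContinuousLinearMap.adjoint_inner_right]
    obtain ⟨h1, h2⟩ := apply_eq_of_mem_graph (hR.1 φ)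
    obtain ⟨h3, h4⟩ := apply_eq_of_mem_graph (hS.1 ψ)
    have h5 := hs ⟨R φ, h1⟩ ⟨S ψ, h3⟩
    rw [h2, h4] at h5
    simp only [inner_add_left, inner_add_right, inner_smul_left, inner_smul_right,
      Complex.conj_I] at h5
    push_cast at h5
    linear_combination -h5
  have h2 : R - S = (2 * Complex.I) • (R * S) := by
    ext ψ
    obtain ⟨h3, h4⟩ := apply_eq_of_mem_graph (hS.1 ψ)
    have h5 := hR.2 ⟨S ψ, h3⟩
    rw [h4] at h5
    simp only [map_add, map_sub, map_smul] at h5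
    simp only [sub_apply, smul_apply, mul_apply_eq_comp]
    rw [← sub_eq_zero] at h5 ⊢
    rw [← h5]
    simp only [Complex.ofReal_neg, Complex.ofReal_one, mul_neg, mul_one, neg_smul, mul_smul,
      two_smul]
    abel
  have h1 := resolvent_sub_star hs hR
  rw [hSR, h2] at h1
  refine ⟨?_⟩
  rw [hSR]
  exact (smul_right_injective _ (by simp : (2 * Complex.I : ℂ) ≠ 0) h1).symm

/-! ### Borel functional calculus of a bounded normal operator -/

section Normal

variable {R : 𝓗 →L[ℂ] 𝓗} (hR : IsStarNormal R)

/-- Real continuous functions on the spectrum as complex ones. -/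
def toComplexMap {X : Type*} [TopologicalSpace X] (f : C(X, ℝ)) : C(X, ℂ) :=
  ⟨fun x => (f x : ℂ), Complex.continuous_ofReal.comp f.continuous⟩

/-- With g = √f the expectation is ‖g(R)ψ‖². This positivity is what Riesz–Markov needs. -/
theorem cfcHom_inner_nonneg (f : C(spectrum ℂ R, ℝ)) (hf : ∀ x, 0 ≤ f x) (ψ : 𝓗) :
    0 ≤ (inner ℂ ψ (cfcHom hR (toComplexMap f) ψ)).re := by
  let g : C(spectrum ℂ R, ℝ) := ⟨fun x => Real.sqrt (f x), f.continuous.sqrt⟩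
  have h1 : toComplexMap f = star (toComplexMap g) * toComplexMap g := by
    ext x
    have : (Real.sqrt (f x) : ℂ) * (Real.sqrt (f x) : ℂ) = (f x : ℂ) := by
      rw [← Complex.ofReal_mul, Real.mul_self_sqrt (hf x)]
    simp [toComplexMap, g, this]
  rw [h1, map_mul, map_star, ContinuousLinearMap.star_eq_adjoint, mul_apply_eq_comp,
    ContinuousLinearMap.adjoint_inner_right]
  exact inner_self_nonneg (𝕜 := ℂ)

/-- The positive functional of a vector. -/
def vectorFunctional (ψ : 𝓗) : CompactlySupportedContinuousMap (spectrum ℂ R) ℝ →ₚ[ℝ] ℝ :=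
  PositiveLinearMap.mk₀
    { toFun := fun f => (inner ℂ ψ (cfcHom hR (toComplexMap f.toContinuousMap) ψ)).re
      map_add' := fun f g => by
        have : toComplexMap (f + g).toContinuousMap =
            toComplexMap f.toContinuousMap + toComplexMap g.toContinuousMap := by
          ext x; simp [toComplexMap]
        rw [this, map_add, add_apply, inner_add_right, Complex.add_re]
      map_smul' := fun c f => by
        have : toComplexMap (c • f).toContinuousMap = (c : ℂ) • toComplexMap f.toContinuousMap := by
          ext x; simp [toComplexMap]
        rw [this, map_smul, smul_apply, inner_smul_right]
        simp }
    (fun f hf => cfcHom_inner_nonneg hR f.toContinuousMap (fun x => hf x) ψ)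

/-- The scalar spectral measure of a normal operator. -/
def normalMeasure (ψ : 𝓗) : Measure (spectrum ℂ R) :=
  RealRMK.rieszMeasure (vectorFunctional hR ψ)

theorem normalMeasure_finite (ψ : 𝓗) : IsFiniteMeasure (normalMeasure hR ψ) := by
  have : IsFiniteMeasureOnCompacts (normalMeasure hR ψ) := by
    unfold normalMeasure
    infer_instance
  exact ⟨isCompact_univ.measure_lt_top⟩

theorem integral_normalMeasure_real (f : C(spectrum ℂ R, ℝ)) (ψ : 𝓗) :
    inner ℂ ψ (cfcHom hR (toComplexMap f) ψ) = ((∫ x, f x ∂(normalMeasure hR ψ) : ℝ) : ℂ) := by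
  have h1 := RealRMK.integral_rieszMeasure (vectorFunctional hR ψ)
    ⟨f, HasCompactSupport.of_compactSpace f⟩
  have h2 : (inner ℂ ψ (cfcHom hR (toComplexMap f) ψ)).im = 0 := by
    have h3 : star (toComplexMap f) = toComplexMap f := by ext x; simp [toComplexMap]
    have h4 : star (cfcHom hR (toComplexMap f)) = cfcHom hR (toComplexMap f) := by
      rw [← map_star, h3]
    rw [ContinuousLinearMap.star_eq_adjoint] at h4
    have h5 := ContinuousLinearMap.adjoint_inner_right (cfcHom hR (toComplexMap f)) ψ ψ
    rw [h4] at h5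
    exact Complex.conj_eq_iff_im.mp (by rw [inner_conj_symm, h5])
  refine Complex.ext ?_ ?_
  · rw [Complex.ofReal_re]
    exact h1.symm
  · rw [h2, Complex.ofReal_im]

theorem integral_normalMeasure (h : C(spectrum ℂ R, ℂ)) (ψ : 𝓗) :
    inner ℂ ψ (cfcHom hR h ψ) = ∫ x, h x ∂(normalMeasure hR ψ) := by
  have := normalMeasure_finite hR ψ
  let f : C(spectrum ℂ R, ℝ) := ⟨fun x => (h x).re, Complex.continuous_re.comp h.continuous⟩
  let g : C(spectrum ℂ R, ℝ) := ⟨fun x => (h x).im, Complex.continuous_im.comp h.continuous⟩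
  have e : h = toComplexMap f + Complex.I • toComplexMap g := by
    ext x
    simp only [toComplexMap, f, g, ContinuousMap.add_apply, ContinuousMap.coe_mk,
      ContinuousMap.smul_apply, smul_eq_mul]
    rw [mul_comm, Complex.re_add_im]
  have hi : ∀ k : C(spectrum ℂ R, ℂ), Integrable k (normalMeasure hR ψ) := fun k =>
    k.continuous.integrable_of_hasCompactSupport (HasCompactSupport.of_compactSpace k)
  have hr : ∀ k : C(spectrum ℂ R, ℝ), ((∫ x, k x ∂(normalMeasure hR ψ) : ℝ) : ℂ) =
      ∫ x, toComplexMap k x ∂(normalMeasure hR ψ) := fun k => integral_complex_ofReal.symm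
  rw [e, map_add, map_smul, add_apply, smul_apply, inner_add_right, inner_smul_right,
    integral_normalMeasure_real, integral_normalMeasure_real, hr, hr]
  simp only [ContinuousMap.add_apply, ContinuousMap.smul_apply, smul_eq_mul]
  rw [integral_add (hi _) ((hi _).const_mul _), integral_const_mul]

/-- Borel functional calculus of a bounded normal operator. -/
theorem exists_isCalculus_of_normal : ∃ Op : (spectrum ℂ R → ℂ) → 𝓗 →L[ℂ] 𝓗,
    IsCalculus (normalMeasure hR) Op ∧ Op (fun z => (z : ℂ)) = R := by
  classical
  set S : Set (spectrum ℂ R → ℂ) := {g | ∃ f : BoundedContinuousFunction (spectrum ℂ R) NNReal,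
    g = fun x => ((f x : ℝ) : ℂ)} with hS
  have hScont : ∀ g ∈ S, ∃ k : C(spectrum ℂ R, ℂ), g = k ∧ ∀ x, starRingEnd ℂ (k x) = k x := by
    rintro g ⟨f, rfl⟩
    exact ⟨⟨fun x => ((f x : ℝ) : ℂ), by fun_prop⟩, rfl, fun x => Complex.conj_ofReal _⟩
  have hfin := normalMeasure_finite hR
  have gen : ∀ L : (spectrum ℂ R → ℂ) → ℂ, IsSigma L → (∀ g ∈ S, L g = 0) →
      ∀ h, BddMeas h → L h = 0 := fun L hL h0 h hh =>
    hL.eq_zero_of_continuous (fun f => h0 _ ⟨f, rfl⟩) hh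
  have hb : ∀ k : C(spectrum ℂ R, ℂ), BddMeas k := fun k =>
    ⟨k.continuous.measurable, ‖k‖, fun x => k.norm_coe_le_norm x⟩
  have hmass : ∀ ψ, (normalMeasure hR ψ).real Set.univ ≤ ‖ψ‖ ^ 2 := by
    intro ψ
    have := integral_normalMeasure_real hR 1 ψ
    have h1 : toComplexMap (1 : C(spectrum ℂ R, ℝ)) = 1 := by ext x; simp [toComplexMap]
    rw [h1, map_one, one_apply_eq_self, inner_self_eq_norm_sq_to_K] at this
    have h2 : ‖ψ‖ ^ 2 = ∫ x, (1 : C(spectrum ℂ R, ℝ)) x ∂(normalMeasure hR ψ) :=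
      Complex.ofReal_injective (by simpa using this)
    rw [h2]
    simp
  have hex : ∀ h : spectrum ℂ R → ℂ, BddMeas h → ∃ A : 𝓗 →L[ℂ] 𝓗,
      ∀ ψ, inner ℂ ψ (A ψ) = ∫ z, h z ∂(normalMeasure hR ψ) := fun h hh =>
    exists_operator_of_generating hfin hmass S gen (fun g hg => by
      obtain ⟨k, rfl, -⟩ := hScont g hg
      exact ⟨cfcHom hR k, integral_normalMeasure hR k⟩) hh
  let Op : (spectrum ℂ R → ℂ) → 𝓗 →L[ℂ] 𝓗 := fun h =>
    if hh : BddMeas h then (hex h hh).choose else 0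
  have hOp : ∀ h, BddMeas h → ∀ ψ, inner ℂ ψ (Op h ψ) = ∫ z, h z ∂(normalMeasure hR ψ) := by
    intro h hh
    simp only [Op, dif_pos hh]
    exact (hex h hh).choose_spec
  have hOpc : ∀ k : C(spectrum ℂ R, ℂ), Op k = cfcHom hR k := fun k =>
    ext_inner_diag fun ψ => by rw [hOp k (hb k), integral_normalMeasure]
  refine ⟨Op, isCalculus_of_generating hfin hOp ?_ S ?_ ?_ gen ?_, ?_⟩
  · rw [← map_one (cfcHom (R := ℂ) hR), ← hOpc]
    rfl
  · intro g hg
    obtain ⟨k, rfl, -⟩ := hScont g hg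
    exact hb k
  · intro g hg
    obtain ⟨k, rfl, hk⟩ := hScont g hg
    exact hk
  · intro g hg h hh
    obtain ⟨k, rfl, -⟩ := hScont g hg
    obtain ⟨l, rfl, -⟩ := hScont h hh
    rw [hOpc, hOpc, ← map_mul, ← hOpc]
    rfl
  · have := cfcHom_id (R := ℂ) hR
    rw [← hOpc] at this
    exact this

end Normal

end RelMOI
end

/-! ### From the resolvent to the unbounded operator -/

noncomputable section
namespace RelMOI

variable {𝓗 : Type*} [NormedAddCommGroup 𝓗] [InnerProductSpace ℂ 𝓗] [CompleteSpace 𝓗]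

/-- A self-adjoint operator has a calculus that sends `(x - i)⁻¹` to the resolvent. -/
theorem exists_isCalculus_of_isSelfAdjoint {H : 𝓗 →ₗ.[ℂ] 𝓗} (hH : IsSelfAdjoint H)
    {R : 𝓗 →L[ℂ] 𝓗} (hR : IsResolvent H R) :
    ∃ (μ : 𝓗 → Measure ℝ) (Op : (ℝ → ℂ) → 𝓗 →L[ℂ] 𝓗), IsCalculus μ Op ∧
      Op (fun x => (u x)⁻¹) = R := by
  have hn := isStarNormal_resolvent hH hR
  obtain ⟨Op, hc, hz⟩ := exists_isCalculus_of_normal hn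
  -- On the circle without 0 this map inverts x ↦ 1/u(x), so pushing the calculus of R forward along
  -- it gives the calculus of H.
  let k : spectrum ℂ R → ℝ := fun z => ((z : ℂ)⁻¹).re
  have hk : Measurable k := Complex.measurable_re.comp measurable_subtype_coe.inv
  have hcirc : ∀ z : spectrum ℂ R, (z : ℂ) - starRingEnd ℂ (z : ℂ) =
      2 * Complex.I * (starRingEnd ℂ (z : ℂ) * z) := by
    let id' : C(spectrum ℂ R, ℂ) := (ContinuousMap.id ℂ).restrict (spectrum ℂ R)
    have h1 : cfcHom hn (id' - star id') = cfcHom hn ((2 * Complex.I) • (star id' * id')) := by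
      rw [map_sub, map_smul, map_mul, map_star, cfcHom_id (R := ℂ) hn]
      exact resolvent_sub_star (isFormalAdjoint_self hH) hR
    intro z
    have h2 := cfcHom_injective (R := ℂ) hn h1
    have h3 := congrArg (fun f : C(spectrum ℂ R, ℂ) => f z) h2
    simpa [id'] using h3
  have hinv : ∀ z : spectrum ℂ R, (z : ℂ) ≠ 0 → (u (k z))⁻¹ = z := by
    intro z hz0
    have hz' : starRingEnd ℂ (z : ℂ) ≠ 0 := by simpa using hz0
    have h1 : starRingEnd ℂ ((z : ℂ)⁻¹) - (z : ℂ)⁻¹ = 2 * Complex.I := by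
      rw [map_inv₀]
      field_simp
      linear_combination hcirc z
    have h2 : ((z : ℂ)⁻¹).im = -1 := by
      have := congrArg Complex.im h1
      simp only [Complex.sub_im, Complex.conj_im, Complex.mul_im, Complex.re_ofNat, Complex.I_im,
        Complex.im_ofNat, Complex.I_re] at this
      linarith
    have h3 : u (k z) = (z : ℂ)⁻¹ := by
      refine Complex.ext ?_ ?_
      · simp [u, k]
      · rw [h2]
        simp [u]
    rw [h3, inv_inv]
  -- The point 0 may lie in the spectrum, and there 1/u(k z) is i instead of z. The discrepancy is
  -- harmless: R annihilates the range of the spectral projection of {0}, and R is injective.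
  set e : spectrum ℂ R → ℂ := Set.indicator {z | (z : ℂ) = 0} fun _ => 1 with he
  have hms : MeasurableSet {z : spectrum ℂ R | (z : ℂ) = 0} :=
    measurable_subtype_coe (measurableSet_singleton 0)
  have hbe : BddMeas e := BddMeas.indicator hms
  have hbz : BddMeas fun z : spectrum ℂ R => (z : ℂ) := by
    refine ⟨measurable_subtype_coe, ‖R‖ * ‖(1 : 𝓗 →L[ℂ] 𝓗)‖, fun z => ?_⟩
    exact spectrum.norm_le_norm_mul_of_mem z.2
  have he0 : Op e = 0 := by
    have h1 : R * Op e = 0 := by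
      rw [← hz, ← hc.mul _ _ hbz hbe]
      have : (fun x : spectrum ℂ R => (x : ℂ) * e x) = fun _ => 0 := by
        ext z
        by_cases h : (z : ℂ) = 0
        · simp [h]
        · simp [he, h]
      rw [this]
      simpa using hc.const 0
    ext ψ
    exact resolvent_injective hR (by simpa using congrArg (fun A : 𝓗 →L[ℂ] 𝓗 => A ψ) h1)
  refine ⟨_, _, hc.map hk, ?_⟩
  have hbg : BddMeas fun z => (u (k z))⁻¹ := bddMeas_inv_u.comp hk
  have h1 : (fun z => (u (k z))⁻¹) =
      fun z : spectrum ℂ R => (z : ℂ) + (u (k z))⁻¹ * e z := by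
    ext z
    by_cases h : (z : ℂ) = 0
    · simp [he, h]
    · rw [hinv z h]
      simp [he, h]
  change Op (fun z => (u (k z))⁻¹) = R
  rw [h1, hc.add hbz (hbg.mul hbe), hc.mul _ _ hbg hbe, he0, hz]
  simp

section

variable {μ : 𝓗 → Measure ℝ} {Op : (ℝ → ℂ) → 𝓗 →L[ℂ] 𝓗}

/-- `norm_sq` for the indicator of s divided by u produces the density 1/|u|² = 1/(1 + x²). So x² is
integrable against the spectral measure of every vector in the range of the resolvent. -/
theorem IsCalculus.measure_inv_u (hc : IsCalculus μ Op) (φ : 𝓗) :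
    μ (Op (fun x => (u x)⁻¹) φ) =
      (μ φ).withDensity fun x => ENNReal.ofReal ((1 + x ^ 2)⁻¹) := by
  have := hc.finite φ
  have := hc.finite (Op (fun x => (u x)⁻¹) φ)
  have hm : Measurable fun x : ℝ => (1 + x ^ 2)⁻¹ := by fun_prop
  have hpos : ∀ x : ℝ, 0 ≤ (1 + x ^ 2)⁻¹ := fun x => by positivity
  ext s hs
  rw [withDensity_apply _ hs, ← ofReal_integral_eq_lintegral_ofReal]
  · have h1 := hc.norm_sq (BddMeas.indicator hs) (Op (fun x => (u x)⁻¹) φ)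
    have h2 := hc.norm_sq ((BddMeas.indicator hs).mul bddMeas_inv_u) φ
    rw [hc.mul _ _ (BddMeas.indicator hs) bddMeas_inv_u, mul_apply_eq_comp, h1] at h2
    have e1 : (fun z => ‖s.indicator (fun _ => (1 : ℂ)) z‖ ^ 2) = s.indicator fun _ => (1 : ℝ) := by
      ext x
      by_cases hx : x ∈ s <;> simp [hx]
    have e2 : (fun z => ‖s.indicator (fun _ => (1 : ℂ)) z * (u z)⁻¹‖ ^ 2) =
        s.indicator fun x => (1 + x ^ 2)⁻¹ := by
      ext x
      by_cases hx : x ∈ s <;> simp [hx, norm_u_sq]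
    rw [e1, e2, integral_indicator_const _ hs, integral_indicator hs, smul_eq_mul, mul_one] at h2
    rw [← h2]
    simp [Measure.real]
  · refine Integrable.of_bound (C := 1) hm.aestronglyMeasurable (Eventually.of_forall fun x => ?_)
    rw [Real.norm_of_nonneg (hpos x)]
    exact inv_le_one_of_one_le₀ (by nlinarith [sq_nonneg x])
  · exact Eventually.of_forall hpos

theorem IsCalculus.integrable_sq_inv_u (hc : IsCalculus μ Op) (φ : 𝓗) :
    Integrable (fun x : ℝ => x ^ 2) (μ (Op (fun x => (u x)⁻¹) φ)) := by
  have := hc.finite φ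
  have hm : Measurable fun x : ℝ => (1 + x ^ 2)⁻¹ := by fun_prop
  rw [hc.measure_inv_u, integrable_withDensity_iff_integrable_smul' hm.ennreal_ofReal
    (Eventually.of_forall fun x => ENNReal.ofReal_lt_top)]
  refine Integrable.of_bound (C := 1) (by fun_prop) (Eventually.of_forall fun x => ?_)
  rw [ENNReal.toReal_ofReal (by positivity), smul_eq_mul, Real.norm_of_nonneg (by positivity),
    inv_mul_eq_div]
  exact div_le_one_of_le₀ (by linarith) (by positivity)

theorem IsCalculus.integral_id_inv_u (hc : IsCalculus μ Op) (φ : 𝓗) :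
    ((∫ x, x ∂(μ (Op (fun x => (u x)⁻¹) φ)) : ℝ) : ℂ) =
      inner ℂ (Op (fun x => (u x)⁻¹) φ) (Op (fun x : ℝ => (x : ℂ) * (u x)⁻¹) φ) := by
  have hm : Measurable fun x : ℝ => (1 + x ^ 2)⁻¹ := by fun_prop
  rw [← ContinuousLinearMap.adjoint_inner_right, ← ContinuousLinearMap.star_eq_adjoint,
    ← hc.star bddMeas_inv_u, ← mul_apply_eq_comp, ← hc.mul _ _ bddMeas_inv_u.star bddMeas_mul_inv_u,
    hc.inner_diag _ (bddMeas_inv_u.star.mul bddMeas_mul_inv_u), hc.measure_inv_u,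
    integral_withDensity_eq_integral_toReal_smul hm.ennreal_ofReal
      (Eventually.of_forall fun x => ENNReal.ofReal_lt_top), ← integral_complex_ofReal]
  congr 1
  ext x
  rw [ENNReal.toReal_ofReal (by positivity), map_inv₀, smul_eq_mul]
  have h1 := normSq_u x
  have h2 : (starRingEnd ℂ (u x))⁻¹ * ((x : ℂ) * (u x)⁻¹) =
      x * (starRingEnd ℂ (u x) * u x)⁻¹ := by
    rw [mul_inv]
    ring
  rw [h2, h1]
  push_cast
  ring

theorem IsCalculus.mul_inv_u (hc : IsCalculus μ Op) :
    Op (fun x : ℝ => (x : ℂ) * (u x)⁻¹) = 1 + Complex.I • Op (fun x => (u x)⁻¹) := by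
  rw [← hc.one, ← hc.smul _ bddMeas_inv_u,
    ← hc.add (BddMeas.const 1) ((BddMeas.const _).mul bddMeas_inv_u)]
  congr 1
  ext x
  have := u_ne_zero x
  field_simp
  simp [u]

theorem IsCalculus.tendsto_cutoff (hc : IsCalculus μ Op) (ψ : 𝓗) :
    Tendsto (fun N => Op (cutoff N) ψ) atTop (𝓝 ψ) := by
  have := hc.tendsto (l := atTop) (fun N => (bddMeas_cutoff N).1) (BddMeas.const 1) norm_cutoff_le
    RelMOI.tendsto_cutoff ψ
  simpa [hc.one] using this

/-- The preimage is the limit of u times a cutoff applied to ψ. The second moment makes this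
sequence Cauchy, and applying 1/u leaves the cutoff of ψ, which tends to ψ. -/
theorem IsCalculus.exists_eq_inv_u (hc : IsCalculus μ Op) {ψ : 𝓗}
    (h : Integrable (fun x : ℝ => x ^ 2) (μ ψ)) : ∃ φ, ψ = Op (fun x => (u x)⁻¹) φ := by
  have := hc.finite ψ
  have hb := fun N => bddMeas_mul_cutoff continuous_u N
  set v : ℕ → 𝓗 := fun N => Op (fun x => u x * cutoff N x) ψ with hv
  have hintg : Integrable (fun x : ℝ => 1 + x ^ 2) (μ ψ) := (integrable_const 1).add h
  -- The square root of the mass of 1 + x² outside [-N, N]; it bounds the distance of v M from v N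
  -- for all M ≥ N.
  set b : ℕ → ℝ := fun N => Real.sqrt (∫ x, (1 + x ^ 2) * (1 - (cutoff N x).re) ∂(μ ψ)) with hbdef
  have hcut : ∀ N x, cutoff N x = 0 ∨ cutoff N x = 1 := by
    intro N x
    by_cases hx : x ∈ Set.Icc (-(N : ℝ)) N
    · exact Or.inr (Set.indicator_of_mem hx _)
    · exact Or.inl (Set.indicator_of_notMem hx _)
  have hmono : ∀ N M x, N ≤ M → cutoff N x = 1 → cutoff M x = 1 := by
    intro N M x hNM h1
    have hx : x ∈ Set.Icc (-(N : ℝ)) N := by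
      by_contra hx
      rw [cutoff, Set.indicator_of_notMem hx] at h1
      exact zero_ne_one h1
    have hNM' : (N : ℝ) ≤ M := by exact_mod_cast hNM
    have hx' : x ∈ Set.Icc (-(M : ℝ)) M := ⟨by linarith [hx.1], by linarith [hx.2]⟩
    exact Set.indicator_of_mem hx' _
  have hbint : ∀ N, Integrable (fun x => (1 + x ^ 2) * (1 - (cutoff N x).re)) (μ ψ) := by
    intro N
    refine hintg.mul_bdd (c := 1) ?_ (Eventually.of_forall fun x => ?_)
    · exact (measurable_const.sub
        (Complex.measurable_re.comp (bddMeas_cutoff N).1)).aestronglyMeasurable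
    · rcases hcut N x with h | h <;> simp [h]
  have hcauchy : CauchySeq v := by
    refine cauchySeq_of_le_tendsto_0' b (fun N M hNM => ?_) ?_
    · rw [dist_comm, dist_eq_norm]
      refine Real.le_sqrt_of_sq_le ?_
      have e : v M - v N = Op (fun x => u x * cutoff M x - u x * cutoff N x) ψ := by
        rw [hc.sub (hb M) (hb N)]
        rfl
      rw [e, hc.norm_sq ((hb M).sub (hb N))]
      refine integral_mono_of_nonneg (Eventually.of_forall fun x => by positivity) (hbint N)
        (Eventually.of_forall fun x => ?_)
      simp only
      rw [← mul_sub, norm_mul, mul_pow, norm_u_sq]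
      rcases hcut N x with h | h
      · rcases hcut M x with h' | h' <;> simp [h, h']
        positivity
      · simp [h, hmono N M x hNM h]
    · have h1 : Tendsto (fun N => ∫ x, (1 + x ^ 2) * (1 - (cutoff N x).re) ∂(μ ψ)) atTop
          (𝓝 (∫ _, (0 : ℝ) ∂(μ ψ))) := by
        refine tendsto_integral_of_dominated_convergence (fun x => 1 + x ^ 2)
          (fun N => (hbint N).aestronglyMeasurable) hintg
          (fun N => Eventually.of_forall fun x => ?_) (Eventually.of_forall fun x => ?_)
        · have : 0 ≤ 1 + x ^ 2 := by positivity
          rcases hcut N x with h | h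
          · simp [h, abs_of_nonneg this]
          · simpa [h] using this
        · refine tendsto_const_nhds.congr' ((cutoff_eventually_eq_one x).mono fun N hN => ?_)
          simp [hN]
      simpa using h1.sqrt
  obtain ⟨φ, hφ⟩ := cauchySeq_tendsto_of_complete hcauchy
  refine ⟨φ, ?_⟩
  have h1 := ((Op (fun x => (u x)⁻¹)).continuous.tendsto φ).comp hφ
  refine tendsto_nhds_unique (hc.tendsto_cutoff ψ) (h1.congr fun N => ?_)
  simp only [Function.comp, hv]
  rw [← mul_apply_eq_comp, ← hc.mul _ _ bddMeas_inv_u (hb N)]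
  congr 2
  ext x
  rw [inv_mul_cancel_left₀ (u_ne_zero x)]

theorem mem_domain_iff_resolvent {H : 𝓗 →ₗ.[ℂ] 𝓗} {R : 𝓗 →L[ℂ] 𝓗} (hR : IsResolvent H R) (ψ : 𝓗) :
    ψ ∈ H.domain ↔ ∃ φ, ψ = R φ :=
  ⟨fun h => ⟨_, (hR.2 ⟨ψ, h⟩).symm⟩, fun ⟨φ, h⟩ => h ▸ (apply_eq_of_mem_graph (hR.1 φ)).1⟩

theorem IsCalculus.isSpectralMeasureOf (hc : IsCalculus μ Op) {H : 𝓗 →ₗ.[ℂ] 𝓗}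
    (hR : IsResolvent H (Op fun x => (u x)⁻¹)) : hc.toPVM.IsSpectralMeasureOf H := by
  refine ⟨fun ψ => ?_, fun ψ => ?_⟩
  · rw [hc.toPVM_scalar, mem_domain_iff_resolvent hR]
    refine ⟨?_, hc.exists_eq_inv_u⟩
    rintro ⟨φ, rfl⟩
    exact hc.integrable_sq_inv_u φ
  · obtain ⟨φ, hφ⟩ := (mem_domain_iff_resolvent hR ψ).mp ψ.2
    obtain ⟨h1, h2⟩ := apply_eq_of_mem_graph (hR.1 φ)
    have h3 : H ψ = Op (fun x : ℝ => (x : ℂ) * (u x)⁻¹) φ := by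
      rw [hc.mul_inv_u, add_apply, smul_apply, one_apply_eq_self, ← h2]
      congr 1
      exact Subtype.ext hφ
    rw [hc.toPVM_scalar, h3, hφ]
    exact (hc.integral_id_inv_u φ).symm

end

theorem exists_spectralMeasure {H : 𝓗 →ₗ.[ℂ] 𝓗} (hH : IsSelfAdjoint H) :
    ∃ P : PVM 𝓗, P.IsSpectralMeasureOf H := by
  obtain ⟨μ, Op, hc, h⟩ := exists_isCalculus_of_isSelfAdjoint hH (isResolvent_resolvent hH)
  exact ⟨hc.toPVM, hc.isSpectralMeasureOf (h ▸ isResolvent_resolvent hH)⟩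

/-- `funCalc` picks some spectral measure, so every one must be tied to the resolvent. The
definition fixes only the form ⟪ψ, Hψ⟫. Polarizing it on the range of Q = ∫ u⁻¹ dP gives HQ = ∫ x
u⁻¹ dP = 1 + iQ weakly against that dense range, whence Q = R. -/
theorem PVM.IsSpectralMeasureOf.integral_inv_u {P : PVM 𝓗} {H : 𝓗 →ₗ.[ℂ] 𝓗}
    (hP : P.IsSpectralMeasureOf H) {R : 𝓗 →L[ℂ] 𝓗} (hR : IsResolvent H R) :
    P.integral (fun x => (u x)⁻¹) = R := by
  have hc := P.isCalculus
  set Q := P.integral (fun x => (u x)⁻¹) with hQ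
  have hdom : ∀ φ, Q φ ∈ H.domain := fun φ => (hP.1 _).mpr (hc.integrable_sq_inv_u φ)
  let Q' : 𝓗 →ₗ[ℂ] H.domain := LinearMap.codRestrict H.domain Q.toLinearMap hdom
  let B : 𝓗 →ₗ[ℂ] 𝓗 := H.toFun ∘ₗ Q' - (P.integral fun x : ℝ => (x : ℂ) * (u x)⁻¹).toLinearMap
  have hB : ∀ φ, B φ = H ⟨Q φ, hdom φ⟩ - P.integral (fun x : ℝ => (x : ℂ) * (u x)⁻¹) φ :=
    fun φ => rfl
  have hzero : ∀ y x, inner ℂ (Q y) (B x) = 0 := by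
    refine polar_diag_eq_zero (Q := fun y x => inner ℂ (Q y) (B x)) (fun φ => ?_) ?_ ?_ ?_ ?_
    · rw [hB, inner_sub_right, ← hc.integral_id_inv_u φ, sub_eq_zero]
      exact hP.2 ⟨Q φ, hdom φ⟩
    · intro x y z; simp
    · intro x y z; simp
    · intro x y
      simp [mul_comm]
    · intro x y; simp
  -- Density of the range of Q: every spectral cutoff factors through Q*, hence annihilates v, while
  -- the cutoffs tend strongly to 1.
  have hinj : ∀ v, (∀ y, inner ℂ (Q y) v = 0) → v = 0 := by
    intro v hv
    have h1 : star Q v = 0 := by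
      refine ext_inner_left ℂ fun y => ?_
      rw [ContinuousLinearMap.star_eq_adjoint, ContinuousLinearMap.adjoint_inner_right, hv,
        inner_zero_right]
    refine tendsto_nhds_unique (hc.tendsto_cutoff v) (tendsto_const_nhds.congr fun N => ?_)
    have h2 : P.integral (cutoff N) =
        P.integral (fun x => starRingEnd ℂ (u x) * cutoff N x) * star Q := by
      rw [hQ, ← hc.star bddMeas_inv_u, ← hc.mul (fun x => starRingEnd ℂ (u x) * cutoff N x) _
        (bddMeas_mul_cutoff (Complex.continuous_conj.comp continuous_u) N) bddMeas_inv_u.star]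
      congr 1
      ext x
      have : starRingEnd ℂ (u x) ≠ 0 := by simpa using u_ne_zero x
      rw [map_inv₀]
      field_simp
    rw [h2, mul_apply_eq_comp, h1, map_zero]
  ext φ
  have h1 := hinj (B φ) fun y => hzero y φ
  rw [hB, sub_eq_zero, hc.mul_inv_u] at h1
  have h2 := hR.2 ⟨Q φ, hdom φ⟩
  rw [h1] at h2
  simpa [← hQ] using h2.symm

/-! ### The functional calculus of a self-adjoint operator -/

/-- The scalar spectral measures of a self-adjoint operator. -/
def specMeasure (H : 𝓗 →ₗ.[ℂ] 𝓗) (ψ : 𝓗) : Measure ℝ :=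
  open Classical in
  if h : ∃ P : PVM 𝓗, P.IsSpectralMeasureOf H then h.choose.scalar ψ else 0

theorem isCalculus_funCalc {H : 𝓗 →ₗ.[ℂ] 𝓗} (hH : IsSelfAdjoint H) :
    IsCalculus (specMeasure H) (funCalc H) := by
  have h := exists_spectralMeasure hH
  have h1 : specMeasure H = h.choose.scalar := by
    ext1 ψ
    rw [specMeasure, dif_pos h]
  have h2 : funCalc H = h.choose.integral := by
    ext1 g
    rw [funCalc, dif_pos h]
  rw [h1, h2]
  exact h.choose.isCalculus

theorem funCalc_inv_u {H : 𝓗 →ₗ.[ℂ] 𝓗} (hH : IsSelfAdjoint H) :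
    funCalc H (fun x => (u x)⁻¹) = resolvent H := by
  have h := exists_spectralMeasure hH
  rw [funCalc, dif_pos h]
  exact h.choose_spec.integral_inv_u (isResolvent_resolvent hH)

end RelMOI
end

noncomputable section
namespace RelMOI

/-! ### Products with alternating factors -/

section Chain

variable {M : Type*} [Monoid M] {n : ℕ}

/-- The product `A₀ W₀ A₁ W₁ ⋯ Wₙ₋₁ Aₙ`. -/
def chain (A : Fin (n + 1) → M) (W : Fin n → M) : M :=
  A 0 * (List.ofFn fun j : Fin n => W j * A j.succ).prod

theorem chain_zero (A : Fin 1 → M) (W : Fin 0 → M) : chain A W = A 0 := by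
  simp [chain]

theorem chain_succ (A : Fin (n + 2) → M) (W : Fin (n + 1) → M) :
    chain A W = A 0 * W 0 * chain (fun j => A j.succ) (fun j => W j.succ) := by
  simp only [chain, List.ofFn_succ, List.prod_cons]
  simp only [mul_assoc]

/-- Isolates one argument, with outer factors independent of it; linearity and strong continuity in
a slot are read off from this form. -/
theorem chain_slot (A : Fin (n + 1) → M) (W : Fin n → M) (k : Fin n) :
    ∃ X Y : M, ∀ w, chain A (Function.update W k w) = X * w * Y := by
  induction n with
  | zero => exact k.elim0
  | succ n ih =>
    refine Fin.cases ?_ (fun k => ?_) k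
    · refine ⟨A 0, chain (fun j => A j.succ) (fun j => W j.succ), fun w => ?_⟩
      rw [chain_succ, Function.update_self]
      congr 2
    · obtain ⟨X, Y, h⟩ := ih (fun j => A j.succ) (fun j => W j.succ) k
      refine ⟨A 0 * W 0 * X, Y, fun w => ?_⟩
      rw [chain_succ, Function.update_of_ne (Fin.succ_ne_zero k).symm]
      have : (fun j : Fin n => Function.update W k.succ w j.succ) =
          Function.update (fun j => W j.succ) k w := by
        ext j
        by_cases hj : j = k
        · subst hj; simp
        · rw [Function.update_of_ne hj, Function.update_of_ne (fun h => hj (Fin.succ_injective _ h))]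
      rw [this, h w]
      simp only [mul_assoc]

/-- Contracting the factors `Aᵢ Wᵢ Aᵢ₊₁` to one. -/
theorem chain_contract (A : Fin (n + 2) → M) (W : Fin (n + 1) → M) (i : Fin (n + 1)) :
    chain A W = chain (Function.update (fun j => A (i.succ.succAbove j)) i
      (A i.castSucc * W i * A i.succ)) (fun j => W (i.succAbove j)) := by
  induction n with
  | zero =>
    obtain rfl : i = 0 := Subsingleton.elim (α := Fin 1) _ _
    rw [chain_succ, chain_zero, chain_zero]
    simp
  | succ n ih =>
    refine Fin.cases ?_ (fun i => ?_) i
    · rw [chain_succ, chain_succ (fun j => A j.succ), chain_succ, Function.update_self]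
      have h1 : (fun j : Fin (n + 1) => Function.update
          (fun j => A ((0 : Fin (n + 2)).succ.succAbove j)) 0
            (A (Fin.castSucc 0) * W 0 * A (Fin.succ 0)) j.succ) = fun j => A j.succ.succ := by
        ext j
        rw [Function.update_of_ne (Fin.succ_ne_zero j), Fin.succ_succAbove_succ]
        simp
      rw [h1]
      simp [mul_assoc]
    · rw [chain_succ, ih (fun j => A j.succ) (fun j => W j.succ) i, chain_succ,
        Function.update_of_ne (Fin.succ_ne_zero i).symm]
      have h1 : (fun j : Fin (n + 1) => Function.update
          (fun j => A (i.succ.succ.succAbove j)) i.succ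
            (A (Fin.castSucc i.succ) * W i.succ * A i.succ.succ) j.succ) =
          Function.update (fun j => A (i.succ.succAbove j).succ) i
            (A i.castSucc.succ * W i.succ * A i.succ.succ) := by
        ext j
        by_cases hj : j = i
        · subst hj
          simp
        · rw [Function.update_of_ne hj, Function.update_of_ne (fun h => hj (Fin.succ_injective _ h)),
            Fin.succ_succAbove_succ]
      rw [h1]
      simp

/-- Moving a left factor of `Aₖ₊₁` to `Wₖ`. -/
theorem chain_move (A : Fin (n + 1) → M) (W : Fin n → M) (k : Fin n) (z : M) :
    chain (Function.update A k.succ (z * A k.succ)) W =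
      chain A (Function.update W k (W k * z)) := by
  have h : (fun j : Fin n => W j * Function.update A k.succ (z * A k.succ) j.succ) =
      fun j => Function.update W k (W k * z) j * A j.succ := by
    ext j
    by_cases hj : j = k
    · subst hj
      simp [mul_assoc]
    · rw [Function.update_of_ne hj, Function.update_of_ne (fun h => hj (Fin.succ_injective _ h))]
  rw [chain, chain, h, Function.update_of_ne (Fin.succ_ne_zero k).symm]

end Chain

theorem norm_chain_le {𝓑 : Type*} [NormedRing 𝓑] {n : ℕ} (A : Fin (n + 1) → 𝓑) (W : Fin n → 𝓑)
    {C D : ℝ} (hC0 : 0 ≤ C) (hD0 : 0 ≤ D) (hC : ∀ j, ‖A j‖ ≤ C) (hD : ∀ j, ‖W j‖ ≤ D) :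
    ‖chain A W‖ ≤ C * (D * C) ^ n := by
  induction n with
  | zero => rw [chain_zero]; simpa using hC 0
  | succ n ih =>
    rw [chain_succ]
    calc _ ≤ ‖A 0‖ * ‖W 0‖ * ‖chain (fun j => A j.succ) (fun j => W j.succ)‖ :=
          (norm_mul_le _ _).trans (mul_le_mul_of_nonneg_right (norm_mul_le _ _) (norm_nonneg _))
      _ ≤ C * D * (C * (D * C) ^ n) := by
          have := ih (fun j => A j.succ) (fun j => W j.succ) (fun j => hC _) fun j => hD _
          gcongr
          · exact hC 0
          · exact hD 0
      _ = _ := by ring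

variable {𝓗 : Type*} [NormedAddCommGroup 𝓗] [InnerProductSpace ℂ 𝓗]

/-- Matrix elements of a product with rank one factors. -/
theorem inner_chain_rankOne {n : ℕ} (A : Fin (n + 1) → 𝓗 →L[ℂ] 𝓗) (p q : Fin n → 𝓗) (y ψ : 𝓗) :
    inner ℂ y (chain A (fun j => InnerProductSpace.rankOne ℂ (p j) (q j)) ψ) =
      ∏ j, inner ℂ ((Fin.cons y q : Fin (n + 1) → 𝓗) j)
        (A j ((Fin.snoc p ψ : Fin (n + 1) → 𝓗) j)) := by
  induction n generalizing y with
  | zero =>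
    rw [chain_zero, Fin.prod_univ_one]
    rfl
  | succ n ih =>
    rw [chain_succ, Fin.prod_univ_succ]
    have h1 := ih (fun j => A j.succ) (fun j => p j.succ) (fun j => q j.succ) (q 0)
    simp only [mul_apply_eq_comp, InnerProductSpace.rankOne_apply, map_smul, inner_smul_right]
    rw [h1, mul_comm]
    have h2 : (Fin.snoc p ψ : Fin (n + 2) → 𝓗) 0 = p 0 := by simp
    rw [h2, Fin.cons_zero]
    congr 1
    · refine Finset.prod_congr rfl fun j _ => ?_
      rw [Fin.cons_succ]
      congr 1
      · refine Fin.cases ?_ (fun j => ?_) j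
        · simp
        · simp
      · congr 1
        refine Fin.lastCases ?_ (fun j => ?_) j
        · rw [Fin.snoc_last, Fin.succ_last, Fin.snoc_last]
        · rw [Fin.snoc_castSucc, Fin.succ_castSucc, Fin.snoc_castSucc]

/-! ### Measurable operator families -/

/-- A bounded, strongly measurable family of operators. -/
def IsOpFam {Ω : Type*} [MeasurableSpace Ω] (A : Ω → 𝓗 →L[ℂ] 𝓗) : Prop :=
  (∀ ψ, StronglyMeasurable fun ω => A ω ψ) ∧ ∃ C : ℝ, ∀ ω, ‖A ω‖ ≤ C

variable {Ω : Type*} [MeasurableSpace Ω]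

theorem IsOpFam.const (T : 𝓗 →L[ℂ] 𝓗) : IsOpFam fun _ : Ω => T :=
  ⟨fun _ => stronglyMeasurable_const, ‖T‖, fun _ => le_rfl⟩

theorem IsOpFam.sub {A B : Ω → 𝓗 →L[ℂ] 𝓗} (hA : IsOpFam A) (hB : IsOpFam B) :
    IsOpFam fun ω => A ω - B ω := by
  obtain ⟨hA1, C, hC⟩ := hA
  obtain ⟨hB1, D, hD⟩ := hB
  exact ⟨fun ψ => (hA1 ψ).sub (hB1 ψ), C + D, fun ω =>
    (norm_sub_le _ _).trans (add_le_add (hC ω) (hD ω))⟩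

theorem IsOpFam.integrable {A : Ω → 𝓗 →L[ℂ] 𝓗} (hA : IsOpFam A) (ν : Measure Ω)
    [IsFiniteMeasure ν] (ψ : 𝓗) : Integrable (fun ω => A ω ψ) ν := by
  obtain ⟨hA1, C, hC⟩ := hA
  exact Integrable.of_bound (hA1 ψ).aestronglyMeasurable (C * ‖ψ‖)
    (Eventually.of_forall fun ω => (A ω).le_of_opNorm_le (hC ω) ψ)

open Classical in
/-- The strong integral of an operator family. -/
def opInt (ν : Measure Ω) (A : Ω → 𝓗 →L[ℂ] 𝓗) : 𝓗 →L[ℂ] 𝓗 :=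
  if h : ∃ T : 𝓗 →L[ℂ] 𝓗, ∀ ψ, T ψ = ∫ ω, A ω ψ ∂ν then h.choose else 0

theorem opInt_apply [CompleteSpace 𝓗] {ν : Measure Ω} [IsFiniteMeasure ν] {A : Ω → 𝓗 →L[ℂ] 𝓗}
    (hA : IsOpFam A) (ψ : 𝓗) : opInt ν A ψ = ∫ ω, A ω ψ ∂ν := by
  have h : ∃ T : 𝓗 →L[ℂ] 𝓗, ∀ ψ, T ψ = ∫ ω, A ω ψ ∂ν := by
    obtain ⟨C, hC⟩ := hA.2
    refine ⟨LinearMap.mkContinuous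
      { toFun := fun ψ => ∫ ω, A ω ψ ∂ν
        map_add' := fun x y => by
          simp only [map_add]
          exact integral_add (hA.integrable ν x) (hA.integrable ν y)
        map_smul' := fun c x => by
          simp only [map_smul, RingHom.id_apply]
          exact integral_smul c _ } (C * ν.real Set.univ) fun ψ => ?_, fun ψ => rfl⟩
    refine (norm_integral_le_of_norm_le_const (C := C * ‖ψ‖) (Eventually.of_forall fun ω =>
      (A ω).le_of_opNorm_le (hC ω) ψ)).trans (le_of_eq ?_)
    ring
  rw [opInt, dif_pos h]
  exact h.choose_spec ψ

theorem norm_opInt_le [CompleteSpace 𝓗] {ν : Measure Ω} [IsFiniteMeasure ν] {A : Ω → 𝓗 →L[ℂ] 𝓗}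
    (hA : IsOpFam A) {C : ℝ} (hC0 : 0 ≤ C) (hC : ∀ ω, ‖A ω‖ ≤ C) :
    ‖opInt ν A‖ ≤ C * ν.real Set.univ := by
  refine ContinuousLinearMap.opNorm_le_bound _ (by positivity) fun ψ => ?_
  rw [opInt_apply hA]
  refine (norm_integral_le_of_norm_le_const (C := C * ‖ψ‖) (Eventually.of_forall fun ω =>
    (A ω).le_of_opNorm_le (hC ω) ψ)).trans (le_of_eq ?_)
  ring

variable [TopologicalSpace.SeparableSpace 𝓗]

/-- A Carathéodory argument: (ψ, ω) ↦ A ω ψ is continuous in ψ and measurable in ω. Separability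
makes it jointly measurable, and so products of families remain families. -/
theorem IsOpFam.apply {A : Ω → 𝓗 →L[ℂ] 𝓗} (hA : IsOpFam A) {v : Ω → 𝓗}
    (hv : StronglyMeasurable v) : StronglyMeasurable fun ω => A ω (v ω) := by
  borelize 𝓗
  have := UniformSpace.secondCountable_of_separable 𝓗
  have h := stronglyMeasurable_uncurry_of_continuous_of_stronglyMeasurable
    (u := fun (ψ : 𝓗) ω => A ω ψ) (fun ω => (A ω).continuous) hA.1
  exact h.comp_measurable (hv.measurable.prodMk measurable_id)

theorem IsOpFam.mul {A B : Ω → 𝓗 →L[ℂ] 𝓗} (hA : IsOpFam A) (hB : IsOpFam B) :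
    IsOpFam fun ω => A ω * B ω := by
  refine ⟨fun ψ => hA.apply (hB.1 ψ), ?_⟩
  obtain ⟨C, hC⟩ := hA.2
  obtain ⟨D, hD⟩ := hB.2
  exact ⟨C * D, fun ω => (norm_mul_le _ _).trans (mul_le_mul (hC ω) (hD ω) (norm_nonneg _)
    ((norm_nonneg _).trans (hC ω)))⟩

theorem IsOpFam.chain {n : ℕ} {A : Fin (n + 1) → Ω → 𝓗 →L[ℂ] 𝓗} (hA : ∀ j, IsOpFam (A j))
    (W : Fin n → 𝓗 →L[ℂ] 𝓗) : IsOpFam fun ω => chain (fun j => A j ω) W := by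
  induction n with
  | zero => simpa only [chain_zero] using hA 0
  | succ n ih =>
    simp only [chain_succ]
    exact ((hA 0).mul (IsOpFam.const _)).mul (ih (fun j => hA j.succ) _)

/-- A bound on the operator norm need only be tested on a dense sequence. No measurability of ω ↦ A
ω in the norm topology is assumed. -/
theorem IsOpFam.norm_measurable {A : Ω → 𝓗 →L[ℂ] 𝓗} (hA : IsOpFam A) :
    Measurable fun ω => ‖A ω‖ := by
  refine measurable_of_Iic fun c => ?_
  rcases lt_or_ge c 0 with hc | hc
  · have : (fun ω => ‖A ω‖) ⁻¹' Set.Iic c = ∅ := by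
      ext ω
      simp only [Set.mem_preimage, Set.mem_Iic, Set.mem_empty_iff_false, iff_false, not_le]
      exact lt_of_lt_of_le hc (norm_nonneg _)
    rw [this]
    exact MeasurableSet.empty
  · have : (fun ω => ‖A ω‖) ⁻¹' Set.Iic c =
        ⋂ k, {ω | ‖A ω (TopologicalSpace.denseSeq 𝓗 k)‖ ≤ c * ‖TopologicalSpace.denseSeq 𝓗 k‖} := by
      ext ω
      simp only [Set.mem_preimage, Set.mem_Iic, Set.mem_iInter, Set.mem_ofPred_eq]
      refine ⟨fun h k => (A ω).le_of_opNorm_le h _, fun h => ?_⟩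
      refine ContinuousLinearMap.opNorm_le_bound _ hc fun ψ => ?_
      have hcl : IsClosed {ψ | ‖A ω ψ‖ ≤ c * ‖ψ‖} :=
        isClosed_le (A ω).continuous.norm (continuous_const.mul continuous_norm)
      have := (TopologicalSpace.denseRange_denseSeq 𝓗).closure_range
      have hsub : closure (Set.range (TopologicalSpace.denseSeq 𝓗)) ⊆ {ψ | ‖A ω ψ‖ ≤ c * ‖ψ‖} :=
        closure_minimal (by rintro _ ⟨k, rfl⟩; exact h k) hcl
      exact hsub (this ▸ Set.mem_univ ψ)
    rw [this]
    exact MeasurableSet.iInter fun k => measurableSet_le (hA.1 _).norm.measurable measurable_const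

variable [CompleteSpace 𝓗]

theorem exists_countable_hilbertBasis : ∃ (ι : Set 𝓗) (_ : HilbertBasis ι ℂ 𝓗), Countable ι := by
  obtain ⟨w, b, -⟩ := exists_hilbertBasis ℂ 𝓗
  refine ⟨w, b, ?_⟩
  have hpair : Pairwise (Function.onFun Disjoint fun i => Metric.ball (b i) (1 / 2)) := by
    intro i j hij
    refine Metric.ball_disjoint_ball ?_
    have h1 : ‖b i - b j‖ ^ 2 = 2 := by
      rw [@norm_sub_sq ℂ, b.orthonormal.1 i, b.orthonormal.1 j, b.orthonormal.2 hij]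
      norm_num
    rw [dist_eq_norm]
    nlinarith [norm_nonneg (b i - b j)]
  exact hpair.countable_of_isOpen_disjoint (fun _ => Metric.isOpen_ball) fun i =>
    ⟨b i, Metric.mem_ball_self (by norm_num)⟩

theorem norm_partial_sum_le {ι : Type*} {b : ι → 𝓗} (hb : Orthonormal ℂ b) (F : Finset ι) (v : 𝓗) :
    ‖∑ i ∈ F, inner ℂ (b i) v • b i‖ ≤ ‖v‖ := by
  refine (pow_le_pow_iff_left₀ (norm_nonneg _) (norm_nonneg _) two_ne_zero).mp ?_
  refine le_trans (le_of_eq ?_) (hb.sum_inner_products_le v (s := F))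
  have h1 := hb.inner_sum (fun i => inner ℂ (b i) v) (fun i => inner ℂ (b i) v) F
  rw [inner_self_eq_norm_sq_to_K] at h1
  refine Complex.ofReal_injective ?_
  simp only [Complex.conj_mul'] at h1
  push_cast
  exact h1

/-- The form of Pettis' theorem needed here: v is the pointwise limit of its partial expansions in a
countable orthonormal basis. -/
theorem stronglyMeasurable_of_inner {v : Ω → 𝓗}
    (h : ∀ y, Measurable fun ω => inner ℂ y (v ω)) : StronglyMeasurable v := by
  obtain ⟨ι, b, hι⟩ := exists_countable_hilbertBasis (𝓗 := 𝓗)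
  refine stronglyMeasurable_of_tendsto (u := (atTop : Filter (Finset ι)))
    (f := fun F ω => ∑ i ∈ F, inner ℂ (b i) (v ω) • b i) (fun F => ?_) ?_
  · refine Finset.stronglyMeasurable_fun_sum F fun i _ => ?_
    exact (h (b i)).stronglyMeasurable.smul_const (b i)
  · rw [tendsto_pi_nhds]
    intro ω
    have := b.hasSum_repr (v ω)
    simpa only [HasSum, b.repr_apply_apply, SummationFilter.unconditional_filter] using this

/-- By polarization the matrix elements are combinations of parameter integrals of a jointly
measurable function, hence measurable; weak measurability is enough. -/
theorem isOpFam_funCalc {H : 𝓗 →ₗ.[ℂ] 𝓗} (hH : IsSelfAdjoint H) {a : ℝ → Ω → ℂ}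
    (ha : Measurable (Function.uncurry a)) {C : ℝ} (hC0 : 0 ≤ C) (hC : ∀ x ω, ‖a x ω‖ ≤ C) :
    IsOpFam fun ω => funCalc H (fun x => a x ω) := by
  have hc := isCalculus_funCalc hH
  have hm : ∀ ω, Measurable fun x => a x ω := fun ω =>
    ha.comp (measurable_id.prodMk measurable_const)
  have hb : ∀ ω, BddMeas fun x => a x ω := fun ω => ⟨hm ω, C, fun x => hC x ω⟩
  refine ⟨fun ψ => stronglyMeasurable_of_inner fun y => ?_, C, fun ω =>
    hc.norm_le (hm ω) hC0 fun x => hC x ω⟩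
  simp only [fun ω => hc.inner_eq_polar (hb ω) y ψ, polar]
  have hi : ∀ φ, Measurable fun ω => ∫ x, a x ω ∂(specMeasure H φ) := fun φ => by
    have := hc.finite φ
    have := ha.stronglyMeasurable.integral_prod_left (μ := specMeasure H φ)
    exact this.measurable
  exact ((((hi _).sub (hi _)).add (((hi _).sub (hi _)).const_mul _)).const_mul _)

end RelMOI
end

noncomputable section
namespace RelMOI

/-! ### Multiple operator integrals do not depend on the representation -/

variable {𝓗 : Type*} [NormedAddCommGroup 𝓗] [InnerProductSpace ℂ 𝓗] [CompleteSpace 𝓗]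

/-- The coefficients in the polarization identity. -/
def polarCoeff : Fin 4 → ℂ := ![1 / 4, -1 / 4, Complex.I / 4, -Complex.I / 4]

/-- The phases in the polarization identity. -/
def polarPhase : Fin 4 → ℂ := ![1, -1, Complex.I, -Complex.I]

theorem polar_eq_sum (Q : 𝓗 → ℂ) (y x : 𝓗) :
    polar Q y x = ∑ k, polarCoeff k * Q (x + polarPhase k • y) := by
  simp only [polar, polarCoeff, polarPhase, Fin.sum_univ_four, Matrix.cons_val_zero,
    Matrix.cons_val_one, Matrix.cons_val, one_smul, neg_smul, ← sub_eq_add_neg]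
  ring

namespace BSRep

attribute [instance] BSRep.mΩ BSRep.finite_ν

variable {n : ℕ} {φ χ : (Fin (n + 1) → ℝ) → ℂ}

theorem exists_bound (r : BSRep φ) : ∃ C : ℝ, 0 ≤ C ∧ ∀ j x ω, ‖r.a j x ω‖ ≤ C := by
  obtain ⟨C, hC⟩ := r.bounded_a
  exact ⟨max C 0, le_max_right _ _, fun j x ω => (hC j x ω).trans (le_max_left _ _)⟩

theorem bddMeas (r : BSRep φ) (j : Fin (n + 1)) (ω : r.Ω) : BddMeas fun x => r.a j x ω := by
  obtain ⟨C, hC⟩ := r.bounded_a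
  exact ⟨(r.measurable_a j).comp (measurable_id.prodMk measurable_const), C, fun x => hC j x ω⟩

/-- The operators `aⱼ(Hⱼ, ω)`. -/
def fam (r : BSRep φ) (H : Fin (n + 1) → 𝓗 →ₗ.[ℂ] 𝓗) (j : Fin (n + 1)) (ω : r.Ω) : 𝓗 →L[ℂ] 𝓗 :=
  funCalc (H j) fun x => r.a j x ω

theorem moiVec_eq (r : BSRep φ) (H : Fin (n + 1) → 𝓗 →ₗ.[ℂ] 𝓗) (W : Fin n → 𝓗 →L[ℂ] 𝓗) (ψ : 𝓗) :
    r.moiVec H W ψ = ∫ ω, chain (fun j => r.fam H j ω) W ψ ∂r.ν := rfl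

/-- The multiple operator integral as an operator. -/
def moi (r : BSRep φ) (H : Fin (n + 1) → 𝓗 →ₗ.[ℂ] 𝓗) (W : Fin n → 𝓗 →L[ℂ] 𝓗) : 𝓗 →L[ℂ] 𝓗 :=
  opInt r.ν fun ω => chain (fun j => r.fam H j ω) W

theorem norm_fam_le (r : BSRep φ) {H : Fin (n + 1) → 𝓗 →ₗ.[ℂ] 𝓗} (hH : ∀ j, IsSelfAdjoint (H j))
    {C : ℝ} (hC0 : 0 ≤ C) (hC : ∀ j x ω, ‖r.a j x ω‖ ≤ C) (j : Fin (n + 1)) (ω : r.Ω) :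
    ‖r.fam H j ω‖ ≤ C :=
  (isCalculus_funCalc (hH j)).norm_le (r.bddMeas j ω).1 hC0 fun x => hC j x ω

/-- Matrix elements of the multiple operator integral with rank one arguments. -/
theorem integral_prod_inner (r : BSRep φ) {H : Fin (n + 1) → 𝓗 →ₗ.[ℂ] 𝓗}
    (hH : ∀ j, IsSelfAdjoint (H j)) (L S : Fin (n + 1) → 𝓗) :
    ∫ ω, ∏ j, inner ℂ (L j) (r.fam H j ω (S j)) ∂r.ν =
      ∑ κ : Fin (n + 1) → Fin 4, (∏ j, polarCoeff (κ j)) *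
        ∫ l, φ l ∂(Measure.pi fun j => specMeasure (H j) (S j + polarPhase (κ j) • L j)) := by
  obtain ⟨C, hC0, hC⟩ := r.exists_bound
  have hfin : ∀ j ψ, IsFiniteMeasure (specMeasure (H j) ψ) := fun j =>
    (isCalculus_funCalc (hH j)).finite
  -- Each factor is a sum of four integrals. Expanding the product over κ gives products of
  -- one-variable integrals, that is, integrals over product measures; Fubini then carries out the
  -- ω-integral first and reproduces φ.
  have h1 : ∀ ω, ∏ j, inner ℂ (L j) (r.fam H j ω (S j)) =
      ∑ κ : Fin (n + 1) → Fin 4, ∏ j, (polarCoeff (κ j) *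
        ∫ x, r.a j x ω ∂(specMeasure (H j) (S j + polarPhase (κ j) • L j))) := by
    intro ω
    have h2 : ∀ j, inner ℂ (L j) (r.fam H j ω (S j)) = ∑ k, polarCoeff k *
        ∫ x, r.a j x ω ∂(specMeasure (H j) (S j + polarPhase k • L j)) := by
      intro j
      rw [fam, (isCalculus_funCalc (hH j)).inner_eq_polar (r.bddMeas j ω), polar_eq_sum]
    simp only [h2, Finset.prod_univ_sum, Fintype.piFinset_univ]
  have hmeas : ∀ κ : Fin (n + 1) → Fin 4, Integrable
      (Function.uncurry fun (ω : r.Ω) (l : Fin (n + 1) → ℝ) => ∏ j, r.a j (l j) ω)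
      (r.ν.prod (Measure.pi fun j => specMeasure (H j) (S j + polarPhase (κ j) • L j))) := by
    intro κ
    refine Integrable.of_bound (C := C ^ (n + 1)) ?_ (Eventually.of_forall fun p => ?_)
    · refine Measurable.aestronglyMeasurable ?_
      simp only [Function.uncurry_def]
      refine Finset.measurable_fun_prod _ fun j _ => ?_
      have := (r.measurable_a j).comp (f := fun p : r.Ω × (Fin (n + 1) → ℝ) => (p.2 j, p.1))
        (((measurable_pi_apply j).comp measurable_snd).prodMk measurable_fst)
      exact this
    · simp only [Function.uncurry_def, norm_prod]
      refine (Finset.prod_le_prod (fun _ _ => norm_nonneg _) fun j _ => hC j _ _).trans ?_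
      simp
  have h3 : ∀ (κ : Fin (n + 1) → Fin 4) ω, ∏ j, (polarCoeff (κ j) *
        ∫ x, r.a j x ω ∂(specMeasure (H j) (S j + polarPhase (κ j) • L j))) =
      (∏ j, polarCoeff (κ j)) * ∫ l, ∏ j, r.a j (l j) ω
        ∂(Measure.pi fun j => specMeasure (H j) (S j + polarPhase (κ j) • L j)) := by
    intro κ ω
    rw [Finset.prod_mul_distrib]
    congr 1
    exact (integral_fintype_prod_eq_prod (fun j x => r.a j x ω)).symm
  simp only [h1, h3]
  rw [integral_finsetSum]
  · refine Finset.sum_congr rfl fun κ _ => ?_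
    rw [integral_const_mul, integral_integral_swap (hmeas κ)]
    simp only [← r.eq_integral]
  · intro κ _
    exact ((hmeas κ).integral_prod_left).const_mul _

variable [TopologicalSpace.SeparableSpace 𝓗]

theorem isOpFam_fam (r : BSRep φ) {H : Fin (n + 1) → 𝓗 →ₗ.[ℂ] 𝓗} (hH : ∀ j, IsSelfAdjoint (H j))
    (j : Fin (n + 1)) : IsOpFam (r.fam H j) := by
  obtain ⟨C, hC0, hC⟩ := r.exists_bound
  exact isOpFam_funCalc (hH j) (r.measurable_a j) hC0 fun x ω => hC j x ω

theorem isOpFam_chain (r : BSRep φ) {H : Fin (n + 1) → 𝓗 →ₗ.[ℂ] 𝓗} (hH : ∀ j, IsSelfAdjoint (H j))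
    (W : Fin n → 𝓗 →L[ℂ] 𝓗) : IsOpFam fun ω => chain (fun j => r.fam H j ω) W :=
  IsOpFam.chain (r.isOpFam_fam hH) W

theorem moi_apply (r : BSRep φ) {H : Fin (n + 1) → 𝓗 →ₗ.[ℂ] 𝓗} (hH : ∀ j, IsSelfAdjoint (H j))
    (W : Fin n → 𝓗 →L[ℂ] 𝓗) (ψ : 𝓗) :
    r.moi H W ψ = ∫ ω, chain (fun j => r.fam H j ω) W ψ ∂r.ν :=
  opInt_apply (r.isOpFam_chain hH W) ψ

/-- Rank one arguments decouple the factors, and `integral_prod_inner` evaluates the matrix elements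
by an expression in which only φ occurs, not the representation. -/
theorem moi_rankOne_congr (r s : BSRep φ) {H : Fin (n + 1) → 𝓗 →ₗ.[ℂ] 𝓗}
    (hH : ∀ j, IsSelfAdjoint (H j)) (p q : Fin n → 𝓗) :
    r.moi H (fun j => InnerProductSpace.rankOne ℂ (p j) (q j)) =
      s.moi H (fun j => InnerProductSpace.rankOne ℂ (p j) (q j)) := by
  have key : ∀ (r : BSRep φ) (y ψ : 𝓗),
      inner ℂ y (r.moi H (fun j => InnerProductSpace.rankOne ℂ (p j) (q j)) ψ) =
        ∑ κ : Fin (n + 1) → Fin 4, (∏ j, polarCoeff (κ j)) *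
          ∫ l, φ l ∂(Measure.pi fun j => specMeasure (H j) ((Fin.snoc p ψ : Fin (n + 1) → 𝓗) j +
            polarPhase (κ j) • (Fin.cons y q : Fin (n + 1) → 𝓗) j)) := by
    intro r y ψ
    rw [r.moi_apply hH, ← integral_inner ((r.isOpFam_chain hH _).integrable r.ν ψ),
      ← r.integral_prod_inner hH]
    simp only [inner_chain_rankOne]
  ext ψ
  exact ext_inner_left ℂ fun y => by rw [key r, key s]

theorem moi_slot_linear (r : BSRep φ) {H : Fin (n + 1) → 𝓗 →ₗ.[ℂ] 𝓗}
    (hH : ∀ j, IsSelfAdjoint (H j)) (W : Fin n → 𝓗 →L[ℂ] 𝓗) (k : Fin n) {ι : Type*}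
    (F : Finset ι) (w : ι → 𝓗 →L[ℂ] 𝓗) :
    r.moi H (Function.update W k (∑ i ∈ F, w i)) = ∑ i ∈ F, r.moi H (Function.update W k (w i)) := by
  ext ψ
  rw [r.moi_apply hH, sum_apply]
  simp only [r.moi_apply hH]
  rw [← integral_finsetSum F fun i _ => (r.isOpFam_chain hH _).integrable r.ν ψ]
  congr 1
  ext ω
  obtain ⟨X, Y, h⟩ := chain_slot (fun j => r.fam H j ω) W k
  simp only [h, Finset.mul_sum, Finset.sum_mul]
  rw [sum_apply]

/-- The multiple operator integral depends continuously on each argument. -/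
theorem tendsto_moi_slot (r : BSRep φ) {H : Fin (n + 1) → 𝓗 →ₗ.[ℂ] 𝓗}
    (hH : ∀ j, IsSelfAdjoint (H j)) (W : Fin n → 𝓗 →L[ℂ] 𝓗) (k : Fin n) {ι : Type*}
    {l : Filter ι} [l.IsCountablyGenerated] {w : ι → 𝓗 →L[ℂ] 𝓗} {T : 𝓗 →L[ℂ] 𝓗} {D : ℝ}
    (hD : ∀ i, ‖w i‖ ≤ D) (hw : ∀ ψ, Tendsto (fun i => w i ψ) l (𝓝 (T ψ))) (ψ : 𝓗) :
    Tendsto (fun i => r.moi H (Function.update W k (w i)) ψ) l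
      (𝓝 (r.moi H (Function.update W k T) ψ)) := by
  obtain ⟨C, hC0, hC⟩ := r.exists_bound
  simp only [r.moi_apply hH]
  set E := ∑ j, ‖W j‖ + |D| with hE
  have hE0 : 0 ≤ E := by positivity
  have hWE : ∀ i j, ‖Function.update W k (w i) j‖ ≤ E := by
    intro i j
    by_cases hj : j = k
    · subst hj
      rw [Function.update_self]
      have : 0 ≤ ∑ j, ‖W j‖ := by positivity
      linarith [hD i, le_abs_self D]
    · rw [Function.update_of_ne hj]
      have := Finset.single_le_sum (f := fun j => ‖W j‖) (fun j _ => norm_nonneg _)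
        (Finset.mem_univ j)
      linarith [abs_nonneg D]
  refine tendsto_integral_filter_of_dominated_convergence (fun _ => C * (E * C) ^ n * ‖ψ‖)
    (Eventually.of_forall fun i => ((r.isOpFam_chain hH _).1 ψ).aestronglyMeasurable)
    (Eventually.of_forall fun i => Eventually.of_forall fun ω => ?_) (integrable_const _)
    (Eventually.of_forall fun ω => ?_)
  · exact ContinuousLinearMap.le_of_opNorm_le _ (norm_chain_le _ _ hC0 hE0
      (fun j => r.norm_fam_le hH hC0 hC j ω) (hWE i)) ψ
  · obtain ⟨X, Y, h⟩ := chain_slot (fun j => r.fam H j ω) W k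
    simp only [h, mul_apply_eq_comp]
    exact (X.continuous.tendsto _).comp (hw (Y ψ))

/-- The multiple operator integral does not depend on the representation. -/
theorem moi_congr (r s : BSRep φ) {H : Fin (n + 1) → 𝓗 →ₗ.[ℂ] 𝓗}
    (hH : ∀ j, IsSelfAdjoint (H j)) (W : Fin n → 𝓗 →L[ℂ] 𝓗) : r.moi H W = s.moi H W := by
  obtain ⟨ι, b, hι⟩ := exists_countable_hilbertBasis (𝓗 := 𝓗)
  -- Induction on the number k of leading slots that are still arbitrary. The last of them is
  -- replaced by its compressions to finitely many basis vectors: sums of rank one operators,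
  -- bounded by the norm of the slot and strongly convergent to it.
  have key : ∀ (k : ℕ) (W : Fin n → 𝓗 →L[ℂ] 𝓗),
      (∀ j : Fin n, k ≤ j.val → ∃ p q, W j = InnerProductSpace.rankOne ℂ p q) →
        r.moi H W = s.moi H W := by
    intro k
    induction k with
    | zero =>
      intro W hW
      choose p q hpq using fun j => hW j (Nat.zero_le _)
      obtain rfl : W = fun j => InnerProductSpace.rankOne ℂ (p j) (q j) := funext hpq
      exact moi_rankOne_congr r s hH p q
    | succ k ih =>
      intro W hW
      by_cases hk : k < n
      · set k' : Fin n := ⟨k, hk⟩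
        set w : Finset ι → 𝓗 →L[ℂ] 𝓗 := fun F => ∑ i ∈ F, InnerProductSpace.rankOne ℂ (b i)
          (ContinuousLinearMap.adjoint (W k') (b i)) with hw
        have happ : ∀ F ψ, w F ψ = ∑ i ∈ F, inner ℂ (b i) (W k' ψ) • b i := by
          intro F ψ
          simp only [hw]
          rw [sum_apply]
          simp only [InnerProductSpace.rankOne_apply, ContinuousLinearMap.adjoint_inner_left]
        have hbd : ∀ F, ‖w F‖ ≤ ‖W k'‖ := fun F =>
          ContinuousLinearMap.opNorm_le_bound _ (norm_nonneg _) fun ψ => by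
            rw [happ]
            exact (norm_partial_sum_le b.orthonormal F _).trans ((W k').le_opNorm ψ)
        have hlim : ∀ ψ, Tendsto (fun F => w F ψ) atTop (𝓝 (W k' ψ)) := by
          intro ψ
          have := b.hasSum_repr (W k' ψ)
          simp only [HasSum, b.repr_apply_apply, SummationFilter.unconditional_filter] at this
          simpa only [happ] using this
        have heq : ∀ F, r.moi H (Function.update W k' (w F)) =
            s.moi H (Function.update W k' (w F)) := by
          intro F
          rw [hw, r.moi_slot_linear hH, s.moi_slot_linear hH]
          refine Finset.sum_congr rfl fun i _ => ih _ fun j hj => ?_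
          by_cases hjk : j = k'
          · subst hjk
            exact ⟨_, _, Function.update_self _ _ _⟩
          · rw [Function.update_of_ne hjk]
            refine hW j ?_
            have : j.val ≠ k := fun h => hjk (Fin.ext h)
            omega
        ext ψ
        have h1 := r.tendsto_moi_slot hH W k' hbd hlim ψ
        have h2 := s.tendsto_moi_slot hH W k' hbd hlim ψ
        simp only [heq, Function.update_eq_self] at h1 h2
        exact tendsto_nhds_unique h1 h2
      · exact ih W fun j hj => absurd j.2 (by omega)
  exact key n W fun j hj => absurd j.2 (by omega)

end BSRep

end RelMOI
end

noncomputable section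
namespace RelMOI

/-! ### Operations on representations -/

section ChainLemmas

variable {M : Type*} [Monoid M] {n : ℕ}

theorem chain_move_left (A : Fin (n + 1) → M) (W : Fin n → M) (k : Fin n) (z : M) :
    chain (Function.update A k.castSucc (A k.castSucc * z)) W =
      chain A (Function.update W k (z * W k)) := by
  induction n with
  | zero => exact k.elim0
  | succ n ih =>
    refine Fin.cases ?_ (fun k => ?_) k
    · rw [chain_succ, chain_succ]
      simp [mul_assoc, Fin.succ_ne_zero]
    · rw [chain_succ, chain_succ]
      have h1 : (fun j : Fin (n + 1) => Function.update A k.succ.castSucc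
          (A k.succ.castSucc * z) j.succ) =
          Function.update (fun j => A j.succ) k.castSucc (A k.castSucc.succ * z) := by
        ext j
        rw [Function.update_apply, Function.update_apply]
        simp [Fin.ext_iff]
      have h2 : (fun j : Fin n => Function.update W k.succ (z * W k.succ) j.succ) =
          Function.update (fun j => W j.succ) k (z * W k.succ) := by
        ext j
        rw [Function.update_apply, Function.update_apply]
        simp
      rw [h1, h2, ih (fun j => A j.succ) (fun j => W j.succ) k]
      rw [Function.update_of_ne (by simp [Fin.ext_iff]),
        Function.update_of_ne (Fin.succ_ne_zero k).symm]

theorem chain_mul_right (A B : Fin (n + 1) → M) (W : Fin n → M) (h0 : B 0 = 1) :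
    chain (fun j => B j * A j) W = chain A (fun j => W j * B j.succ) := by
  simp only [chain, h0, one_mul, mul_assoc]

end ChainLemmas

variable {𝓗 : Type*} [NormedAddCommGroup 𝓗] [InnerProductSpace ℂ 𝓗] [CompleteSpace 𝓗]

theorem measurableEmbedding_inl {X Y : Type*} [MeasurableSpace X] [MeasurableSpace Y] :
    MeasurableEmbedding (Sum.inl : X → X ⊕ Y) :=
  ⟨Sum.inl_injective, measurable_inl, fun _ hs => hs.inl_image⟩

theorem measurableEmbedding_inr {X Y : Type*} [MeasurableSpace X] [MeasurableSpace Y] :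
    MeasurableEmbedding (Sum.inr : Y → X ⊕ Y) :=
  ⟨Sum.inr_injective, measurable_inr, fun _ hs => measurableSet_inr_image.mpr hs⟩

theorem funCalc_one {H : 𝓗 →ₗ.[ℂ] 𝓗} (hH : IsSelfAdjoint H) : funCalc H (fun _ => 1) = 1 :=
  (isCalculus_funCalc hH).one

namespace BSRep

variable {n : ℕ} {φ χ : (Fin (n + 1) → ℝ) → ℂ}

/-- The representation is continuous in the real variables. -/
def IsCont (r : BSRep φ) : Prop := ∀ j ω, Continuous fun x => r.a j x ω

/-- Multiplication by a product of functions of one variable. -/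
abbrev mulAll (r : BSRep φ) (g : Fin (n + 1) → ℝ → ℂ) (hg : ∀ j, BddMeas (g j)) :
    BSRep (fun l => φ l * ∏ j, g j (l j)) where
  Ω := r.Ω
  ν := r.ν
  a := fun j x ω => r.a j x ω * g j x
  measurable_a := fun j => (r.measurable_a j).mul ((hg j).1.comp measurable_fst)
  bounded_a := by
    obtain ⟨C, hC0, hC⟩ := r.exists_bound
    choose D hD0 hD using fun j => (hg j).exists_nonneg
    refine ⟨C * ∑ j, D j, fun j x ω => ?_⟩
    rw [norm_mul]
    exact mul_le_mul (hC j x ω) ((hD j x).trans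
      (Finset.single_le_sum (fun j _ => hD0 j) (Finset.mem_univ j))) (norm_nonneg _) hC0
  eq_integral := fun l => by
    simp only [Finset.prod_mul_distrib, r.eq_integral]
    rw [integral_mul_const]

theorem fam_mulAll_left (r : BSRep φ) (g : Fin (n + 1) → ℝ → ℂ) (hg : ∀ j, BddMeas (g j))
    {H : Fin (n + 1) → 𝓗 →ₗ.[ℂ] 𝓗} (hH : ∀ j, IsSelfAdjoint (H j)) (j : Fin (n + 1)) (ω : r.Ω) :
    (r.mulAll g hg).fam H j ω = funCalc (H j) (g j) * r.fam H j ω := by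
  rw [fam, fam, ← (isCalculus_funCalc (hH j)).mul _ _ (hg j) (r.bddMeas j ω)]
  simp only [mul_comm]

/-- Moving factors into the arguments of the multiple operator integral. -/
theorem moi_mulAll (r : BSRep φ) (g : Fin (n + 1) → ℝ → ℂ) (hg : ∀ j, BddMeas (g j))
    (hg0 : g 0 = fun _ => 1) {H : Fin (n + 1) → 𝓗 →ₗ.[ℂ] 𝓗} (hH : ∀ j, IsSelfAdjoint (H j))
    (W : Fin n → 𝓗 →L[ℂ] 𝓗) :
    (r.mulAll g hg).moi H W = r.moi H (fun j => W j * funCalc (H j.succ) (g j.succ)) := by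
  have : (fun ω => chain (fun j => (r.mulAll g hg).fam H j ω) W) =
      fun ω => chain (fun j => r.fam H j ω) (fun j => W j * funCalc (H j.succ) (g j.succ)) := by
    ext1 ω
    simp only [r.fam_mulAll_left g hg hH]
    exact chain_mul_right _ _ W (by rw [hg0, funCalc_one (hH 0)])
  exact congrArg (opInt r.ν) this

/-- Multiplication by a function of one variable. -/
abbrev mulAt (r : BSRep φ) (k : Fin (n + 1)) (g : ℝ → ℂ) (hg : BddMeas g) :
    BSRep (fun l => φ l * g (l k)) where
  Ω := r.Ω
  ν := r.ν
  a := fun j x ω => r.a j x ω * (if j = k then g x else 1)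
  measurable_a := fun j => by
    by_cases h : j = k
    · simp only [h, if_true]
      exact (r.measurable_a k).mul (hg.1.comp measurable_fst)
    · simp only [h, if_false, mul_one]
      exact r.measurable_a j
  bounded_a := by
    obtain ⟨C, hC0, hC⟩ := r.exists_bound
    obtain ⟨D, hD0, hD⟩ := hg.exists_nonneg
    refine ⟨C * (D + 1), fun j x ω => ?_⟩
    rw [norm_mul]
    refine mul_le_mul (hC j x ω) ?_ (norm_nonneg _) hC0
    split_ifs
    · linarith [hD x]
    · simpa using hD0
  eq_integral := fun l => by
    simp only [Finset.prod_mul_distrib, r.eq_integral]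
    rw [integral_mul_const]
    simp

theorem fam_mulAt (r : BSRep φ) (k : Fin (n + 1)) {g : ℝ → ℂ} (hg : BddMeas g)
    {H : Fin (n + 1) → 𝓗 →ₗ.[ℂ] 𝓗} (hH : ∀ j, IsSelfAdjoint (H j)) (ω : r.Ω) :
    (fun j => (r.mulAt k g hg).fam H j ω) =
      Function.update (fun j => r.fam H j ω) k (r.fam H k ω * funCalc (H k) g) := by
  ext1 j
  by_cases h : j = k
  · subst h
    rw [Function.update_self, fam, fam, ← (isCalculus_funCalc (hH j)).mul _ _ (r.bddMeas j ω) hg]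
    simp
  · rw [Function.update_of_ne h, fam, fam]
    simp [h]

theorem fam_mul_comm (r : BSRep φ) (k : Fin (n + 1)) {g : ℝ → ℂ} (hg : BddMeas g)
    {H : Fin (n + 1) → 𝓗 →ₗ.[ℂ] 𝓗} (hH : ∀ j, IsSelfAdjoint (H j)) (ω : r.Ω) :
    r.fam H k ω * funCalc (H k) g = funCalc (H k) g * r.fam H k ω := by
  rw [fam, ← (isCalculus_funCalc (hH k)).mul _ _ hg (r.bddMeas k ω),
    ← (isCalculus_funCalc (hH k)).mul _ _ (r.bddMeas k ω) hg]
  simp only [mul_comm]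

theorem IsCont.mulAt {r : BSRep φ} (hr : r.IsCont) (k : Fin (n + 1)) {g : ℝ → ℂ}
    (hg : BddMeas g) (hgc : Continuous g) : (r.mulAt k g hg).IsCont := by
  intro j ω
  by_cases h : j = k
  · simp only [h, if_true]
    exact (hr k ω).mul hgc
  · simpa [BSRep.mulAt, h] using hr j ω

theorem moi_mulAt_succ (r : BSRep φ) (k : Fin n) {g : ℝ → ℂ} (hg : BddMeas g)
    {H : Fin (n + 1) → 𝓗 →ₗ.[ℂ] 𝓗} (hH : ∀ j, IsSelfAdjoint (H j)) (W : Fin n → 𝓗 →L[ℂ] 𝓗) :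
    (r.mulAt k.succ g hg).moi H W =
      r.moi H (Function.update W k (W k * funCalc (H k.succ) g)) := by
  have : (fun ω => chain (fun j => (r.mulAt k.succ g hg).fam H j ω) W) =
      fun ω => chain (fun j => r.fam H j ω)
        (Function.update W k (W k * funCalc (H k.succ) g)) := by
    ext1 ω
    rw [r.fam_mulAt k.succ hg hH ω, r.fam_mul_comm _ hg hH, chain_move]
  exact congrArg (opInt r.ν) this

theorem moi_mulAt_castSucc (r : BSRep φ) (k : Fin n) {g : ℝ → ℂ} (hg : BddMeas g)
    {H : Fin (n + 1) → 𝓗 →ₗ.[ℂ] 𝓗} (hH : ∀ j, IsSelfAdjoint (H j)) (W : Fin n → 𝓗 →L[ℂ] 𝓗) :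
    (r.mulAt k.castSucc g hg).moi H W =
      r.moi H (Function.update W k (funCalc (H k.castSucc) g * W k)) := by
  have : (fun ω => chain (fun j => (r.mulAt k.castSucc g hg).fam H j ω) W) =
      fun ω => chain (fun j => r.fam H j ω)
        (Function.update W k (funCalc (H k.castSucc) g * W k)) := by
    ext1 ω
    rw [r.fam_mulAt k.castSucc hg hH ω, chain_move_left]
  exact congrArg (opInt r.ν) this

/-- Insertion of a dummy variable. -/
abbrev insert (r : BSRep φ) (p : Fin (n + 2)) : BSRep (fun l => φ (fun j => l (p.succAbove j))) where
  Ω := r.Ω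
  ν := r.ν
  a := p.insertNth (fun _ _ => 1) r.a
  measurable_a := fun j => by
    rcases Fin.eq_self_or_eq_succAbove p j with rfl | ⟨k, rfl⟩
    · simp only [Fin.insertNth_apply_same]
      exact measurable_const
    · simp only [Fin.insertNth_apply_succAbove]
      exact r.measurable_a k
  bounded_a := by
    obtain ⟨C, hC0, hC⟩ := r.exists_bound
    refine ⟨C + 1, fun j x ω => ?_⟩
    rcases Fin.eq_self_or_eq_succAbove p j with rfl | ⟨k, rfl⟩
    · simpa using hC0
    · simp only [Fin.insertNth_apply_succAbove]
      linarith [hC k x ω]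
  eq_integral := fun l => by
    rw [r.eq_integral]
    simp only [Fin.prod_univ_succAbove _ p, Fin.insertNth_apply_same,
      Fin.insertNth_apply_succAbove, one_mul]

theorem IsCont.insert {r : BSRep φ} (hr : r.IsCont) (p : Fin (n + 2)) : (r.insert p).IsCont := by
  intro j ω
  rcases Fin.eq_self_or_eq_succAbove p j with rfl | ⟨k, rfl⟩
  · simpa [BSRep.insert] using continuous_const
  · simpa [BSRep.insert] using hr k ω

theorem fam_insert_same (r : BSRep φ) (p : Fin (n + 2)) {H : Fin (n + 2) → 𝓗 →ₗ.[ℂ] 𝓗}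
    (hH : ∀ j, IsSelfAdjoint (H j)) (ω : r.Ω) : (r.insert p).fam H p ω = 1 := by
  rw [fam, ← funCalc_one (hH p)]
  simp

theorem fam_insert_succAbove (r : BSRep φ) (p : Fin (n + 2)) (H : Fin (n + 2) → 𝓗 →ₗ.[ℂ] 𝓗)
    (j : Fin (n + 1)) (ω : r.Ω) :
    (r.insert p).fam H (p.succAbove j) ω = r.fam (fun j => H (p.succAbove j)) j ω := by
  simp [fam]

theorem castSucc_eq_succ_succAbove (i : Fin n) : i.castSucc = i.succ.succAbove i := by
  rw [Fin.succAbove_of_castSucc_lt _ _ (Fin.castSucc_lt_succ)]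

theorem succ_eq_castSucc_succAbove (i : Fin n) : i.succ = i.castSucc.succAbove i := by
  rw [Fin.succAbove_of_le_castSucc _ _ le_rfl]

theorem succAbove_eq_of_ne {i j : Fin n} (h : j ≠ i) :
    i.succ.succAbove j = i.castSucc.succAbove j := by
  rcases lt_or_gt_of_ne h with h | h
  · rw [Fin.succAbove_of_castSucc_lt i.succ _
        ((Fin.castSucc_lt_castSucc_iff.mpr h).trans Fin.castSucc_lt_succ),
      Fin.succAbove_of_castSucc_lt _ _ (Fin.castSucc_lt_castSucc_iff.mpr h)]
  · rw [Fin.succAbove_of_le_castSucc i.succ _ (Fin.succ_le_castSucc_iff.mpr h),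
      Fin.succAbove_of_le_castSucc _ _ (Fin.castSucc_le_castSucc_iff.mpr h.le)]

theorem moi_insert_succ (r : BSRep φ) (i : Fin (n + 1)) {H : Fin (n + 2) → 𝓗 →ₗ.[ℂ] 𝓗}
    (hH : ∀ j, IsSelfAdjoint (H j)) (W : Fin (n + 1) → 𝓗 →L[ℂ] 𝓗) :
    (r.insert i.succ).moi H (Function.update W i 1) =
      r.moi (fun j => H (i.succ.succAbove j)) (fun j => W (i.succAbove j)) := by
  have : (fun ω => chain (fun j => (r.insert i.succ).fam H j ω) (Function.update W i 1)) =
      fun ω => chain (fun j => r.fam (fun j => H (i.succ.succAbove j)) j ω)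
        (fun j => W (i.succAbove j)) := by
    ext1 ω
    rw [chain_contract _ _ i]
    simp only [Function.update_self, Function.update_of_ne (Fin.succAbove_ne i _), mul_one]
    rw [r.fam_insert_same _ hH, mul_one, castSucc_eq_succ_succAbove i, Function.update_eq_self]
    simp only [fam_insert_succAbove]
  exact congrArg (opInt r.ν) this

theorem moi_insert_castSucc (r : BSRep φ) (i : Fin (n + 1)) {H : Fin (n + 2) → 𝓗 →ₗ.[ℂ] 𝓗}
    (hH : ∀ j, IsSelfAdjoint (H j)) (W : Fin (n + 1) → 𝓗 →L[ℂ] 𝓗) (z : 𝓗 →L[ℂ] 𝓗) :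
    (r.insert i.castSucc).moi H (Function.update W i z) =
      opInt r.ν fun ω => chain (Function.update
        (fun j => r.fam (fun j => H (i.castSucc.succAbove j)) j ω) i
          (z * r.fam (fun j => H (i.castSucc.succAbove j)) i ω)) (fun j => W (i.succAbove j)) := by
  have : (fun ω => chain (fun j => (r.insert i.castSucc).fam H j ω) (Function.update W i z)) =
      fun ω => chain (Function.update
        (fun j => r.fam (fun j => H (i.castSucc.succAbove j)) j ω) i
          (z * r.fam (fun j => H (i.castSucc.succAbove j)) i ω)) (fun j => W (i.succAbove j)) := by
    ext1 ω
    rw [chain_contract _ _ i]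
    simp only [Function.update_self, Function.update_of_ne (Fin.succAbove_ne i _)]
    rw [r.fam_insert_same _ hH, one_mul, ← fam_insert_succAbove r i.castSucc H i ω,
      ← succ_eq_castSucc_succAbove i]
    congr 1
    ext1 j
    by_cases hj : j = i
    · subst hj
      simp
    · rw [Function.update_of_ne hj, Function.update_of_ne hj, succAbove_eq_of_ne hj,
        fam_insert_succAbove]
  exact congrArg (opInt r.ν) this

/-- A dummy variable in front has no argument to its left that could absorb a factor, so only the
unit argument is treated here. -/
theorem moi_insert_zero (r : BSRep φ) {H : Fin (n + 2) → 𝓗 →ₗ.[ℂ] 𝓗}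
    (hH : ∀ j, IsSelfAdjoint (H j)) (W : Fin (n + 1) → 𝓗 →L[ℂ] 𝓗) :
    (r.insert (0 : Fin (n + 1)).castSucc).moi H (Function.update W 0 1) =
      r.moi (fun j => H ((0 : Fin (n + 1)).castSucc.succAbove j))
        (fun j => W ((0 : Fin (n + 1)).succAbove j)) := by
  rw [r.moi_insert_castSucc 0 hH W 1]
  simp only [one_mul, Function.update_eq_self]
  rfl

/-- The operator at a dummy variable is 1, so the argument z after it is adjacent to the preceding
argument and merges into it. -/
theorem moi_insert_castSucc_succ (r : BSRep φ)
    (k : Fin n) {H : Fin (n + 2) → 𝓗 →ₗ.[ℂ] 𝓗} (hH : ∀ j, IsSelfAdjoint (H j))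
    (W : Fin (n + 1) → 𝓗 →L[ℂ] 𝓗) (z : 𝓗 →L[ℂ] 𝓗) :
    (r.insert k.succ.castSucc).moi H (Function.update W k.succ z) =
      r.moi (fun j => H (k.succ.castSucc.succAbove j))
        (Function.update (fun j => W (k.succ.succAbove j)) k (W k.castSucc * z)) := by
  rw [r.moi_insert_castSucc k.succ hH W z]
  simp only [chain_move]
  rw [show k.succ.succAbove k = k.castSucc from (castSucc_eq_succ_succAbove k).symm]
  rfl

/-- The sum of two representations. -/
abbrev add (r : BSRep φ) (s : BSRep χ) : BSRep (fun l => φ l + χ l) where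
  Ω := r.Ω ⊕ s.Ω
  ν := r.ν.map Sum.inl + s.ν.map Sum.inr
  finite_ν := by
    have h1 := Measure.isFiniteMeasure_map r.ν (Sum.inl : r.Ω → r.Ω ⊕ s.Ω)
    have h2 := Measure.isFiniteMeasure_map s.ν (Sum.inr : s.Ω → r.Ω ⊕ s.Ω)
    infer_instance
  a := fun j x => Sum.elim (r.a j x) (s.a j x)
  measurable_a := fun j => by
    have h : Function.uncurry (fun x => Sum.elim (r.a j x) (s.a j x)) =
        Sum.elim (Function.uncurry (r.a j)) (Function.uncurry (s.a j)) ∘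
          MeasurableEquiv.prodSumDistrib ℝ r.Ω s.Ω := by
      ext ⟨x, ω | ω⟩ <;> rfl
    rw [h]
    have hm : Measurable (Sum.elim (Function.uncurry (r.a j)) (Function.uncurry (s.a j))) :=
      measurable_fun_sum (r.measurable_a j) (s.measurable_a j)
    exact hm.comp
      (MeasurableEquiv.prodSumDistrib ℝ r.Ω s.Ω).measurable
  bounded_a := by
    obtain ⟨C, hC0, hC⟩ := r.exists_bound
    obtain ⟨D, hD0, hD⟩ := s.exists_bound
    refine ⟨C + D, ?_⟩
    rintro j x (ω | ω)
    · exact (hC j x ω).trans (by linarith)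
    · exact (hD j x ω).trans (by linarith)
  eq_integral := fun l => by
    have hi : ∀ {φ : (Fin (n + 1) → ℝ) → ℂ} (r : BSRep φ),
        Integrable (fun ω => ∏ j, r.a j (l j) ω) r.ν := by
      intro φ r
      obtain ⟨C, hC0, hC⟩ := r.exists_bound
      refine Integrable.of_bound (C := C ^ (n + 1)) ?_ (Eventually.of_forall fun ω => ?_)
      · refine Measurable.aestronglyMeasurable (Finset.measurable_fun_prod _ fun j _ => ?_)
        exact (r.measurable_a j).comp (measurable_const.prodMk measurable_id)
      · rw [norm_prod]
        exact (Finset.prod_le_prod (fun _ _ => norm_nonneg _) fun j _ => hC j _ _).trans (by simp)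
    rw [integral_add_measure, measurableEmbedding_inl.integral_map,
      measurableEmbedding_inr.integral_map, r.eq_integral, s.eq_integral]
    · simp only [Sum.elim_inl, Sum.elim_inr]
    · rw [measurableEmbedding_inl.integrable_map_iff]
      exact hi r
    · rw [measurableEmbedding_inr.integrable_map_iff]
      exact hi s

theorem IsCont.add {r : BSRep φ} {s : BSRep χ} (hr : r.IsCont) (hs : s.IsCont) :
    (r.add s).IsCont := by
  rintro j (ω | ω)
  · exact hr j ω
  · exact hs j ω

/-- The same representation of an equal function. -/
abbrev congr (r : BSRep φ) (h : ∀ l, χ l = φ l) : BSRep χ where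
  Ω := r.Ω
  ν := r.ν
  a := r.a
  measurable_a := r.measurable_a
  bounded_a := r.bounded_a
  eq_integral := fun l => (h l).trans (r.eq_integral l)

variable [TopologicalSpace.SeparableSpace 𝓗]

theorem moi_add (r : BSRep φ) (s : BSRep χ) {H : Fin (n + 1) → 𝓗 →ₗ.[ℂ] 𝓗}
    (hH : ∀ j, IsSelfAdjoint (H j)) (W : Fin n → 𝓗 →L[ℂ] 𝓗) :
    (r.add s).moi H W = r.moi H W + s.moi H W := by
  ext ψ
  rw [add_apply, moi_apply _ hH, moi_apply _ hH, moi_apply _ hH]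
  have hi := ((r.add s).isOpFam_chain hH W).integrable (r.add s).ν ψ
  have hi1 := (r.isOpFam_chain hH W).integrable r.ν ψ
  have hi2 := (s.isOpFam_chain hH W).integrable s.ν ψ
  have e : (r.add s).ν = r.ν.map Sum.inl + s.ν.map Sum.inr := rfl
  rw [e, integral_add_measure, measurableEmbedding_inl.integral_map,
    measurableEmbedding_inr.integral_map]
  · rfl
  · rw [measurableEmbedding_inl.integrable_map_iff]
    exact hi1
  · rw [measurableEmbedding_inr.integrable_map_iff]
    exact hi2

theorem moi_eq_of_eq (r : BSRep φ) (s : BSRep χ) (h : ∀ l, φ l = χ l)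
    {H : Fin (n + 1) → 𝓗 →ₗ.[ℂ] 𝓗} (hH : ∀ j, IsSelfAdjoint (H j)) (W : Fin n → 𝓗 →L[ℂ] 𝓗) :
    r.moi H W = s.moi H W := by
  obtain rfl : φ = χ := funext h
  exact moi_congr r s hH W

end BSRep

/-! ### The generalized multiple operator integral is well defined -/

theorem bddMeas_inv_u_pow (m : ℕ) : BddMeas fun x => (u x)⁻¹ ^ m := by
  induction m with
  | zero => simpa using BddMeas.const 1
  | succ m ih => simpa only [pow_succ] using ih.mul bddMeas_inv_u

theorem funCalc_inv_u_pow {H : 𝓗 →ₗ.[ℂ] 𝓗} (hH : IsSelfAdjoint H) (m : ℕ) :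
    funCalc H (fun x => (u x)⁻¹ ^ m) = resolvent H ^ m := by
  induction m with
  | zero => simpa using funCalc_one hH
  | succ m ih =>
    simp only [pow_succ]
    rw [(isCalculus_funCalc hH).mul _ _ (bddMeas_inv_u_pow m) bddMeas_inv_u, ih, funCalc_inv_u hH]

theorem IsBoundedProduct.eq {V : 𝓗 →ₗ.[ℂ] 𝓗} {R W W' : 𝓗 →L[ℂ] 𝓗} (h : IsBoundedProduct V R W)
    (h' : IsBoundedProduct V R W') : W = W' := by
  ext ψ
  obtain ⟨h1, h2⟩ := apply_eq_of_mem_graph (h ψ)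
  obtain ⟨h3, h4⟩ := apply_eq_of_mem_graph (h' ψ)
  rw [← h2, ← h4]

theorem IsBoundedProduct.mul {V : 𝓗 →ₗ.[ℂ] 𝓗} {R W : 𝓗 →L[ℂ] 𝓗} (h : IsBoundedProduct V R W)
    (S : 𝓗 →L[ℂ] 𝓗) : IsBoundedProduct V (R * S) (W * S) := fun ψ => h (S ψ)

variable [TopologicalSpace.SeparableSpace 𝓗]

/-- Passing to smaller exponents. -/
theorem BSRep.exists_moi_eq {n : ℕ} {φ : (Fin (n + 1) → ℝ) → ℂ} {α γ : Fin n → ℕ}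
    (r : BSRep fun l => φ l * ∏ j : Fin n, u (l j.succ) ^ α j)
    (hγ : ∀ j, γ j ≤ α j) {H : Fin (n + 1) → 𝓗 →ₗ.[ℂ] 𝓗} (hH : ∀ j, IsSelfAdjoint (H j))
    {V : Fin n → 𝓗 →ₗ.[ℂ] 𝓗} {W W' : Fin n → 𝓗 →L[ℂ] 𝓗}
    (hW : ∀ j, IsBoundedProduct (V j) (resolvent (H j.succ) ^ α j) (W j))
    (hW' : ∀ j, IsBoundedProduct (V j) (resolvent (H j.succ) ^ γ j) (W' j)) :
    ∃ s : BSRep fun l => φ l * ∏ j : Fin n, u (l j.succ) ^ γ j, r.moi H W = s.moi H W' := by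
  -- Multiplying the symbol by these bounded functions lowers u^α to u^γ. Moved into the arguments
  -- they turn V R^γ into V R^α, so both integrals agree. Variable 0 carries no weight.
  set g : Fin (n + 1) → ℝ → ℂ := Fin.cons (fun _ => 1) fun j x => (u x)⁻¹ ^ (α j - γ j) with hg
  have hgb : ∀ j, BddMeas (g j) := by
    intro j
    refine Fin.cases ?_ (fun j => ?_) j
    · exact BddMeas.const 1
    · exact bddMeas_inv_u_pow _
  refine ⟨(r.mulAll g hgb).congr fun l => ?_, ?_⟩
  · rw [Fin.prod_univ_succ]
    simp only [hg, Fin.cons_zero, Fin.cons_succ, one_mul]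
    rw [mul_assoc, ← Finset.prod_mul_distrib]
    congr 1
    refine Finset.prod_congr rfl fun j _ => ?_
    rw [← Nat.sub_add_cancel (hγ j), pow_add, Nat.add_sub_cancel, inv_pow, mul_comm (_ ^ _) (_ ^ _),
      mul_assoc, mul_inv_cancel₀ (pow_ne_zero _ (u_ne_zero _)), mul_one]
  · refine Eq.trans ?_ (r.moi_mulAll g hgb rfl hH W').symm
    congr 1
    ext1 j
    have := (hW' j).mul (resolvent (H j.succ) ^ (α j - γ j))
    rw [← pow_add, Nat.add_sub_cancel' (hγ j)] at this
    rw [(hW j).eq this]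
    simp only [hg, Fin.cons_succ, funCalc_inv_u_pow (hH j.succ)]

/-- Both integrals are compared at the exponents min(α_j, β_j), which are admissible because slot by
slot they coincide with one of the two; there `moi_congr` applies. -/
theorem IsGenMOI.unique {n : ℕ} {φ : (Fin (n + 1) → ℝ) → ℂ}
    {H : Fin (n + 1) → 𝓗 →ₗ.[ℂ] 𝓗} (hH : ∀ j, IsSelfAdjoint (H j))
    {V : Fin n → 𝓗 →ₗ.[ℂ] 𝓗} {S T : 𝓗 →L[ℂ] 𝓗} (hS : IsGenMOI H φ V S) (hT : IsGenMOI H φ V T) :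
    S = T := by
  obtain ⟨α, W, hW, r, hr⟩ := hS
  obtain ⟨β, X, hX, s, hs⟩ := hT
  have h1 : S = r.moi H W := by
    ext ψ
    rw [hr, r.moi_apply hH, r.moiVec_eq]
  have h2 : T = s.moi H X := by
    ext ψ
    rw [hs, s.moi_apply hH, s.moiVec_eq]
  set Y : Fin n → 𝓗 →L[ℂ] 𝓗 := fun j => if α j ≤ β j then W j else X j with hYdef
  have hY : ∀ j, IsBoundedProduct (V j) (resolvent (H j.succ) ^ (min (α j) (β j))) (Y j) := by
    intro j
    simp only [hYdef]
    split_ifs with h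
    · rw [min_eq_left h]
      exact hW j
    · rw [min_eq_right (not_le.mp h).le]
      exact hX j
  obtain ⟨r', hr'⟩ := r.exists_moi_eq (γ := fun j => min (α j) (β j))
    (fun j => min_le_left _ _) hH hW hY
  obtain ⟨s', hs'⟩ := s.exists_moi_eq (γ := fun j => min (α j) (β j))
    (fun j => min_le_right _ _) hH hX hY
  rw [h1, h2, hr', hs', BSRep.moi_congr r' s' hH]

theorem IsGenMOI.genMOI_eq {n : ℕ} {φ : (Fin (n + 1) → ℝ) → ℂ}
    {H : Fin (n + 1) → 𝓗 →ₗ.[ℂ] 𝓗} (hH : ∀ j, IsSelfAdjoint (H j))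
    {V : Fin n → 𝓗 →ₗ.[ℂ] 𝓗} {T : 𝓗 →L[ℂ] 𝓗} (hT : IsGenMOI H φ V T) : genMOI H φ V = T := by
  have h : ∃ T, IsGenMOI H φ V T := ⟨T, hT⟩
  rw [genMOI, dif_pos h]
  exact h.choose_spec.unique hH hT

end RelMOI
end

noncomputable section
namespace RelMOI

/-! ### Divided differences -/

/-- The Lagrange form of the divided difference at distinct points. -/
def lagrangeDiff (n : ℕ) (g : ℝ → ℂ) (l : Fin (n + 1) → ℝ) : ℂ :=
  ∑ j, g (l j) * ∏ k, if k = j then 1 else ((l j - l k : ℝ) : ℂ)⁻¹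

theorem lagrangeDiff_zero (g : ℝ → ℂ) (l : Fin 1 → ℝ) : lagrangeDiff 0 g l = g (l 0) := by
  simp [lagrangeDiff]

/-- Write u(l_j) = u(l_i) + (l_j - l_i). The second summand cancels one factor of the j-th Lagrange
weight and so deletes the node i. As the choice of i is free, equating two choices gives the divided
difference recursion. -/
theorem lagrangeDiff_mul_u {n : ℕ} (g : ℝ → ℂ) {l : Fin (n + 2) → ℝ} (hl : Function.Injective l)
    (i : Fin (n + 2)) :
    lagrangeDiff (n + 1) (fun x => g x * u x) l =
      u (l i) * lagrangeDiff (n + 1) g l + lagrangeDiff n g (fun j => l (i.succAbove j)) := by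
  rw [← sub_eq_iff_eq_add']
  simp only [lagrangeDiff, Finset.mul_sum]
  rw [← Finset.sum_sub_distrib, Fin.sum_univ_succAbove _ i]
  rw [show ∀ a b : ℂ, g (l i) * u (l i) * a - u (l i) * (g (l i) * a) + b = b by intro a b; ring]
  refine Finset.sum_congr rfl fun j _ => ?_
  rw [Fin.prod_univ_succAbove _ i]
  simp only [if_neg (Fin.succAbove_ne i j).symm, Fin.succAbove_right_inj]
  have h : ((l (i.succAbove j) - l i : ℝ) : ℂ) ≠ 0 := by
    rw [Complex.ofReal_ne_zero, sub_ne_zero]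
    exact fun h => Fin.succAbove_ne i j (hl h)
  have hu : u (l (i.succAbove j)) = u (l i) + ((l (i.succAbove j) - l i : ℝ) : ℂ) := by
    simp only [u]
    push_cast
    ring
  rw [hu]
  field_simp
  ring

theorem lagrangeDiff_sub {n : ℕ} (g : ℝ → ℂ) {l : Fin (n + 2) → ℝ} (hl : Function.Injective l)
    (i j : Fin (n + 2)) :
    ((l i - l j : ℝ) : ℂ) * lagrangeDiff (n + 1) g l =
      lagrangeDiff n g (fun k => l (j.succAbove k)) -
        lagrangeDiff n g (fun k => l (i.succAbove k)) := by
  have h1 := lagrangeDiff_mul_u g hl i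
  have h2 := lagrangeDiff_mul_u g hl j
  rw [h1] at h2
  simp only [u] at h2
  push_cast
  linear_combination h2

theorem lagrangeDiff_one (n : ℕ) {l : Fin (n + 2) → ℝ} (hl : Function.Injective l) :
    lagrangeDiff (n + 1) (fun _ => 1) l = 0 := by
  have h01 : ((l 0 - l 1 : ℝ) : ℂ) ≠ 0 := by
    rw [Complex.ofReal_ne_zero, sub_ne_zero]
    exact fun h => absurd (hl h) Fin.zero_ne_one
  refine (mul_eq_zero.mp ?_).resolve_left h01
  rw [lagrangeDiff_sub _ hl]
  cases n with
  | zero => simp [lagrangeDiff_zero]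
  | succ n =>
    have h : ∀ i : Fin (n + 3),
        lagrangeDiff (n + 1) (fun _ => 1) (fun k => l (i.succAbove k)) = 0 := fun i =>
      lagrangeDiff_one n (hl.comp Fin.succAbove_right_injective)
    rw [h, h, sub_zero]

/-- Subtracting the constant f(l₀) changes nothing, since constants have zero divided difference,
and removes node 0. At the other nodes the difference quotient h absorbs one Lagrange factor. -/
theorem lagrangeDiff_succ {n : ℕ} (f h : ℝ → ℂ) {l : Fin (n + 2) → ℝ} (hl : Function.Injective l)
    (hh : ∀ j : Fin (n + 1), f (l j.succ) - f (l 0) = ((l j.succ - l 0 : ℝ) : ℂ) * h (l j.succ)) :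
    lagrangeDiff (n + 1) f l = lagrangeDiff n h (fun j => l j.succ) := by
  have h1 : lagrangeDiff (n + 1) f l =
      lagrangeDiff (n + 1) f l - f (l 0) * lagrangeDiff (n + 1) (fun _ => 1) l := by
    rw [lagrangeDiff_one n hl, mul_zero, sub_zero]
  rw [h1]
  simp only [lagrangeDiff, Finset.mul_sum]
  rw [← Finset.sum_sub_distrib, Fin.sum_univ_succ]
  rw [show ∀ a b : ℂ, f (l 0) * a - f (l 0) * (1 * a) + b = b by intro a b; ring]
  refine Finset.sum_congr rfl fun j _ => ?_
  rw [Fin.prod_univ_succ]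
  simp only [if_neg (Fin.succ_ne_zero j).symm, Fin.succ_inj]
  have h0 : ((l j.succ - l 0 : ℝ) : ℂ) ≠ 0 := by
    rw [Complex.ofReal_ne_zero, sub_ne_zero]
    exact fun h => Fin.succ_ne_zero j (hl h)
  rw [one_mul, ← sub_mul, hh j]
  field_simp

/-- Weighted averages representing divided differences by derivatives (Hermite–Genocchi). -/
structure HermiteGenocchi (n : ℕ) where
  Ω : Type
  [mΩ : MeasurableSpace Ω]
  ν : Measure Ω
  [finite_ν : IsFiniteMeasure ν]
  w : Ω → ℝ
  c : Fin (n + 1) → Ω → ℝ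
  measurable_w : Measurable w
  measurable_c : ∀ j, Measurable (c j)
  abs_w : ∀ ω, |w ω| ≤ 1
  abs_c : ∀ j ω, |c j ω| ≤ 1
  repr : ∀ f : ℝ → ℂ, ContDiff ℝ n f → ∀ l : Fin (n + 1) → ℝ, Function.Injective l →
    lagrangeDiff n f l = ∫ ω, (w ω : ℂ) * iteratedDeriv n f (∑ j, c j ω * l j) ∂ν

attribute [instance] HermiteGenocchi.mΩ HermiteGenocchi.finite_ν

namespace HermiteGenocchi

theorem abs_sum_le {n : ℕ} (d : HermiteGenocchi n) (l : Fin (n + 1) → ℝ) (ω : d.Ω) :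
    |∑ j, d.c j ω * l j| ≤ ∑ j, |l j| := by
  refine (Finset.abs_sum_le_sum_abs _ _).trans (Finset.sum_le_sum fun j _ => ?_)
  rw [abs_mul]
  exact mul_le_of_le_one_left (abs_nonneg _) (d.abs_c j ω)

theorem measurable_sum {n : ℕ} (d : HermiteGenocchi n) (l : Fin (n + 1) → ℝ) :
    Measurable fun ω => ∑ j, d.c j ω * l j :=
  Finset.measurable_fun_sum _ fun j _ => (d.measurable_c j).mul_const _

theorem exists_bound_of_continuous {g : ℝ → ℂ} (hg : Continuous g) (M : ℝ) :
    ∃ C : ℝ, ∀ x, |x| ≤ M → ‖g x‖ ≤ C := by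
  obtain ⟨C, hC⟩ := (isCompact_Icc (a := -M) (b := M)).exists_bound_of_continuousOn hg.continuousOn
  exact ⟨C, fun x hx => hC x (abs_le.mp hx)⟩

theorem integral_deriv_segment {f : ℝ → ℂ} (hf : ContDiff ℝ 1 f) (x z : ℝ) :
    f x - f z = ((x - z : ℝ) : ℂ) *
      ∫ s : unitInterval, deriv f ((s : ℝ) * x + (1 - (s : ℝ)) * z) := by
  have h1 : ∫ s : unitInterval, deriv f ((s : ℝ) * x + (1 - (s : ℝ)) * z) =
      ∫ s in (0 : ℝ)..1, deriv f (s * x + (1 - s) * z) := by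
    rw [intervalIntegral.integral_of_le zero_le_one, ← integral_Icc_eq_integral_Ioc]
    exact integral_subtype_comap measurableSet_Icc
      (fun s : ℝ => deriv f (s * x + (1 - s) * z))
  have hd : ∀ s : ℝ, HasDerivAt (fun s : ℝ => f (s * x + (1 - s) * z))
      (((x - z : ℝ) : ℂ) * deriv f (s * x + (1 - s) * z)) s := by
    intro s
    have h2 : HasDerivAt (fun s : ℝ => s * x + (1 - s) * z) (x - z) s :=
      (((hasDerivAt_id' s).mul_const x).fun_add
        (((hasDerivAt_id' s).const_sub 1).mul_const z)).congr_deriv (by ring)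
    have h3 := ((hf.differentiable one_ne_zero) (s * x + (1 - s) * z)).hasDerivAt.scomp s h2
    simpa [Function.comp_def] using h3
  have hc : Continuous fun s : ℝ => ((x - z : ℝ) : ℂ) * deriv f (s * x + (1 - s) * z) :=
    continuous_const.mul ((hf.continuous_deriv le_rfl).comp (by fun_prop))
  have h4 := intervalIntegral.integral_eq_sub_of_hasDerivAt (a := 0) (b := 1)
    (fun s _ => hd s) (hc.intervalIntegrable _ _)
  rw [intervalIntegral.integral_const_mul] at h4
  rw [h1, h4]
  simp

theorem iteratedDeriv_deriv_affine {n : ℕ} {f : ℝ → ℂ} (hf : ContDiff ℝ (n + 1) f) (s b y : ℝ) :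
    iteratedDeriv n (fun x => deriv f (s * x + b)) y =
      (s : ℂ) ^ n * iteratedDeriv (n + 1) f (s * y + b) := by
  have hd : ContDiff ℝ n (deriv f) := hf.deriv'
  have h1 := iteratedDeriv_comp_const_smul (n := n) (f := fun x : ℝ => deriv f (x + b))
    (hd.comp (contDiff_id.add contDiff_const)) s
  refine (congrFun h1 y).trans ?_
  simp [iteratedDeriv_comp_add_const, iteratedDeriv_succ']

/-- The quotient (f(x) - f(l₀))/(x - l₀) is the average of f'(sx + (1 - s)l₀) over s in [0, 1]. Its
n-th derivative brings out sⁿ; this explains the weight sⁿw and the coefficients 1 - s and s c_j in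
the inductive step. -/
theorem nonempty (n : ℕ) : Nonempty (HermiteGenocchi n) := by
  induction n with
  | zero =>
    refine ⟨⟨Unit, Measure.dirac (), fun _ => 1, fun _ _ => 1, measurable_const,
      fun _ => measurable_const, fun _ => by simp, fun _ _ => by simp, fun f _ l _ => ?_⟩⟩
    simp [lagrangeDiff_zero]
  | succ n ih =>
    obtain ⟨d⟩ := ih
    have hmc : ∀ j, Measurable ((Fin.cons (fun p => 1 - (p.1 : ℝ))
        fun j p => (p.1 : ℝ) * d.c j p.2 : Fin (n + 2) → unitInterval × d.Ω → ℝ) j) := by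
      intro j
      have h0 : Measurable fun p : unitInterval × d.Ω => (p.1 : ℝ) :=
        measurable_subtype_coe.comp measurable_fst
      refine Fin.cases ?_ (fun j => ?_) j
      · exact measurable_const.sub h0
      · exact h0.mul ((d.measurable_c j).comp measurable_snd)
    refine ⟨⟨unitInterval × d.Ω, volume.prod d.ν, fun p => (p.1 : ℝ) ^ n * d.w p.2,
      Fin.cons (fun p => 1 - (p.1 : ℝ)) fun j p => (p.1 : ℝ) * d.c j p.2,
      ((measurable_subtype_coe.comp measurable_fst).pow_const n).mul
        (d.measurable_w.comp measurable_snd), hmc, fun p => ?_, fun j p => ?_,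
      fun f hf l hl => ?_⟩⟩
    · rw [abs_mul, abs_pow, abs_of_nonneg p.1.2.1]
      exact mul_le_one₀ (pow_le_one₀ p.1.2.1 p.1.2.2) (abs_nonneg _) (d.abs_w _)
    · refine Fin.cases ?_ (fun j => ?_) j
      · simp only [Fin.cons_zero]
        rw [abs_of_nonneg (by linarith [p.1.2.2])]
        linarith [p.1.2.1]
      · simp only [Fin.cons_succ, abs_mul, abs_of_nonneg p.1.2.1]
        exact mul_le_one₀ p.1.2.2 (abs_nonneg _) (d.abs_c j _)
    · have hf1 : ContDiff ℝ 1 f := hf.of_le (by exact_mod_cast Nat.le_add_left 1 n)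
      have hdc : Continuous (deriv f) := hf1.continuous_deriv le_rfl
      have hl' : Function.Injective fun j : Fin (n + 1) => l j.succ :=
        hl.comp (Fin.succ_injective _)
      rw [lagrangeDiff_succ f (fun x => ∫ s : unitInterval,
        deriv f ((s : ℝ) * x + (1 - (s : ℝ)) * l 0)) hl
        fun j => integral_deriv_segment hf1 _ _]
      have hintg : ∀ x : ℝ, Integrable (fun s : unitInterval =>
          deriv f ((s : ℝ) * x + (1 - (s : ℝ)) * l 0)) := by
        intro x
        exact Continuous.integrable_of_hasCompactSupport (by fun_prop)
          (HasCompactSupport.of_compactSpace _)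
      have hswap : lagrangeDiff n (fun x => ∫ s : unitInterval,
          deriv f ((s : ℝ) * x + (1 - (s : ℝ)) * l 0)) (fun j => l j.succ) =
          ∫ s : unitInterval, lagrangeDiff n (fun x =>
            deriv f ((s : ℝ) * x + (1 - (s : ℝ)) * l 0)) (fun j => l j.succ) := by
        simp only [lagrangeDiff]
        rw [integral_finsetSum _ fun j _ => (hintg _).mul_const _]
        refine Finset.sum_congr rfl fun j _ => ?_
        rw [integral_mul_const]
      rw [hswap, integral_prod]
      · refine integral_congr_ae (Eventually.of_forall fun s => ?_)
        have hcd : ContDiff ℝ n fun x => deriv f ((s : ℝ) * x + (1 - (s : ℝ)) * l 0) :=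
          ContDiff.comp (g := deriv f) hf.deriv'
            ((contDiff_const.mul contDiff_id).add contDiff_const)
        simp only
        rw [d.repr _ hcd _ hl']
        refine integral_congr_ae (Eventually.of_forall fun ω => ?_)
        beta_reduce
        rw [iteratedDeriv_deriv_affine hf, Fin.sum_univ_succ (n := n + 1)]
        change _ = (((s : ℝ) ^ n * d.w ω : ℝ) : ℂ) * iteratedDeriv (n + 1) f
          ((1 - (s : ℝ)) * l 0 + ∑ j : Fin (n + 1), ((s : ℝ) * d.c j ω) * l j.succ)
        rw [Finset.mul_sum, add_comm ((1 - (s : ℝ)) * l 0)]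
        simp only [← mul_assoc]
        push_cast
        ring
      · obtain ⟨C, hC⟩ := exists_bound_of_continuous
          (hf.continuous_iteratedDeriv (n + 1) le_rfl) (∑ j, |l j|)
        refine Integrable.of_bound (C := C) ?_ (Eventually.of_forall fun p => ?_)
        · refine Measurable.aestronglyMeasurable ?_
          refine Measurable.mul ?_ ?_
          · refine Complex.measurable_ofReal.comp ?_
            exact ((measurable_subtype_coe.comp measurable_fst).pow_const n).mul
              (d.measurable_w.comp measurable_snd)
          · exact (hf.continuous_iteratedDeriv (n + 1) le_rfl).measurable.comp
              (Finset.measurable_fun_sum _ fun j _ => (hmc j).mul_const _)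
        · have hw : ‖(((p.1 : ℝ) ^ n * d.w p.2 : ℝ) : ℂ)‖ ≤ 1 := by
            rw [Complex.norm_real, Real.norm_eq_abs, abs_mul, abs_pow, abs_of_nonneg p.1.2.1]
            exact mul_le_one₀ (pow_le_one₀ p.1.2.1 p.1.2.2) (abs_nonneg _) (d.abs_w _)
          rw [norm_mul]
          refine (mul_le_of_le_one_left (norm_nonneg _) hw).trans (hC _ ?_)
          refine (Finset.abs_sum_le_sum_abs _ _).trans (Finset.sum_le_sum fun j _ => ?_)
          rw [abs_mul]
          refine mul_le_of_le_one_left (abs_nonneg _) ?_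
          refine Fin.cases ?_ (fun j => ?_) j
          · simp only [Fin.cons_zero]
            rw [abs_of_nonneg (by linarith [p.1.2.2])]
            linarith [p.1.2.1]
          · simp only [Fin.cons_succ, abs_mul, abs_of_nonneg p.1.2.1]
            exact mul_le_one₀ p.1.2.2 (abs_nonneg _) (d.abs_c j _)

end HermiteGenocchi

/-- A choice of averages for each order. -/
def hermiteGenocchi (n : ℕ) : HermiteGenocchi n := Classical.choice (HermiteGenocchi.nonempty n)

/-- The divided difference as an average of the derivative. -/
def avgDiff (n : ℕ) (f : ℝ → ℂ) (l : Fin (n + 1) → ℝ) : ℂ :=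
  ∫ ω, ((hermiteGenocchi n).w ω : ℂ) *
    iteratedDeriv n f (∑ j, (hermiteGenocchi n).c j ω * l j) ∂(hermiteGenocchi n).ν

theorem avgDiff_eq {n : ℕ} {f : ℝ → ℂ} (hf : ContDiff ℝ n f) {l : Fin (n + 1) → ℝ}
    (hl : Function.Injective l) : avgDiff n f l = lagrangeDiff n f l :=
  ((hermiteGenocchi n).repr f hf l hl).symm

theorem continuous_avgDiff {n : ℕ} {f : ℝ → ℂ} (hf : ContDiff ℝ n f) :
    Continuous (avgDiff n f) := by
  set d := hermiteGenocchi n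
  have hc := hf.continuous_iteratedDeriv n le_rfl
  refine continuous_iff_continuousAt.mpr fun l => ?_
  obtain ⟨C, hC⟩ := HermiteGenocchi.exists_bound_of_continuous hc (∑ j, |l j| + 1)
  have hev : ∀ᶠ m : Fin (n + 1) → ℝ in 𝓝 l, ∑ j, |m j| < ∑ j, |l j| + 1 :=
    (by fun_prop : Continuous fun m : Fin (n + 1) → ℝ => ∑ j, |m j|).continuousAt.eventually_lt
      continuousAt_const (by linarith)
  refine continuousAt_of_dominated (bound := fun _ => C) (Eventually.of_forall fun m => ?_) ?_
    (integrable_const _) (Eventually.of_forall fun ω => ?_)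
  · exact ((Complex.measurable_ofReal.comp d.measurable_w).mul
      (hc.measurable.comp (d.measurable_sum m))).aestronglyMeasurable
  · filter_upwards [hev] with m hm
    refine Eventually.of_forall fun ω => ?_
    rw [norm_mul, Complex.norm_real, Real.norm_eq_abs]
    exact (mul_le_of_le_one_left (norm_nonneg _) (d.abs_w ω)).trans
      (hC _ ((d.abs_sum_le m ω).trans hm.le))
  · refine Continuous.continuousAt ?_
    exact continuous_const.mul (hc.comp (by fun_prop))

/-- Along l_j + εj two given coordinates collide for at most one ε, so all but finitely many ε give
distinct coordinates, and ε can tend to 0. -/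
theorem dense_injective (n : ℕ) : Dense {l : Fin (n + 1) → ℝ | Function.Injective l} := by
  intro l
  set γ : ℝ → Fin (n + 1) → ℝ := fun ε j => l j + ε * (j : ℝ) with hγ
  have hγc : Continuous γ := by fun_prop
  have hbad : {ε : ℝ | ¬ Function.Injective (γ ε)}.Finite := by
    refine Set.Finite.subset (Set.finite_range fun p : Fin (n + 1) × Fin (n + 1) =>
      (l p.2 - l p.1) / ((p.1 : ℝ) - (p.2 : ℝ))) ?_
    intro ε hε
    simp only [Set.mem_ofPred_eq, Function.Injective, not_forall] at hε
    obtain ⟨i, j, hij, hne⟩ := hε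
    refine ⟨(i, j), ?_⟩
    have h0 : ((i : ℕ) : ℝ) - ((j : ℕ) : ℝ) ≠ 0 := by
      rw [sub_ne_zero]
      exact fun h => hne (Fin.ext (by exact_mod_cast h))
    simp only [hγ] at hij
    rw [div_eq_iff h0]
    linarith
  have hd := hbad.countable.dense_compl ℝ
  have h0 : (0 : ℝ) ∈ closure {ε : ℝ | ¬ Function.Injective (γ ε)}ᶜ := hd 0
  have h1 := image_closure_subset_closure_image hγc (Set.mem_image_of_mem γ h0)
  have h2 : γ 0 = l := by
    ext j
    simp [hγ]
  rw [h2] at h1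
  refine closure_mono ?_ h1
  rintro _ ⟨ε, hε, rfl⟩
  simpa using hε

theorem avgDiff_zero (f : ℝ → ℂ) (hf : Continuous f) (l : Fin 1 → ℝ) : avgDiff 0 f l = f (l 0) := by
  rw [avgDiff_eq (contDiff_zero.mpr hf) (Function.injective_of_subsingleton l), lagrangeDiff_zero]

theorem contDiff_u {n : WithTop ℕ∞} : ContDiff ℝ n u :=
  Complex.ofRealCLM.contDiff.sub contDiff_const

/-- Continuity of both sides extends the Lagrange identity from the dense set of distinct nodes to
all nodes. -/
theorem avgDiff_mul_u {n : ℕ} {g : ℝ → ℂ} (hg : ContDiff ℝ (n + 1) g) (l : Fin (n + 2) → ℝ)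
    (i : Fin (n + 2)) :
    avgDiff (n + 1) (fun x => g x * u x) l =
      u (l i) * avgDiff (n + 1) g l + avgDiff n g (fun j => l (i.succAbove j)) := by
  have hgu : ContDiff ℝ (n + 1) fun x => g x * u x := hg.mul contDiff_u
  have hgn : ContDiff ℝ n g := hg.of_le (by exact_mod_cast Nat.le_succ n)
  refine congrFun (Continuous.ext_on (dense_injective (n + 1)) (continuous_avgDiff hgu)
    (g := fun l => u (l i) * avgDiff (n + 1) g l + avgDiff n g (fun j => l (i.succAbove j)))
    ?_ ?_) l
  · exact ((continuous_u.comp (continuous_apply i)).mul (continuous_avgDiff hg)).add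
      ((continuous_avgDiff hgn).comp (by fun_prop))
  · intro l hl
    have hl' : Function.Injective fun j => l (i.succAbove j) :=
      Function.Injective.comp hl Fin.succAbove_right_injective
    simp only
    rw [avgDiff_eq hgu hl, avgDiff_eq hg hl, avgDiff_eq hgn hl', lagrangeDiff_mul_u g hl i]

theorem avgDiff_sub {n : ℕ} {g : ℝ → ℂ} (hg : ContDiff ℝ (n + 1) g) (l : Fin (n + 2) → ℝ)
    (i j : Fin (n + 2)) :
    ((l i - l j : ℝ) : ℂ) * avgDiff (n + 1) g l =
      avgDiff n g (fun k => l (j.succAbove k)) - avgDiff n g (fun k => l (i.succAbove k)) := by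
  have h1 := avgDiff_mul_u hg l i
  have h2 := avgDiff_mul_u hg l j
  rw [h1] at h2
  simp only [u] at h2
  push_cast
  linear_combination h2

/-- Divided differences as averages of derivatives. -/
theorem divDiff_eq_avgDiff {n : ℕ} {f : ℝ → ℂ} (hf : ContDiff ℝ n f) :
    divDiff f n = avgDiff n f := by
  induction n with
  | zero =>
    ext l
    rw [avgDiff_zero f hf.continuous, divDiff]
  | succ n ih =>
    have hfn : ContDiff ℝ n f := hf.of_le (by exact_mod_cast Nat.le_succ n)
    have hq : ∀ m : Fin (n + 2) → ℝ, m 0 ≠ m (Fin.last (n + 1)) →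
        (divDiff f n (Fin.init m) - divDiff f n (Fin.tail m)) /
          ((m 0 - m (Fin.last (n + 1)) : ℝ) : ℂ) = avgDiff (n + 1) f m := by
      intro m hm
      have hm' : ((m 0 - m (Fin.last (n + 1)) : ℝ) : ℂ) ≠ 0 := by
        rw [Complex.ofReal_ne_zero, sub_ne_zero]
        exact hm
      rw [ih hfn, div_eq_iff hm', mul_comm, avgDiff_sub hf]
      congr 2
      ext k
      simp [Fin.init]
    ext l
    rw [divDiff]
    simp only
    split_ifs with h
    · exact hq l h
    -- Off the hyperplane the quotient is the globally continuous `avgDiff`, so its limit is the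
    -- value of that function. The filter must be nontrivial for the limit to be determined.
    · have hne : (𝓝[{m : Fin (n + 2) → ℝ | m 0 ≠ m (Fin.last (n + 1))}] l).NeBot := by
        rw [← mem_closure_iff_nhdsWithin_neBot]
        refine closure_mono ?_ (dense_injective (n + 1) l)
        intro m hm h
        exact absurd (hm h) (by simp [Fin.ext_iff])
      refine Tendsto.limUnder_eq ?_
      refine (((continuous_avgDiff hf).tendsto l).mono_left nhdsWithin_le_nhds).congr' ?_
      filter_upwards [self_mem_nhdsWithin] with m hm
      exact (hq m hm).symm

end RelMOI
end

noncomputable section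
namespace RelMOI

/-! ### Fourier transforms of complex measures -/

section ComplexMeasureIntegral

variable {X : Type*} [MeasurableSpace X]

theorem isFiniteMeasure_variation_signed (σ : SignedMeasure X) : IsFiniteMeasure σ.variation := by
  rw [← SignedMeasure.totalVariation_eq_variation, SignedMeasure.totalVariation]
  infer_instance

theorem isFiniteMeasure_variation_complex (μ : ComplexMeasure X) :
    IsFiniteMeasure μ.variation := by
  have h1 := isFiniteMeasure_variation_signed (ComplexMeasure.re μ)
  have h2 := isFiniteMeasure_variation_signed (ComplexMeasure.im μ)
  refine isFiniteMeasure_of_le ((ComplexMeasure.re μ).variation + (ComplexMeasure.im μ).variation)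
    (VectorMeasure.variation_le_of_forall_enorm_le fun s _ => ?_)
  refine le_trans ?_ (add_le_add (VectorMeasure.enorm_measure_le_variation (ComplexMeasure.re μ) s)
    (VectorMeasure.enorm_measure_le_variation (ComplexMeasure.im μ) s))
  have h : ‖μ s‖ ≤ ‖ComplexMeasure.re μ s‖ + ‖ComplexMeasure.im μ s‖ :=
    Complex.norm_le_abs_re_add_abs_im (μ s)
  rw [← ofReal_norm, ← ofReal_norm, ← ofReal_norm,
    ← ENNReal.ofReal_add (norm_nonneg _) (norm_nonneg _)]
  exact ENNReal.ofReal_le_ofReal h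

theorem isSigma_complexMeasure (μ : ComplexMeasure X) :
    IsSigma fun g : X → ℂ => VectorMeasure.integral μ g (ContinuousLinearMap.mul ℝ ℂ) := by
  have hfin := isFiniteMeasure_variation_complex μ
  refine ⟨fun g h hg hh => ?_, fun c g hg => ?_, fun g h C hm hC hl => ?_⟩
  · exact VectorMeasure.integral_fun_add (hg.integrable _) (hh.integrable _)
  · simp only [VectorMeasure.integral_eq_setToFun]
    have := setToFun_smul (E := ℂ) (𝕜 := ℂ) (dominatedFinMeasAdditive_cbmApplyMeasure μ
      (ContinuousLinearMap.mul ℝ ℂ)) (fun c s x => ?_) c g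
    · exact this
    · rw [transpose_eq_cbmApplyMeasure]
      simp [mul_assoc]
  · exact VectorMeasure.tendsto_integral_of_dominated_convergence (fun _ => C)
      (fun n => (hm n).aestronglyMeasurable) (integrable_const _)
      (fun n => Eventually.of_forall (hC n)) (Eventually.of_forall hl)

theorem integral_indicator_complexMeasure (μ : ComplexMeasure X) {s : Set X}
    (hs : MeasurableSet s) :
    VectorMeasure.integral μ (s.indicator fun _ => (1 : ℂ)) (ContinuousLinearMap.mul ℝ ℂ) =
      μ s := by
  have hfin := isFiniteMeasure_variation_complex μ
  rw [VectorMeasure.integral_eq_setToFun, setToFun_indicator_const _ hs (measure_ne_top _ _),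
    transpose_eq_cbmApplyMeasure]
  simp

/-- The integral with respect to a complex measure in terms of positive measures. -/
theorem exists_integral_complexMeasure (μ : ComplexMeasure X) :
    ∃ m : Fin 4 → Measure X, (∀ k, IsFiniteMeasure (m k)) ∧ ∀ g : X → ℂ, BddMeas g →
      VectorMeasure.integral μ g (ContinuousLinearMap.mul ℝ ℂ) =
        ∑ k, polarPhase k * ∫ x, g x ∂(m k) := by
  set p := (ComplexMeasure.re μ).toJordanDecomposition
  set q := (ComplexMeasure.im μ).toJordanDecomposition
  have hp1 := p.posPart_finite
  have hp2 := p.negPart_finite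
  have hq1 := q.posPart_finite
  have hq2 := q.negPart_finite
  -- The order matches the entries 1, -1, i, -i of `polarPhase`.
  set m : Fin 4 → Measure X := ![p.posPart, p.negPart, q.posPart, q.negPart] with hm
  have hfin : ∀ k, IsFiniteMeasure (m k) := by
    intro k
    fin_cases k <;> assumption
  refine ⟨m, hfin, fun g hg => ?_⟩
  have hL : IsSigma fun g : X → ℂ => VectorMeasure.integral μ g (ContinuousLinearMap.mul ℝ ℂ) -
      ∑ k, polarPhase k * ∫ x, g x ∂(m k) := by
    refine (isSigma_complexMeasure μ).sum_sub ?_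
    simp only [Fin.sum_univ_four]
    exact ((((IsSigma.of_integral _).const_mul _).sum_add
      ((IsSigma.of_integral _).const_mul _)).sum_add ((IsSigma.of_integral _).const_mul _)).sum_add
        ((IsSigma.of_integral _).const_mul _)
  refine sub_eq_zero.mp (hL.eq_zero_of_indicator (fun s hs => ?_) hg)
  rw [integral_indicator_complexMeasure μ hs, sub_eq_zero]
  have hre := (ComplexMeasure.re μ).apply_eq_posPart_real_sub_negPart_real hs
  have him := (ComplexMeasure.im μ).apply_eq_posPart_real_sub_negPart_real hs
  have hintg : ∀ k, ∫ x, s.indicator (fun _ => (1 : ℂ)) x ∂(m k) = ((m k).real s : ℂ) := by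
    intro k
    rw [integral_indicator hs]
    simp
  simp only [hintg, Fin.sum_univ_four]
  have hs1 : μ s = ((ComplexMeasure.re μ s : ℝ) : ℂ) + ((ComplexMeasure.im μ s : ℝ) : ℂ) *
      Complex.I := (Complex.re_add_im (μ s)).symm
  rw [hs1, hre, him]
  simp only [hm, polarPhase, Matrix.cons_val_zero, Matrix.cons_val_one, Matrix.cons_val]
  push_cast
  ring

end ComplexMeasureIntegral

/-! ### Representations of divided differences -/

theorem bddMeas_exp (x : ℝ) : BddMeas fun y : ℝ => Complex.exp (Complex.I * x * y) := by
  refine ⟨(by fun_prop : Continuous fun y : ℝ => Complex.exp (Complex.I * x * y)).measurable, 1,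
    fun y => ?_⟩
  beta_reduce
  rw [show Complex.I * x * y = ((x * y : ℝ) : ℂ) * Complex.I by push_cast; ring]
  exact (Complex.norm_exp_ofReal_mul_I _).le

/-- The representation belonging to the Fourier transform of a positive measure. -/
def fourierRep {n : ℕ} (d : HermiteGenocchi n) (m : Measure ℝ) [IsFiniteMeasure m] :
    BSRep fun l : Fin (n + 1) → ℝ => ∫ ω, (d.w ω : ℂ) *
      ∫ y, Complex.exp (Complex.I * ((∑ j, d.c j ω * l j : ℝ) : ℂ) * y) ∂m ∂d.ν where
  Ω := d.Ω × ℝ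
  ν := d.ν.prod m
  -- The exponential of iy Σ c_j λ_j factors over the variables. The weight must occur exactly once,
  -- and variable 0 carries it.
  a := fun j x p => Complex.exp (((d.c j p.1 * x * p.2 : ℝ) : ℂ) * Complex.I) *
    if j = 0 then (d.w p.1 : ℂ) else 1
  measurable_a := fun j => by
    refine Measurable.mul ?_ ?_
    · refine Complex.measurable_exp.comp ((Complex.measurable_ofReal.comp ?_).mul_const _)
      exact (((d.measurable_c j).comp (measurable_fst.comp measurable_snd)).mul
        measurable_fst).mul (measurable_snd.comp measurable_snd)
    · split_ifs
      · exact Complex.measurable_ofReal.comp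
          (d.measurable_w.comp (measurable_fst.comp measurable_snd))
      · exact measurable_const
  bounded_a := by
    refine ⟨1, fun j x p => ?_⟩
    rw [norm_mul, Complex.norm_exp_ofReal_mul_I, one_mul]
    split_ifs
    · rw [Complex.norm_real]
      exact d.abs_w p.1
    · simp
  eq_integral := fun l => by
    have hprod : ∀ p : d.Ω × ℝ, ∏ j, (Complex.exp (((d.c j p.1 * l j * p.2 : ℝ) : ℂ) * Complex.I) *
        if j = 0 then (d.w p.1 : ℂ) else 1) = (d.w p.1 : ℂ) *
          Complex.exp (Complex.I * ((∑ j, d.c j p.1 * l j : ℝ) : ℂ) * p.2) := by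
      intro p
      rw [Finset.prod_mul_distrib, ← Complex.exp_sum, mul_comm]
      congr 1
      · simp
      · rw [← Finset.sum_mul]
        congr 1
        push_cast
        rw [← Finset.sum_mul]
        ring
    simp only [hprod]
    rw [integral_prod]
    · simp only [integral_const_mul]
    · refine Integrable.of_bound (C := 1) ?_ (Eventually.of_forall fun p => ?_)
      · refine Measurable.aestronglyMeasurable (Measurable.mul ?_ ?_)
        · exact Complex.measurable_ofReal.comp (d.measurable_w.comp measurable_fst)
        · refine Complex.measurable_exp.comp (((Complex.measurable_ofReal.comp
            ((d.measurable_sum l).comp measurable_fst)).const_mul _).mul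
              (Complex.measurable_ofReal.comp measurable_snd))
      · rw [norm_mul, Complex.norm_real]
        refine mul_le_one₀ (d.abs_w p.1) (norm_nonneg _) ?_
        rw [show Complex.I * ((∑ j, d.c j p.1 * l j : ℝ) : ℂ) * p.2 =
          (((∑ j, d.c j p.1 * l j) * p.2 : ℝ) : ℂ) * Complex.I by push_cast; ring]
        exact (Complex.norm_exp_ofReal_mul_I _).le

theorem isCont_fourierRep {n : ℕ} (d : HermiteGenocchi n) (m : Measure ℝ) [IsFiniteMeasure m] :
    (fourierRep d m).IsCont := by
  intro j p
  refine Continuous.mul ?_ continuous_const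
  fun_prop

/-- `φ` has a representation that is continuous in the real variables. -/
def HasContRep {n : ℕ} (φ : (Fin (n + 1) → ℝ) → ℂ) : Prop := ∃ r : BSRep φ, r.IsCont

namespace HasContRep

variable {n : ℕ} {φ χ : (Fin (n + 1) → ℝ) → ℂ}

theorem congr (h : HasContRep φ) (he : ∀ l, χ l = φ l) : HasContRep χ := by
  obtain ⟨r, hr⟩ := h
  exact ⟨r.congr he, hr⟩

theorem add (h : HasContRep φ) (h' : HasContRep χ) : HasContRep fun l => φ l + χ l := by
  obtain ⟨r, hr⟩ := h
  obtain ⟨s, hs⟩ := h'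
  exact ⟨r.add s, hr.add hs⟩

theorem const_mul (h : HasContRep φ) (c : ℂ) : HasContRep fun l => c * φ l := by
  obtain ⟨r, hr⟩ := h
  exact congr ⟨r.mulAt 0 (fun _ => c) (BddMeas.const c), hr.mulAt 0 _ continuous_const⟩
    fun l => mul_comm _ _

theorem sub (h : HasContRep φ) (h' : HasContRep χ) : HasContRep fun l => φ l - χ l :=
  (h.add (h'.const_mul (-1))).congr fun l => by ring

theorem insert (h : HasContRep φ) (p : Fin (n + 2)) :
    HasContRep fun l => φ (fun j => l (p.succAbove j)) := by
  obtain ⟨r, hr⟩ := h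
  exact ⟨r.insert p, hr.insert p⟩

end HasContRep

theorem hasContRep_avgDiff {n : ℕ} {g : ℝ → ℂ} (hg : MemW0 (iteratedDeriv n g)) :
    HasContRep (avgDiff n g) := by
  obtain ⟨-, -, μ, hμ⟩ := hg
  obtain ⟨m, hfin, hm⟩ := exists_integral_complexMeasure μ
  set d := hermiteGenocchi n with hd
  have hrep : ∀ k, HasContRep fun l : Fin (n + 1) → ℝ => ∫ ω, (d.w ω : ℂ) *
      ∫ y, Complex.exp (Complex.I * ((∑ j, d.c j ω * l j : ℝ) : ℂ) * y) ∂(m k) ∂d.ν :=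
    fun k => ⟨fourierRep d (m k), isCont_fourierRep d (m k)⟩
  refine (((((hrep 0).const_mul (polarPhase 0)).add ((hrep 1).const_mul (polarPhase 1))).add
    ((hrep 2).const_mul (polarPhase 2))).add ((hrep 3).const_mul (polarPhase 3))).congr fun l => ?_
  have hval : ∀ x, iteratedDeriv n g x =
      ∑ k, polarPhase k * ∫ y, Complex.exp (Complex.I * x * y) ∂(m k) := fun x => by
    rw [hμ, hm _ (bddMeas_exp x)]
  have hintg : ∀ k, Integrable (fun ω => (d.w ω : ℂ) *
      ∫ y, Complex.exp (Complex.I * ((∑ j, d.c j ω * l j : ℝ) : ℂ) * y) ∂(m k)) d.ν := by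
    intro k
    refine Integrable.of_bound (C := (m k).real Set.univ) ?_ (Eventually.of_forall fun ω => ?_)
    · refine (Complex.measurable_ofReal.comp d.measurable_w).aestronglyMeasurable.mul ?_
      refine StronglyMeasurable.aestronglyMeasurable ?_
      refine StronglyMeasurable.integral_prod_right (f := fun ω (y : ℝ) =>
        Complex.exp (Complex.I * ((∑ j, d.c j ω * l j : ℝ) : ℂ) * y)) ?_
      refine Measurable.stronglyMeasurable (Complex.measurable_exp.comp
        (((Complex.measurable_ofReal.comp ((d.measurable_sum l).comp measurable_fst)).const_mul
          _).mul (Complex.measurable_ofReal.comp measurable_snd)))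
    · rw [norm_mul, Complex.norm_real]
      refine (mul_le_of_le_one_left (norm_nonneg _) (d.abs_w ω)).trans ?_
      refine (norm_integral_le_of_bound (m k) (C := 1) fun y => ?_).trans (one_mul _).le
      rw [show Complex.I * ((∑ j, d.c j ω * l j : ℝ) : ℂ) * y =
        (((∑ j, d.c j ω * l j) * y : ℝ) : ℂ) * Complex.I by push_cast; ring]
      exact (Complex.norm_exp_ofReal_mul_I _).le
  rw [avgDiff, ← hd]
  simp only [hval, Finset.mul_sum, mul_left_comm (_ : ℂ) (polarPhase _)]
  rw [integral_finsetSum _ fun k _ => (hintg k).const_mul _]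
  simp only [integral_const_mul, Fin.sum_univ_four]

theorem contDiff_u_pow {n : WithTop ℕ∞} (p : ℕ) : ContDiff ℝ n fun x => u x ^ p :=
  contDiff_u.pow p

/-- The representation of `(f u^p)^{[m]} u(λ₁) ⋯ u(λ_k)`, `m = p + k`. -/
theorem hasContRep_avgDiff_mul {n : ℕ} {f : ℝ → ℂ} (hf : MemW n f) (k : ℕ) :
    ∀ p m : ℕ, m = p + k → m ≤ n → HasContRep fun l : Fin (m + 1) → ℝ =>
      avgDiff m (fun x => f x * u x ^ p) l *
        ∏ j : Fin m, if j.val < k then u (l j.succ) else 1 := by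
  induction k with
  | zero =>
    intro p m hm hmn
    obtain rfl : m = p := hm
    exact (hasContRep_avgDiff (hf.2 m hmn)).congr fun l => by simp
  | succ k ih =>
    intro p m hm hmn
    obtain ⟨m, rfl⟩ : ∃ m', m = m' + 1 := ⟨p + k, by omega⟩
    set κ : Fin (m + 1) := ⟨k, by omega⟩ with hκ
    -- Leibniz at the node of the last weight: (f u^p)^{[m+1]} times that weight is (f
    -- u^{p+1})^{[m+1]} minus (f u^p)^{[m]} without the node. Both terms carry only k weights, and
    -- the second is independent of the removed variable.
    have h1 := ih (p + 1) (m + 1) (by omega) hmn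
    have h2 := (ih p m (by omega) (by omega)).insert κ.succ
    refine (h1.sub h2).congr fun l => ?_
    have hg : ContDiff ℝ (m + 1) fun x => f x * u x ^ p :=
      (hf.1.of_le (by exact_mod_cast hmn)).mul (contDiff_u_pow p)
    have hmul := avgDiff_mul_u hg l κ.succ
    have he : (fun x => f x * u x ^ (p + 1)) = fun x => f x * u x ^ p * u x := by
      ext x
      rw [pow_succ, mul_assoc]
    have hp1 : (∏ j : Fin (m + 1), if j.val < k + 1 then u (l j.succ) else 1) =
        u (l κ.succ) * ∏ j : Fin (m + 1), if j.val < k then u (l j.succ) else 1 := by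
      rw [Fin.prod_univ_succAbove _ κ, Fin.prod_univ_succAbove _ κ]
      rw [if_pos (show κ.val < k + 1 from Nat.lt_succ_self k),
        if_neg (show ¬ κ.val < k from lt_irrefl k), one_mul]
      congr 1
      refine Finset.prod_congr rfl fun j _ => ?_
      have hne : (κ.succAbove j).val ≠ k := fun h => Fin.succAbove_ne κ j (Fin.ext h)
      by_cases h : (κ.succAbove j).val < k
      · rw [if_pos h, if_pos (by omega)]
      · rw [if_neg h, if_neg (by omega)]
    have hp2 : (∏ j : Fin (m + 1), if j.val < k then u (l j.succ) else 1) =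
        ∏ j : Fin m, if j.val < k then u (l (κ.succ.succAbove j.succ)) else 1 := by
      rw [Fin.prod_univ_succAbove _ κ, if_neg (show ¬ κ.val < k from lt_irrefl k), one_mul]
      refine Finset.prod_congr rfl fun j _ => ?_
      rw [Fin.succ_succAbove_succ]
      have hiff : (κ.succAbove j).val < k ↔ j.val < k := by
        rw [Fin.succAbove]
        split_ifs with h
        · rfl
        · have : ¬ j.val < k := h
          simp only [Fin.val_succ]
          omega
      simp only [hiff]
    rw [he, hmul, hp1, hp2]
    ring

/-- `f^{[n]}(λ₀, …, λₙ) u(λ₁) ⋯ u(λₙ)`. -/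
def weightedDiff (f : ℝ → ℂ) (n : ℕ) (l : Fin (n + 1) → ℝ) : ℂ :=
  avgDiff n f l * ∏ j : Fin n, u (l j.succ)

theorem hasContRep_weightedDiff {n : ℕ} {f : ℝ → ℂ} (hf : MemW n f) {m : ℕ} (hm : m ≤ n) :
    HasContRep (weightedDiff f m) := by
  refine (hasContRep_avgDiff_mul hf m 0 m (by omega) hm).congr fun l => ?_
  simp [weightedDiff]

end RelMOI
end

noncomputable section
namespace RelMOI

/-! ### The perturbation formula -/

variable {𝓗 : Type*} [NormedAddCommGroup 𝓗] [InnerProductSpace ℂ 𝓗] [CompleteSpace 𝓗]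

/-- The perturbed operator `H + t V`. -/
abbrev pert (H V : 𝓗 →ₗ.[ℂ] 𝓗) (t : ℝ) : 𝓗 →ₗ.[ℂ] 𝓗 := H + (t : ℂ) • V

open Classical in
/-- The bounded operator `V (H + t V - i)⁻¹`. -/
def pertProd (H V : 𝓗 →ₗ.[ℂ] 𝓗) (t : ℝ) : 𝓗 →L[ℂ] 𝓗 :=
  if h : ∃ W, IsBoundedProduct V (resolvent (pert H V t)) W then h.choose else 0

/-- The standing assumptions on the perturbation. -/
structure Perturbation (H V : 𝓗 →ₗ.[ℂ] 𝓗) : Prop where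
  selfAdjoint : IsSelfAdjoint H
  symm : V.IsFormalAdjoint V
  relBounded : IsRelBounded H V

/-- The interval of admissible coupling constants. -/
abbrev couplings (H V : 𝓗 →ₗ.[ℂ] 𝓗) : Set ℝ := symmInterval (relBound H V)

namespace Perturbation

variable {H V : 𝓗 →ₗ.[ℂ] 𝓗}

theorem isSelfAdjoint (hp : Perturbation H V)
    {t : ℝ} (ht : t ∈ couplings H V) : IsSelfAdjoint (pert H V t) :=
  isSelfAdjoint_pert hp.selfAdjoint hp.symm hp.relBounded ht

theorem isBoundedProduct (hp : Perturbation H V) {t : ℝ} (ht : t ∈ couplings H V) :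
    IsBoundedProduct V (resolvent (pert H V t)) (pertProd H V t) := by
  have h := exists_product_resolvent (hp.isSelfAdjoint ht) (isRelBounded_pert hp.relBounded ht)
  rw [pertProd, dif_pos h]
  exact h.choose_spec

/-- The second resolvent identity: applying H + sV - i to x = R_t ψ gives ψ + (s - t)Vx, because the
two operators differ by (s - t)V on their common domain. -/
theorem resolvent_eq (hp : Perturbation H V)
    {s t : ℝ} (hs : s ∈ couplings H V) (ht : t ∈ couplings H V) :
    resolvent (pert H V t) = resolvent (pert H V s) *
      (1 + ((s - t : ℝ) : ℂ) • pertProd H V t) := by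
  ext ψ
  have hd := hp.relBounded.1
  have hg1 := (isResolvent_resolvent (hp.isSelfAdjoint ht)).1 ψ
  have hg2 := hp.isBoundedProduct ht ψ
  generalize resolvent (pert H V t) ψ = x at hg1 hg2 ⊢
  obtain ⟨h1, h2⟩ := apply_eq_of_mem_graph hg1
  obtain ⟨h3, h4⟩ := apply_eq_of_mem_graph hg2
  have hxH : x ∈ H.domain := by rwa [pert_domain hd] at h1
  have hxs : x ∈ (pert H V s).domain := by rwa [pert_domain hd]
  have h5 := (isResolvent_resolvent (hp.isSelfAdjoint hs)).2 ⟨x, hxs⟩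
  rw [pert_apply hd _ hxH] at h2 h5
  refine h5.symm.trans ?_
  rw [mul_apply_eq_comp]
  congr 1
  simp only [add_apply, smul_apply, one_apply_eq_self]
  rw [← h4]
  have h6 : H ⟨x, hxH⟩ = ψ + Complex.I • x - (t : ℂ) • V ⟨x, h3⟩ := by
    rw [← h2]
    abel
  rw [h6]
  push_cast
  rw [sub_smul]
  abel

theorem pertProd_eq (hp : Perturbation H V)
    {s t : ℝ} (hs : s ∈ couplings H V) (ht : t ∈ couplings H V) :
    pertProd H V t = pertProd H V s * (1 + ((s - t : ℝ) : ℂ) • pertProd H V t) := by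
  have h := (hp.isBoundedProduct hs).mul (1 + ((s - t : ℝ) : ℂ) • pertProd H V t)
  rw [← hp.resolvent_eq hs ht] at h
  exact (hp.isBoundedProduct ht).eq h

/-- The truncated form of u(H_s) R_t = 1 + (s - t)W_t. Here a factor u in one variable and 1/u in
the next are converted into the perturbation. -/
theorem funCalc_u_cutoff_mul (hp : Perturbation H V)
    {s t : ℝ} (hs : s ∈ couplings H V) (ht : t ∈ couplings H V) (N : ℕ) :
    funCalc (pert H V s) (fun x => u x * cutoff N x) * resolvent (pert H V t) =
      funCalc (pert H V s) (cutoff N) * (1 + ((s - t : ℝ) : ℂ) • pertProd H V t) := by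
  rw [hp.resolvent_eq hs ht, ← mul_assoc, ← funCalc_inv_u (hp.isSelfAdjoint hs),
    ← (isCalculus_funCalc (hp.isSelfAdjoint hs)).mul _ _ (bddMeas_mul_cutoff continuous_u N)
      bddMeas_inv_u]
  congr 2
  ext x
  have := u_ne_zero x
  field_simp

end Perturbation

namespace BSRep

variable {n : ℕ} {φ : (Fin (n + 1) → ℝ) → ℂ}

theorem moi_mulAt_castSucc_update (r : BSRep φ) (k : Fin n) {g : ℝ → ℂ} (hg : BddMeas g)
    {H : Fin (n + 1) → 𝓗 →ₗ.[ℂ] 𝓗} (hH : ∀ j, IsSelfAdjoint (H j)) (W : Fin n → 𝓗 →L[ℂ] 𝓗)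
    (T : 𝓗 →L[ℂ] 𝓗) :
    (r.mulAt k.castSucc g hg).moi H (Function.update W k T) =
      r.moi H (Function.update W k (funCalc (H k.castSucc) g * T)) := by
  rw [moi_mulAt_castSucc r k hg hH, Function.update_self, Function.update_idem]

theorem moi_mulAt_succ_update (r : BSRep φ) (k : Fin n) {g : ℝ → ℂ} (hg : BddMeas g)
    {H : Fin (n + 1) → 𝓗 →ₗ.[ℂ] 𝓗} (hH : ∀ j, IsSelfAdjoint (H j)) (W : Fin n → 𝓗 →L[ℂ] 𝓗)
    (T : 𝓗 →L[ℂ] 𝓗) :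
    (r.mulAt k.succ g hg).moi H (Function.update W k T) =
      r.moi H (Function.update W k (T * funCalc (H k.succ) g)) := by
  rw [moi_mulAt_succ r k hg hH, Function.update_self, Function.update_idem]

variable [TopologicalSpace.SeparableSpace 𝓗]

theorem moi_slot_affine (r : BSRep φ) {H : Fin (n + 1) → 𝓗 →ₗ.[ℂ] 𝓗}
    (hH : ∀ j, IsSelfAdjoint (H j)) (W : Fin n → 𝓗 →L[ℂ] 𝓗) (k : Fin n) (a b : 𝓗 →L[ℂ] 𝓗)
    (c : ℂ) : r.moi H (Function.update W k (a + c • b)) =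
      r.moi H (Function.update W k a) + c • r.moi H (Function.update W k b) := by
  ext ψ
  simp only [add_apply, smul_apply, r.moi_apply hH]
  have h1 := (r.isOpFam_chain hH (Function.update W k a)).integrable r.ν ψ
  have h2 := ((r.isOpFam_chain hH (Function.update W k b)).integrable r.ν ψ).fun_smul c
  rw [← integral_smul, ← integral_add h1 h2]
  congr 1
  ext ω
  obtain ⟨X, Y, h⟩ := chain_slot (fun j => r.fam H j ω) W k
  simp [h, mul_add, add_mul]

theorem tendsto_moi_cutoff (r : BSRep φ) {H : Fin (n + 1) → 𝓗 →ₗ.[ℂ] 𝓗}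
    (hH : ∀ j, IsSelfAdjoint (H j)) (W : Fin n → 𝓗 →L[ℂ] 𝓗) (k : Fin n) (T : 𝓗 →L[ℂ] 𝓗) (ψ : 𝓗) :
    Tendsto (fun N => r.moi H (Function.update W k (funCalc (H k.castSucc) (cutoff N) * T)) ψ) atTop
      (𝓝 (r.moi H (Function.update W k T) ψ)) := by
  have hc := isCalculus_funCalc (hH k.castSucc)
  refine r.tendsto_moi_slot hH W k (D := ‖T‖) (fun N => ?_) (fun ψ => ?_) ψ
  · refine (norm_mul_le _ _).trans (mul_le_of_le_one_left (norm_nonneg _) ?_)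
    exact hc.norm_le (bddMeas_cutoff N).1 zero_le_one (norm_cutoff_le N)
  · simp only [mul_apply_eq_comp]
    exact hc.tendsto_cutoff (T ψ)

/-- The multiple operator integral in the arguments `V (H + t V - i)⁻¹`. -/
def pertMoi (r : BSRep φ) (H V : 𝓗 →ₗ.[ℂ] 𝓗) (σ : Fin (n + 1) → ℝ) : 𝓗 →L[ℂ] 𝓗 :=
  r.moi (fun j => pert H V (σ j)) (fun j => pertProd H V (σ j.succ))

end BSRep

theorem prod_u_eq {n : ℕ} (l : Fin (n + 2) → ℝ) (i : Fin (n + 1)) :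
    ∏ j : Fin (n + 1), u (l j.succ) =
      u (l i.succ) * ∏ j : Fin n, u (l (i.succ.succAbove j.succ)) := by
  rw [Fin.prod_univ_succAbove _ i]
  simp only [Fin.succ_succAbove_succ]

theorem prod_u_castSucc {n : ℕ} (l : Fin (n + 2) → ℝ) (k : Fin n) :
    u (l k.succ.castSucc) * ∏ j : Fin n, u (l (k.succ.castSucc.succAbove j.succ)) =
      u (l k.succ.succ) * ∏ j : Fin n, u (l (k.succ.succ.succAbove j.succ)) := by
  cases n with
  | zero => exact k.elim0
  | succ n =>
    rw [Fin.prod_univ_succAbove _ k, Fin.prod_univ_succAbove _ k,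
      ← BSRep.succ_eq_castSucc_succAbove k.succ, ← BSRep.castSucc_eq_succ_succAbove k.succ]
    have h : ∀ j : Fin n, k.succ.succ.succAbove (k.succAbove j).succ =
        k.succ.castSucc.succAbove (k.succAbove j).succ := fun j =>
      BSRep.succAbove_eq_of_ne fun h => Fin.succAbove_ne k j (Fin.succ_injective _ h)
    simp only [h]
    ring

variable [TopologicalSpace.SeparableSpace 𝓗]

/-- The perturbation formula for multiple operator integrals. -/
theorem Perturbation.pertMoi_sub {H V : 𝓗 →ₗ.[ℂ] 𝓗} (hp : Perturbation H V) {n : ℕ} {f : ℝ → ℂ}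
    (hf : ContDiff ℝ (n + 1) f) (r : BSRep (weightedDiff f n)) (s : BSRep (weightedDiff f (n + 1)))
    {σ : Fin (n + 2) → ℝ} (hσ : ∀ j, σ j ∈ couplings H V) (i : Fin (n + 1)) :
    r.pertMoi H V (fun j => σ (i.succ.succAbove j)) -
        r.pertMoi H V (fun j => σ (i.castSucc.succAbove j)) =
      ((σ i.castSucc - σ i.succ : ℝ) : ℂ) • s.pertMoi H V σ := by
  set Hv : Fin (n + 2) → 𝓗 →ₗ.[ℂ] 𝓗 := fun j => pert H V (σ j) with hHv
  set Wv : Fin (n + 1) → 𝓗 →L[ℂ] 𝓗 := fun j => pertProd H V (σ j.succ) with hWv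
  have hH : ∀ j, IsSelfAdjoint (Hv j) := fun j => hp.isSelfAdjoint (hσ j)
  -- The formal value of u(H_i) R_{i+1}. Expanding it in slot i yields the unit argument plus the
  -- wanted multiple of V R_{i+1}.
  set Z : 𝓗 →L[ℂ] 𝓗 := 1 + ((σ i.castSucc - σ i.succ : ℝ) : ℂ) • Wv i with hZ
  have hdiff : ∀ l : Fin (n + 2) → ℝ, (u (l i.castSucc) - u (l i.succ)) * avgDiff (n + 1) f l =
      avgDiff n f (fun k => l (i.succ.succAbove k)) -
        avgDiff n f (fun k => l (i.castSucc.succAbove k)) := by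
    intro l
    rw [← avgDiff_sub hf]
    simp only [u]
    push_cast
    ring
  -- it suffices to identify the term without the variable `i`
  have main : ∀ B : ℕ → 𝓗 →L[ℂ] 𝓗, ∀ B' : 𝓗 →L[ℂ] 𝓗,
      (∀ N, s.moi Hv (Function.update Wv i (funCalc (Hv i.castSucc) (cutoff N) * Z)) + B N =
        (r.insert i.succ).moi Hv (Function.update Wv i (funCalc (Hv i.castSucc) (cutoff N) * 1)) +
          s.moi Hv (Function.update Wv i (funCalc (Hv i.castSucc) (cutoff N) * 1))) →
      (∀ ψ, Tendsto (fun N => B N ψ) atTop (𝓝 (B' ψ))) →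
      B' = r.pertMoi H V (fun j => σ (i.castSucc.succAbove j)) →
      r.pertMoi H V (fun j => σ (i.succ.succAbove j)) -
          r.pertMoi H V (fun j => σ (i.castSucc.succAbove j)) =
        ((σ i.castSucc - σ i.succ : ℝ) : ℂ) • s.pertMoi H V σ := by
    intro B B' hB hlim hB'
    have h1 : s.moi Hv (Function.update Wv i Z) + B' =
        (r.insert i.succ).moi Hv (Function.update Wv i 1) +
          s.moi Hv (Function.update Wv i 1) := by
      ext ψ
      have h2 := (s.tendsto_moi_cutoff hH Wv i Z ψ).add (hlim ψ)
      have h3 := ((r.insert i.succ).tendsto_moi_cutoff hH Wv i 1 ψ).add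
        (s.tendsto_moi_cutoff hH Wv i 1 ψ)
      refine tendsto_nhds_unique (h2.congr fun N => ?_) h3
      exact congrArg (fun A : 𝓗 →L[ℂ] 𝓗 => A ψ) (hB N)
    have h4 : (r.insert i.succ).moi Hv (Function.update Wv i 1) =
        r.pertMoi H V (fun j => σ (i.succ.succAbove j)) := by
      rw [r.moi_insert_succ i hH Wv, BSRep.pertMoi]
      simp only [hWv, Fin.succ_succAbove_succ]
      rfl
    have h5 : s.moi Hv (Function.update Wv i Z) = s.moi Hv (Function.update Wv i 1) +
        ((σ i.castSucc - σ i.succ : ℝ) : ℂ) • s.pertMoi H V σ := by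
      rw [hZ, s.moi_slot_affine hH, Function.update_eq_self]
      rfl
    rw [h4, h5, hB'] at h1
    rw [sub_eq_iff_eq_add, ← add_right_inj (s.moi Hv (Function.update Wv i 1)), ← add_assoc, h1]
    abel
  -- Multiplying the symbol by the truncated u in variable i and by 1/u in variable i + 1, around
  -- the argument 1, puts the truncated Z into the slot. With `hcut` this reduces the operator
  -- identity to an identity of symbols.
  have hleft : ∀ {φ : (Fin (n + 2) → ℝ) → ℂ} (q : BSRep φ) (N : ℕ),
      ((q.mulAt i.castSucc _ (bddMeas_mul_cutoff continuous_u N)).mulAt i.succ _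
        bddMeas_inv_u).moi Hv (Function.update Wv i 1) =
          q.moi Hv (Function.update Wv i (funCalc (Hv i.castSucc) (cutoff N) * Z)) := by
    intro φ q N
    rw [BSRep.moi_mulAt_succ_update _ _ _ hH, BSRep.moi_mulAt_castSucc_update _ _ _ hH, one_mul,
      funCalc_inv_u (hH _), hp.funCalc_u_cutoff_mul (hσ _) (hσ _)]
  have hcut : ∀ {φ : (Fin (n + 2) → ℝ) → ℂ} (q : BSRep φ) (N : ℕ),
      (q.mulAt i.castSucc _ (bddMeas_cutoff N)).moi Hv (Function.update Wv i 1) =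
        q.moi Hv (Function.update Wv i (funCalc (Hv i.castSucc) (cutoff N) * 1)) := by
    intro φ q N
    rw [BSRep.moi_mulAt_castSucc_update _ _ _ hH]
  -- Variable 0 is unweighted, so for i = 0 the two lower order symbols carry the same weights. For
  -- i > 0 the weights differ by exchanging u(λ_i) for u(λ_{i+1}).
  obtain rfl | ⟨k, hk⟩ := Fin.eq_zero_or_eq_succ i
  · refine main (fun N => (r.insert (0 : Fin (n + 1)).castSucc).moi Hv
      (Function.update Wv 0 (funCalc (Hv (0 : Fin (n + 1)).castSucc) (cutoff N) * 1))) _ (fun N => ?_)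
      (fun ψ => (r.insert (0 : Fin (n + 1)).castSucc).tendsto_moi_cutoff hH Wv 0 1 ψ) ?_
    · rw [← hleft, ← hcut, ← hcut, ← hcut, ← BSRep.moi_add _ _ hH, ← BSRep.moi_add _ _ hH]
      refine BSRep.moi_eq_of_eq _ _ (fun l => ?_) hH _
      have h0 : ∀ j : Fin n, (0 : Fin (n + 1)).castSucc.succAbove j.succ =
          (0 : Fin (n + 1)).succ.succAbove j.succ := fun j =>
        (BSRep.succAbove_eq_of_ne (Fin.succ_ne_zero j)).symm
      simp only [weightedDiff]
      rw [prod_u_eq l 0]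
      simp only [h0]
      have hu := u_ne_zero (l (0 : Fin (n + 1)).succ)
      have hd := hdiff l
      generalize avgDiff n f (fun k => l ((0 : Fin (n + 1)).succ.succAbove k)) = d1 at hd ⊢
      generalize avgDiff n f (fun k => l ((0 : Fin (n + 1)).castSucc.succAbove k)) = d2 at hd ⊢
      generalize ∏ j : Fin n, u (l ((0 : Fin (n + 1)).succ.succAbove j.succ)) = P
      field_simp
      linear_combination (P * cutoff N (l (0 : Fin (n + 1)).castSucc)) * hd
    · rw [r.moi_insert_zero hH Wv, BSRep.pertMoi]
      rfl
  -- The factor u(λ_i)/u(λ_{i+1}) repairs the mismatch of weights at the cost of an argument Z after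
  -- the dummy variable. Merged to the left, it turns W at σ_i into W at σ_{i+1} by `pertProd_eq`,
  -- as the lower order integral requires.
  · subst hk
    refine main (fun N => (r.insert k.succ.castSucc).moi Hv
      (Function.update Wv k.succ (funCalc (Hv k.succ.castSucc) (cutoff N) * Z))) _ (fun N => ?_)
      (fun ψ => (r.insert k.succ.castSucc).tendsto_moi_cutoff hH Wv k.succ Z ψ) ?_
    · rw [← hleft, ← hleft, ← hcut, ← hcut, ← BSRep.moi_add _ _ hH, ← BSRep.moi_add _ _ hH]
      refine BSRep.moi_eq_of_eq _ _ (fun l => ?_) hH _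
      simp only [weightedDiff]
      rw [prod_u_eq l k.succ]
      have hP := prod_u_castSucc l k
      have hu := u_ne_zero (l k.succ.succ)
      have hd := hdiff l
      generalize avgDiff n f (fun j => l (k.succ.succ.succAbove j)) = d1 at hd ⊢
      generalize avgDiff n f (fun j => l (k.succ.castSucc.succAbove j)) = d2 at hd ⊢
      generalize ∏ j : Fin n, u (l (k.succ.succ.succAbove j.succ)) = P at hP ⊢
      generalize ∏ j : Fin n, u (l (k.succ.castSucc.succAbove j.succ)) = Q at hP ⊢
      generalize cutoff N (l k.succ.castSucc) = e
      field_simp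
      linear_combination (u (l k.succ.succ) * P * e) * hd + (e * d2) * hP
    · rw [r.moi_insert_castSucc_succ k hH Wv Z, BSRep.pertMoi]
      congr 1
      ext1 j
      by_cases hj : j = k
      · subst hj
        rw [Function.update_self, ← BSRep.succ_eq_castSucc_succAbove j.succ]
        exact (hp.pertProd_eq (hσ _) (hσ _)).symm
      · rw [Function.update_of_ne hj, ← BSRep.succAbove_eq_of_ne
          fun h => hj (Fin.succ_injective _ h), Fin.succ_succAbove_succ]

end RelMOI
end

noncomputable section
namespace RelMOI

/-! ### Strong convergence -/

variable {𝓗 : Type*} [NormedAddCommGroup 𝓗] [InnerProductSpace ℂ 𝓗]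
variable {ι : Type*} {l : Filter ι}

/-- Bounded strong convergence of operators. -/
def SConv (l : Filter ι) (A : ι → 𝓗 →L[ℂ] 𝓗) (T : 𝓗 →L[ℂ] 𝓗) : Prop :=
  (∃ C : ℝ, ∀ᶠ i in l, ‖A i‖ ≤ C) ∧ ∀ ψ, Tendsto (fun i => A i ψ) l (𝓝 (T ψ))

theorem eventually_norm_le_of_tendsto {A : ι → 𝓗 →L[ℂ] 𝓗} {T : 𝓗 →L[ℂ] 𝓗}
    (h : Tendsto A l (𝓝 T)) : ∀ᶠ i in l, ‖A i‖ ≤ ‖T‖ + 1 :=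
  (h.norm.eventually_lt_const (lt_add_one ‖T‖)).mono fun _ hi => hi.le

namespace SConv

variable {A B : ι → 𝓗 →L[ℂ] 𝓗} {S T : 𝓗 →L[ℂ] 𝓗}

theorem of_tendsto (h : Tendsto A l (𝓝 T)) : SConv l A T :=
  ⟨⟨_, eventually_norm_le_of_tendsto h⟩, fun ψ =>
    ((ContinuousLinearMap.apply ℂ 𝓗 ψ).continuous.tendsto T).comp h⟩

theorem exists_bound (h : SConv l A T) : ∃ C : ℝ, 0 ≤ C ∧ ∀ᶠ i in l, ‖A i‖ ≤ C := by
  obtain ⟨C, hC⟩ := h.1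
  exact ⟨max C 0, le_max_right _ _, hC.mono fun i hi => hi.trans (le_max_left _ _)⟩

theorem tendsto_apply (h : SConv l A T) {v : ι → 𝓗} {w : 𝓗} (hv : Tendsto v l (𝓝 w)) :
    Tendsto (fun i => A i (v i)) l (𝓝 (T w)) := by
  obtain ⟨C, hC0, hC⟩ := h.exists_bound
  have h1 : Tendsto (fun i => A i (v i - w)) l (𝓝 0) := by
    have h2 : Tendsto (fun i => C * ‖v i - w‖) l (𝓝 0) := by
      have := (tendsto_sub_nhds_zero_iff.mpr hv).norm.const_mul C
      simpa using this
    refine squeeze_zero_norm' ?_ h2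
    filter_upwards [hC] with i hi
    exact (A i).le_of_opNorm_le hi _
  have h3 := h1.add (h.2 w)
  rw [zero_add] at h3
  refine h3.congr fun i => ?_
  rw [← map_add, sub_add_cancel]

theorem mul (hA : SConv l A S) (hB : SConv l B T) : SConv l (fun i => A i * B i) (S * T) := by
  refine ⟨?_, fun ψ => hA.tendsto_apply (hB.2 ψ)⟩
  obtain ⟨C, hC0, hC⟩ := hA.exists_bound
  obtain ⟨D, hD0, hD⟩ := hB.exists_bound
  refine ⟨C * D, ?_⟩
  filter_upwards [hC, hD] with i h1 h2
  exact (norm_mul_le _ _).trans (mul_le_mul h1 h2 (norm_nonneg _) hC0)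

theorem chain {n : ℕ} {A : Fin (n + 1) → ι → 𝓗 →L[ℂ] 𝓗} {S : Fin (n + 1) → 𝓗 →L[ℂ] 𝓗}
    {W : Fin n → ι → 𝓗 →L[ℂ] 𝓗} {T : Fin n → 𝓗 →L[ℂ] 𝓗} (hA : ∀ j, SConv l (A j) (S j))
    (hW : ∀ j, SConv l (W j) (T j)) :
    SConv l (fun i => RelMOI.chain (fun j => A j i) (fun j => W j i)) (RelMOI.chain S T) := by
  induction n with
  | zero => simpa only [chain_zero] using hA 0
  | succ n ih =>
    simp only [chain_succ]
    exact ((hA 0).mul (hW 0)).mul (ih (fun j => hA j.succ) (fun j => hW j.succ))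

/-- Strong convergence becomes norm convergence after multiplication by a compact operator. -/
theorem tendsto_mul_compact (h : SConv l A S) {K : 𝓗 →L[ℂ] 𝓗} (hK : IsCompactOperator K) :
    Tendsto (fun i => A i * K) l (𝓝 (S * K)) := by
  obtain ⟨C, hC0, hC⟩ := h.exists_bound
  rw [Metric.tendsto_nhds]
  intro ε hε
  set D := C + ‖S‖ + 1 with hD
  have hD0 : 0 < D := by positivity
  have hcomp : IsCompact (closure (K '' Metric.closedBall 0 1)) :=
    hK.isCompact_closure_image_closedBall 1
  -- Strong convergence is uniform on a finite net of the compact closure of K(ball). Off the net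
  -- the error is controlled by D, which eventually dominates ‖A i - S‖.
  obtain ⟨t, ht, htc⟩ := Metric.totallyBounded_iff.mp hcomp.totallyBounded (ε / (4 * D))
    (by positivity)
  have hev : ∀ᶠ i in l, ∀ x ∈ t, ‖A i x - S x‖ < ε / 4 := by
    rw [Filter.eventually_all_finite ht]
    intro x _
    have := (tendsto_sub_nhds_zero_iff.mpr (h.2 x)).norm
    rw [norm_zero] at this
    exact this.eventually_lt_const (by positivity)
  filter_upwards [hC, hev] with i hi hx
  have hb : ‖A i * K - S * K‖ ≤ ε / 2 := by
    refine ContinuousLinearMap.opNorm_le_of_unit_norm (by positivity) fun ψ hψ => ?_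
    have hm : K ψ ∈ closure (K '' Metric.closedBall 0 1) :=
      subset_closure (Set.mem_image_of_mem _ (by simp [hψ]))
    obtain ⟨x, hxt, hxb⟩ := Set.mem_iUnion₂.mp (htc hm)
    rw [Metric.mem_ball, dist_eq_norm] at hxb
    have h1 : (A i * K - S * K) ψ = (A i x - S x) + (A i - S) (K ψ - x) := by
      simp only [sub_apply, mul_apply_eq_comp, map_sub]
      abel
    have h2 : ‖A i - S‖ ≤ D := (norm_sub_le _ _).trans (by rw [hD]; linarith)
    have h3 : ‖(A i - S) (K ψ - x)‖ ≤ ε / 4 := by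
      refine ((A i - S).le_of_opNorm_le h2 _).trans ?_
      refine (mul_le_mul_of_nonneg_left hxb.le hD0.le).trans (le_of_eq ?_)
      field_simp
    rw [h1]
    linarith [norm_add_le (A i x - S x) ((A i - S) (K ψ - x)), hx x hxt]
  rw [dist_eq_norm]
  linarith

theorem tendsto_mul (h : SConv l A S) (hB : Tendsto B l (𝓝 T)) (hT : IsCompactOperator T) :
    Tendsto (fun i => A i * B i) l (𝓝 (S * T)) := by
  obtain ⟨C, hC0, hC⟩ := h.exists_bound
  have h1 : Tendsto (fun i => A i * (B i - T)) l (𝓝 0) := by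
    have h2 : Tendsto (fun i => C * ‖B i - T‖) l (𝓝 0) := by
      have := (tendsto_sub_nhds_zero_iff.mpr hB).norm.const_mul C
      simpa using this
    refine squeeze_zero_norm' ?_ h2
    filter_upwards [hC] with i hi
    exact (norm_mul_le _ _).trans (mul_le_mul_of_nonneg_right hi (norm_nonneg _))
  have h3 := h1.add (h.tendsto_mul_compact hT)
  rw [zero_add] at h3
  refine h3.congr fun i => ?_
  rw [← mul_add, sub_add_cancel]

end SConv

variable [CompleteSpace 𝓗]

/-- Strong convergence of operators and of their adjoints. -/
def StarSConv (l : Filter ι) (A : ι → 𝓗 →L[ℂ] 𝓗) (T : 𝓗 →L[ℂ] 𝓗) : Prop :=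
  SConv l A T ∧ SConv l (fun i => star (A i)) (star T)

/-- By the C*-identity ‖L(A - T)‖² is at most ‖(A* - T*)L*L‖ ‖A - T‖. The first factor tends to zero
by strong convergence of the adjoints and compactness of L*L. -/
theorem StarSConv.tendsto_compact_mul {A : ι → 𝓗 →L[ℂ] 𝓗} {T : 𝓗 →L[ℂ] 𝓗} (h : StarSConv l A T)
    {K : ι → 𝓗 →L[ℂ] 𝓗} {L : 𝓗 →L[ℂ] 𝓗} (hK : Tendsto K l (𝓝 L)) (hL : IsCompactOperator L) :
    Tendsto (fun i => K i * A i) l (𝓝 (L * T)) := by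
  obtain ⟨C, hC0, hC⟩ := h.1.exists_bound
  have h1 : Tendsto (fun i => (K i - L) * A i) l (𝓝 0) := by
    have h2 : Tendsto (fun i => ‖K i - L‖ * C) l (𝓝 0) := by
      have := (tendsto_sub_nhds_zero_iff.mpr hK).norm.mul_const C
      simpa using this
    refine squeeze_zero_norm' ?_ h2
    filter_upwards [hC] with i hi
    exact (norm_mul_le _ _).trans (mul_le_mul_of_nonneg_left hi (norm_nonneg _))
  have hLL : IsCompactOperator (star L * L) := hL.clm_comp (star L)
  have h2 : Tendsto (fun i => L * (A i - T)) l (𝓝 0) := by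
    have h3 := h.2.tendsto_mul_compact hLL
    have h4 := (tendsto_sub_nhds_zero_iff.mpr h3).norm
    rw [norm_zero] at h4
    have h5 : Tendsto (fun i => ‖star (A i) * (star L * L) - star T * (star L * L)‖ *
        (C + ‖T‖)) l (𝓝 0) := by
      simpa using h4.mul_const (C + ‖T‖)
    have h6 : Tendsto (fun i => ‖L * (A i - T)‖ ^ 2) l (𝓝 0) := by
      refine squeeze_zero' (Eventually.of_forall fun i => by positivity) ?_ h5
      filter_upwards [hC] with i hi
      rw [sq, ← CStarRing.norm_star_mul_self]
      have h7 : star (L * (A i - T)) * (L * (A i - T)) =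
          (star (A i) * (star L * L) - star T * (star L * L)) * (A i - T) := by
        rw [star_mul, star_sub]
        noncomm_ring
      rw [h7]
      refine (norm_mul_le _ _).trans (mul_le_mul_of_nonneg_left ?_ (norm_nonneg _))
      exact (norm_sub_le _ _).trans (by linarith)
    have h8 := h6.sqrt
    simp only [Real.sqrt_sq (norm_nonneg _), Real.sqrt_zero] at h8
    exact tendsto_zero_iff_norm_tendsto_zero.mpr h8
  have h3 := (h1.add h2).add_const (L * T)
  simp only [zero_add] at h3
  refine h3.congr fun i => ?_
  noncomm_ring

/-- Norm convergence of chains starting with a compact operator. -/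
theorem tendsto_compact_mul_chain {n : ℕ} {A : Fin (n + 1) → ι → 𝓗 →L[ℂ] 𝓗}
    {S : Fin (n + 1) → 𝓗 →L[ℂ] 𝓗} {W : Fin n → ι → 𝓗 →L[ℂ] 𝓗} {T : Fin n → 𝓗 →L[ℂ] 𝓗}
    (hA : ∀ j, StarSConv l (A j) (S j)) (hW : ∀ j, Tendsto (W j) l (𝓝 (T j)))
    {K : ι → 𝓗 →L[ℂ] 𝓗} {L : 𝓗 →L[ℂ] 𝓗} (hK : Tendsto K l (𝓝 L)) (hL : IsCompactOperator L) :
    Tendsto (fun i => K i * chain (fun j => A j i) (fun j => W j i)) l (𝓝 (L * chain S T)) := by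
  induction n generalizing K L with
  | zero => simpa only [chain_zero] using (hA 0).tendsto_compact_mul hK hL
  | succ n ih =>
    simp only [chain_succ, ← mul_assoc]
    refine ih (fun j => hA j.succ) (fun j => hW j.succ)
      (((hA 0).tendsto_compact_mul hK hL).mul (hW 0)) ?_
    exact (hL.comp_clm (S 0)).comp_clm (T 0)

/-- One compact argument suffices: it absorbs the convergence of everything to its right, and the
product stays compact, so the leading factor, multiplied from the left, needs only strong
convergence. -/
theorem tendsto_chain_of_compact {n : ℕ} {A : Fin (n + 2) → ι → 𝓗 →L[ℂ] 𝓗}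
    {S : Fin (n + 2) → 𝓗 →L[ℂ] 𝓗} {W : Fin (n + 1) → ι → 𝓗 →L[ℂ] 𝓗}
    {T : Fin (n + 1) → 𝓗 →L[ℂ] 𝓗}
    (hA : ∀ j, StarSConv l (A j) (S j)) (hW : ∀ j, Tendsto (W j) l (𝓝 (T j)))
    (hT : IsCompactOperator (T 0)) :
    Tendsto (fun i => chain (fun j => A j i) (fun j => W j i)) l (𝓝 (chain S T)) := by
  simp only [chain_succ, mul_assoc]
  refine (hA 0).1.tendsto_mul
    (tendsto_compact_mul_chain (fun j => hA j.succ) (fun j => hW j.succ) (hW 0) hT) ?_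
  exact hT.comp_clm (chain (fun j => S j.succ) (fun j => T j.succ))

/-! ### Continuity of the functional calculus in the coupling constant -/

namespace Perturbation

variable {H V : 𝓗 →ₗ.[ℂ] 𝓗} {s : ι → ℝ} {t : ℝ}

/-- From W_s - W_t = -(s - t)W_s W_t. Once |s - t|‖W_t‖ < 1/2 this forces ‖W_s‖ ≤ 2‖W_t‖, and then
the difference is O(|s - t|). -/
theorem tendsto_pertProd (hp : Perturbation H V)
    (hs : Tendsto s l (𝓝 t)) (hsI : ∀ᶠ i in l, s i ∈ couplings H V)
    (ht : t ∈ couplings H V) :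
    Tendsto (fun i => pertProd H V (s i)) l (𝓝 (pertProd H V t)) := by
  set C := ‖pertProd H V t‖
  have hst : Tendsto (fun i => |s i - t|) l (𝓝 0) := by
    simpa using (tendsto_sub_nhds_zero_iff.mpr hs).abs
  have hsmall : ∀ᶠ i in l, |s i - t| * C < 1 / 2 := by
    have := hst.mul_const C
    rw [zero_mul] at this
    exact this.eventually_lt_const (by norm_num)
  have hlim : Tendsto (fun i => |s i - t| * (2 * C * C)) l (𝓝 0) := by
    simpa using hst.mul_const (2 * C * C)
  refine tendsto_sub_nhds_zero_iff.mp (squeeze_zero_norm' ?_ hlim)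
  filter_upwards [hsI, hsmall] with i hi h1
  have h2 := hp.pertProd_eq hi ht
  have h3 : pertProd H V (s i) - pertProd H V t =
      -(((s i - t : ℝ) : ℂ) • (pertProd H V (s i) * pertProd H V t)) := by
    rw [mul_add, mul_one, mul_smul_comm] at h2
    rw [sub_eq_iff_eq_add, ← sub_eq_neg_add, eq_sub_iff_add_eq]
    exact h2.symm
  have h4 : ‖pertProd H V (s i) - pertProd H V t‖ ≤ |s i - t| * (‖pertProd H V (s i)‖ * C) := by
    rw [h3, norm_neg, norm_smul, Complex.norm_real, Real.norm_eq_abs]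
    exact mul_le_mul_of_nonneg_left (norm_mul_le _ _) (abs_nonneg _)
  have h5 : ‖pertProd H V (s i)‖ ≤ 2 * C := by
    have h6 := norm_sub_norm_le (pertProd H V (s i)) (pertProd H V t)
    have h7 : |s i - t| * (‖pertProd H V (s i)‖ * C) ≤ 1 / 2 * ‖pertProd H V (s i)‖ := by
      rw [show |s i - t| * (‖pertProd H V (s i)‖ * C) =
        |s i - t| * C * ‖pertProd H V (s i)‖ by ring]
      exact mul_le_mul_of_nonneg_right h1.le (norm_nonneg _)
    change ‖pertProd H V (s i)‖ - C ≤ _ at h6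
    linarith
  refine h4.trans (mul_le_mul_of_nonneg_left ?_ (abs_nonneg _))
  exact mul_le_mul_of_nonneg_right h5 (norm_nonneg _)

theorem norm_resolvent_le (hp : Perturbation H V)
    {t : ℝ} (ht : t ∈ couplings H V) : ‖resolvent (pert H V t)‖ ≤ 1 := by
  rw [← funCalc_inv_u (hp.isSelfAdjoint ht)]
  refine (isCalculus_funCalc (hp.isSelfAdjoint ht)).norm_le bddMeas_inv_u.1 zero_le_one fun x => ?_
  rw [norm_inv]
  exact inv_le_one_of_one_le₀ (one_le_norm_u x)

theorem tendsto_resolvent (hp : Perturbation H V)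
    (hs : Tendsto s l (𝓝 t)) (hsI : ∀ᶠ i in l, s i ∈ couplings H V)
    (ht : t ∈ couplings H V) :
    Tendsto (fun i => resolvent (pert H V (s i))) l (𝓝 (resolvent (pert H V t))) := by
  have hst : Tendsto (fun i => |s i - t| * ‖pertProd H V t‖) l (𝓝 0) := by
    simpa using (tendsto_sub_nhds_zero_iff.mpr hs).abs.mul_const ‖pertProd H V t‖
  refine tendsto_sub_nhds_zero_iff.mp (squeeze_zero_norm' ?_ hst)
  filter_upwards [hsI] with i hi
  have h3 : resolvent (pert H V (s i)) - resolvent (pert H V t) =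
      -(((s i - t : ℝ) : ℂ) • (resolvent (pert H V (s i)) * pertProd H V t)) := by
    rw [hp.resolvent_eq hi ht, mul_add, mul_one, mul_smul_comm]
    abel
  rw [h3, norm_neg, norm_smul, Complex.norm_real, Real.norm_eq_abs]
  refine mul_le_mul_of_nonneg_left ?_ (abs_nonneg _)
  exact (norm_mul_le _ _).trans
    (mul_le_of_le_one_left (norm_nonneg _) (hp.norm_resolvent_le hi))

end Perturbation

/-- `1 / u` as a map into the unit disc. -/
def invU (x : ℝ) : Metric.closedBall (0 : ℂ) 1 :=
  ⟨(u x)⁻¹, by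
    rw [mem_closedBall_zero_iff, norm_inv]
    exact inv_le_one_of_one_le₀ (one_le_norm_u x)⟩

theorem continuous_invU : Continuous invU :=
  (continuous_u.inv₀ u_ne_zero).subtype_mk _

theorem bddMeas_comp_invU (h : C(Metric.closedBall (0 : ℂ) 1, ℂ)) :
    BddMeas fun x => h (invU x) :=
  ⟨(h.continuous.comp continuous_invU).measurable, ‖h‖, fun _ => h.norm_coe_le_norm _⟩

/-- Stone–Weierstrass on the disc: norm resolvent convergence passes to polynomials in z and z̄
evaluated at 1/u, and uniform approximation reaches all continuous functions of 1/u. -/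
theorem Perturbation.tendsto_funCalc_invU {H V : 𝓗 →ₗ.[ℂ] 𝓗} (hp : Perturbation H V) {s : ι → ℝ}
    {t : ℝ} (hs : Tendsto s l (𝓝 t)) (hsI : ∀ᶠ i in l, s i ∈ couplings H V)
    (ht : t ∈ couplings H V) (h : C(Metric.closedBall (0 : ℂ) 1, ℂ)) :
    Tendsto (fun i => funCalc (pert H V (s i)) fun x => h (invU x)) l
      (𝓝 (funCalc (pert H V t) fun x => h (invU x))) := by
  have hc : ∀ {t}, t ∈ couplings H V →
      IsCalculus (specMeasure (pert H V t)) (funCalc (pert H V t)) :=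
    fun ht => isCalculus_funCalc (hp.isSelfAdjoint ht)
  have hid : Tendsto (fun i => funCalc (pert H V (s i)) fun x => (invU x : ℂ)) l
      (𝓝 (funCalc (pert H V t) fun x => (invU x : ℂ))) := by
    have := hp.tendsto_resolvent hs hsI ht
    rw [← funCalc_inv_u (hp.isSelfAdjoint ht)] at this
    refine this.congr' ?_
    filter_upwards [hsI] with i hi
    rw [← funCalc_inv_u (hp.isSelfAdjoint hi)]
    rfl
  have hidb : BddMeas fun x => (invU x : ℂ) := bddMeas_inv_u
  have hcpt : CompactSpace (Metric.closedBall (0 : ℂ) 1) :=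
    isCompact_iff_compactSpace.mp (isCompact_closedBall _ _)
  refine ContinuousMap.induction_on_of_compact (𝕜 := ℂ) (s := Metric.closedBall (0 : ℂ) 1)
    (p := fun h => Tendsto (fun i => funCalc (pert H V (s i)) fun x => h (invU x)) l
      (𝓝 (funCalc (pert H V t) fun x => h (invU x)))) ?_ ?_ ?_ ?_ ?_ ?_ h
  · intro r
    simp only [ContinuousMap.const_apply]
    rw [(hc ht).const]
    refine (tendsto_const_nhds (x := r • (1 : 𝓗 →L[ℂ] 𝓗))).congr' ?_
    filter_upwards [hsI] with i hi
    rw [(hc hi).const]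
  · exact hid
  · have h2 := (hid.star)
    rw [← (hc ht).star hidb] at h2
    refine h2.congr' ?_
    filter_upwards [hsI] with i hi
    rw [← (hc hi).star hidb]
    rfl
  · intro f g hf hg
    have h2 := hf.add hg
    rw [← (hc ht).add (bddMeas_comp_invU f) (bddMeas_comp_invU g)] at h2
    refine h2.congr' ?_
    filter_upwards [hsI] with i hi
    rw [← (hc hi).add (bddMeas_comp_invU f) (bddMeas_comp_invU g)]
    rfl
  · intro f g hf hg
    have h2 := hf.mul hg
    rw [← (hc ht).mul _ _ (bddMeas_comp_invU f) (bddMeas_comp_invU g)] at h2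
    refine h2.congr' ?_
    filter_upwards [hsI] with i hi
    rw [← (hc hi).mul _ _ (bddMeas_comp_invU f) (bddMeas_comp_invU g)]
    rfl
  · intro f hf
    rw [Metric.tendsto_nhds]
    intro ε hε
    obtain ⟨g, hg, hgb⟩ := (hf.and_eventually
      (Metric.ball_mem_nhds f (show (0 : ℝ) < ε / 4 by positivity))).exists
    have hclose : ∀ {t}, t ∈ couplings H V → ‖(funCalc (pert H V t) fun x => f (invU x)) -
        funCalc (pert H V t) fun x => g (invU x)‖ ≤ ε / 4 := by
      intro t ht
      rw [← (hc ht).sub (bddMeas_comp_invU f) (bddMeas_comp_invU g)]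
      refine (hc ht).norm_le ((bddMeas_comp_invU f).sub (bddMeas_comp_invU g)).1 (by positivity)
        fun x => ?_
      rw [dist_comm, dist_eq_norm] at hgb
      exact ((f - g).norm_coe_le_norm (invU x)).trans hgb.le
    filter_upwards [hsI, Metric.tendsto_nhds.mp hg (ε / 4) (by positivity)] with i hi h1
    have h2 := hclose hi
    have h3 := hclose ht
    rw [← dist_eq_norm] at h2 h3
    rw [dist_comm] at h3
    have h4 := dist_triangle4 (funCalc (pert H V (s i)) fun x => f (invU x))
      (funCalc (pert H V (s i)) fun x => g (invU x)) (funCalc (pert H V t) fun x => g (invU x))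
      (funCalc (pert H V t) fun x => f (invU x))
    linarith

/-- The continuous extension of `g / u` to the disc. -/
theorem exists_comp_invU {g : ℝ → ℂ} (hg : Continuous g) {C : ℝ} (hC : ∀ x, ‖g x‖ ≤ C) :
    ∃ h : C(Metric.closedBall (0 : ℂ) 1, ℂ), ∀ x, h (invU x) = g x * (u x)⁻¹ := by
  have hcont : Continuous fun z : ℂ => z * g (z⁻¹).re := by
    refine continuous_iff_continuousAt.mpr fun z => ?_
    by_cases hz : z = 0
    · subst hz
      rw [ContinuousAt, zero_mul]
      have h0 : Tendsto (fun z : ℂ => ‖z‖ * C) (𝓝 0) (𝓝 0) := by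
        have : Continuous fun z : ℂ => ‖z‖ * C := by fun_prop
        simpa using this.tendsto 0
      refine squeeze_zero_norm (fun z => ?_) h0
      rw [norm_mul]
      exact mul_le_mul_of_nonneg_left (hC _) (norm_nonneg _)
    · exact continuousAt_id.mul (hg.continuousAt.comp
        (Complex.continuous_re.continuousAt.comp (continuousAt_inv₀ hz)))
  refine ⟨⟨fun z => (z : ℂ) * g ((z : ℂ)⁻¹).re, hcont.comp continuous_subtype_val⟩, fun x => ?_⟩
  have hx : ((u x)⁻¹⁻¹).re = x := by
    rw [inv_inv]
    simp [u]
  change (u x)⁻¹ * g ((u x)⁻¹⁻¹).re = _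
  rw [hx, mul_comm]

namespace Perturbation

variable {H V : 𝓗 →ₗ.[ℂ] 𝓗} {s : ι → ℝ} {t : ℝ}

/-- Strong continuity of the functional calculus. -/
theorem sConv_funCalc (hp : Perturbation H V)
    (hs : Tendsto s l (𝓝 t)) (hsI : ∀ᶠ i in l, s i ∈ couplings H V)
    (ht : t ∈ couplings H V) {g : ℝ → ℂ} (hg : Continuous g) {C : ℝ} (hC : ∀ x, ‖g x‖ ≤ C) :
    SConv l (fun i => funCalc (pert H V (s i)) g) (funCalc (pert H V t) g) := by
  have hC0 : 0 ≤ C := (norm_nonneg _).trans (hC 0)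
  have hgb : BddMeas g := ⟨hg.measurable, C, hC⟩
  have hc : ∀ {t}, t ∈ couplings H V →
      IsCalculus (specMeasure (pert H V t)) (funCalc (pert H V t)) :=
    fun ht => isCalculus_funCalc (hp.isSelfAdjoint ht)
  have hbd : ∀ {t}, t ∈ couplings H V → ‖funCalc (pert H V t) g‖ ≤ C := fun ht =>
    (hc ht).norm_le hg.measurable hC0 hC
  refine ⟨⟨C, hsI.mono fun i hi => hbd hi⟩, ?_⟩
  set R := resolvent (pert H V t)
  -- The product g(H_s)R_s = (g/u)(H_s) converges in norm, since g/u extends continuously to the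
  -- disc; replacing R_s by R_t costs at most C‖R_tφ - R_sφ‖.
  have hR : ∀ φ, Tendsto (fun i => funCalc (pert H V (s i)) g (R φ)) l
      (𝓝 (funCalc (pert H V t) g (R φ))) := by
    intro φ
    obtain ⟨h, hh⟩ := exists_comp_invU hg hC
    have h1 := hp.tendsto_funCalc_invU hs hsI ht h
    simp only [hh] at h1
    have h2 := ((ContinuousLinearMap.apply ℂ 𝓗 φ).continuous.tendsto _).comp h1
    have hres := (SConv.of_tendsto (hp.tendsto_resolvent hs hsI ht)).2 φ
    have h3 : Tendsto (fun i => C * ‖R φ - resolvent (pert H V (s i)) φ‖) l (𝓝 0) := by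
      have := (tendsto_const_nhds (x := R φ)).sub hres
      rw [sub_self] at this
      simpa using this.norm.const_mul C
    have h4 : Tendsto (fun i => funCalc (pert H V (s i)) g
        (R φ - resolvent (pert H V (s i)) φ)) l (𝓝 0) := by
      refine squeeze_zero_norm' ?_ h3
      filter_upwards [hsI] with i hi
      exact ContinuousLinearMap.le_of_opNorm_le _ (hbd hi) _
    have hval : ∀ {t}, t ∈ couplings H V → (funCalc (pert H V t) fun x => g x * (u x)⁻¹) φ =
        funCalc (pert H V t) g (resolvent (pert H V t) φ) := by
      intro t ht
      rw [(hc ht).mul _ _ hgb bddMeas_inv_u, funCalc_inv_u (hp.isSelfAdjoint ht), mul_apply_eq_comp]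
    have h5 := h4.add h2
    simp only [zero_add, ContinuousLinearMap.apply_apply, hval ht] at h5
    refine h5.congr' ?_
    filter_upwards [hsI] with i hi
    simp only [Function.comp_apply, ContinuousLinearMap.apply_apply, hval hi, map_sub,
      sub_add_cancel]
  intro ψ
  rw [Metric.tendsto_nhds]
  intro ε hε
  have hdense := (hc ht).tendsto_cutoff ψ
  -- A spectral cutoff of ψ lies in the range of the resolvent, with preimage u times the cutoff
  -- applied to ψ. The denominator uses C + 1 so that C = 0 is allowed.
  obtain ⟨N, hN⟩ := (Metric.tendsto_nhds.mp hdense (ε / (4 * (C + 1))) (by positivity)).exists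
  set φ := funCalc (pert H V t) (fun x => u x * cutoff N x) ψ
  have hφ : R φ = funCalc (pert H V t) (cutoff N) ψ := by
    have : funCalc (pert H V t) (cutoff N) =
        R * funCalc (pert H V t) (fun x => u x * cutoff N x) := by
      simp only [R]
      rw [← funCalc_inv_u (hp.isSelfAdjoint ht),
        ← (hc ht).mul _ _ bddMeas_inv_u (bddMeas_mul_cutoff continuous_u N)]
      congr 1
      ext x
      have := u_ne_zero x
      field_simp
    rw [this, mul_apply_eq_comp]
  rw [← hφ, dist_comm, dist_eq_norm] at hN
  have hclose : ∀ {t}, t ∈ couplings H V →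
      ‖funCalc (pert H V t) g ψ - funCalc (pert H V t) g (R φ)‖ ≤ ε / 4 := by
    intro t ht
    rw [← map_sub]
    refine (ContinuousLinearMap.le_of_opNorm_le _ (hbd ht) _).trans ?_
    refine (mul_le_mul_of_nonneg_left hN.le hC0).trans ?_
    rw [mul_div_assoc', div_le_div_iff₀ (by positivity) (by norm_num)]
    nlinarith
  filter_upwards [hsI, Metric.tendsto_nhds.mp (hR φ) (ε / 4) (by positivity)] with i hi h1
  have h2 := hclose hi
  have h3 := hclose ht
  rw [← dist_eq_norm] at h2 h3
  rw [dist_comm] at h3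
  have h4 := dist_triangle4 (funCalc (pert H V (s i)) g ψ) (funCalc (pert H V (s i)) g (R φ))
    (funCalc (pert H V t) g (R φ)) (funCalc (pert H V t) g ψ)
  linarith

theorem starSConv_funCalc (hp : Perturbation H V)
    (hs : Tendsto s l (𝓝 t)) (hsI : ∀ᶠ i in l, s i ∈ couplings H V)
    (ht : t ∈ couplings H V) {g : ℝ → ℂ} (hg : Continuous g) {C : ℝ} (hC : ∀ x, ‖g x‖ ≤ C) :
    StarSConv l (fun i => funCalc (pert H V (s i)) g) (funCalc (pert H V t) g) := by
  refine ⟨hp.sConv_funCalc hs hsI ht hg hC, ?_⟩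
  have hgb : BddMeas g := ⟨hg.measurable, C, hC⟩
  have h := hp.sConv_funCalc hs hsI ht (g := fun x => starRingEnd ℂ (g x))
    (Complex.continuous_conj.comp hg) (C := C) (fun x => by simpa using hC x)
  rw [(isCalculus_funCalc (hp.isSelfAdjoint ht)).star hgb] at h
  have he : ∀ᶠ i in l, (funCalc (pert H V (s i)) fun x => starRingEnd ℂ (g x)) =
      star (funCalc (pert H V (s i)) g) := by
    filter_upwards [hsI] with i hi
    exact (isCalculus_funCalc (hp.isSelfAdjoint hi)).star hgb
  obtain ⟨⟨D, hD⟩, h2⟩ := h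
  refine ⟨⟨D, ?_⟩, fun ψ => (h2 ψ).congr' ?_⟩
  · filter_upwards [hD, he] with i h3 h4
    rwa [← h4]
  · filter_upwards [he] with i h4
    rw [h4]

end Perturbation

end RelMOI
end

noncomputable section
namespace RelMOI

/-! ### Continuity of multiple operator integrals in the coupling constants -/

variable {𝓗 : Type*} [NormedAddCommGroup 𝓗] [InnerProductSpace ℂ 𝓗] [CompleteSpace 𝓗]
  [TopologicalSpace.SeparableSpace 𝓗]

theorem norm_opInt_le_integral {Ω : Type*} [MeasurableSpace Ω] {ν : Measure Ω} [IsFiniteMeasure ν]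
    {A : Ω → 𝓗 →L[ℂ] 𝓗} (hA : IsOpFam A) : ‖opInt ν A‖ ≤ ∫ ω, ‖A ω‖ ∂ν := by
  refine ContinuousLinearMap.opNorm_le_bound _ (integral_nonneg fun _ => norm_nonneg _) fun ψ => ?_
  rw [opInt_apply hA, ← integral_mul_const]
  obtain ⟨C, hC⟩ := hA.2
  refine norm_integral_le_of_norm_le ?_ (Eventually.of_forall fun ω => (A ω).le_opNorm ψ)
  refine (Integrable.of_bound hA.norm_measurable.aestronglyMeasurable C
    (Eventually.of_forall fun ω => ?_)).mul_const _
  rw [norm_norm]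
  exact hC ω

theorem opInt_sub {Ω : Type*} [MeasurableSpace Ω] {ν : Measure Ω} [IsFiniteMeasure ν]
    {A B : Ω → 𝓗 →L[ℂ] 𝓗} (hA : IsOpFam A) (hB : IsOpFam B) :
    opInt ν A - opInt ν B = opInt ν fun ω => A ω - B ω := by
  ext ψ
  rw [sub_apply, opInt_apply hA, opInt_apply hB, opInt_apply (hA.sub hB),
    ← integral_sub (hA.integrable ν ψ) (hB.integrable ν ψ)]
  rfl

namespace Perturbation

variable {H V : 𝓗 →ₗ.[ℂ] 𝓗} {ι : Type*} {l : Filter ι} {n : ℕ}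
  {φ : (Fin (n + 1) → ℝ) → ℂ} {σ : ι → Fin (n + 1) → ℝ} {τ : Fin (n + 1) → ℝ}

theorem exists_pertProd_bound (hp : Perturbation H V)
    (hσ : ∀ j, Tendsto (fun i => σ i j) l (𝓝 (τ j)))
    (hσI : ∀ᶠ i in l, ∀ j, σ i j ∈ couplings H V) (hτ : ∀ j, τ j ∈ couplings H V) :
    ∃ D : ℝ, 0 ≤ D ∧ ∀ᶠ i in l, ∀ j : Fin n, ‖pertProd H V (σ i j.succ)‖ ≤ D := by
  refine ⟨∑ j : Fin n, (‖pertProd H V (τ j.succ)‖ + 1), by positivity, ?_⟩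
  rw [eventually_all]
  intro j
  have h := hp.tendsto_pertProd (hσ j.succ) (hσI.mono fun i hi => hi j.succ) (hτ j.succ)
  refine (eventually_norm_le_of_tendsto h).mono fun i hi => hi.trans ?_
  exact Finset.single_le_sum (f := fun j : Fin n => ‖pertProd H V (τ j.succ)‖ + 1)
    (fun j _ => by positivity) (Finset.mem_univ j)

theorem exists_chain_bound (hp : Perturbation H V)
    (r : BSRep φ) (hσ : ∀ j, Tendsto (fun i => σ i j) l (𝓝 (τ j)))
    (hσI : ∀ᶠ i in l, ∀ j, σ i j ∈ couplings H V) (hτ : ∀ j, τ j ∈ couplings H V) :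
    ∃ D : ℝ, 0 ≤ D ∧ ∀ᶠ i in l, ∀ ω, ‖chain (fun j => r.fam (fun j => pert H V (σ i j)) j ω)
      (fun j => pertProd H V (σ i j.succ))‖ ≤ D := by
  obtain ⟨C, hC0, hC⟩ := r.exists_bound
  obtain ⟨D, hD0, hD⟩ := hp.exists_pertProd_bound hσ hσI hτ
  refine ⟨C * (D * C) ^ n, by positivity, ?_⟩
  filter_upwards [hσI, hD] with i hi hDi ω
  exact norm_chain_le _ _ hC0 hD0
    (fun j => r.norm_fam_le (fun j => hp.isSelfAdjoint (hi j)) hC0 hC j ω) hDi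

theorem exists_pertMoi_bound (hp : Perturbation H V)
    (r : BSRep φ) (hσ : ∀ j, Tendsto (fun i => σ i j) l (𝓝 (τ j)))
    (hσI : ∀ᶠ i in l, ∀ j, σ i j ∈ couplings H V) (hτ : ∀ j, τ j ∈ couplings H V) :
    ∃ D : ℝ, ∀ᶠ i in l, ‖r.pertMoi H V (σ i)‖ ≤ D := by
  obtain ⟨D, hD0, hD⟩ := hp.exists_chain_bound r hσ hσI hτ
  refine ⟨D * r.ν.real Set.univ, ?_⟩
  filter_upwards [hσI, hD] with i hi hDi
  exact norm_opInt_le (r.isOpFam_chain (fun j => hp.isSelfAdjoint (hi j)) _) hD0 hDi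

theorem tendsto_pertMoi_apply (hp : Perturbation H V)
    [l.IsCountablyGenerated] {r : BSRep φ} (hr : r.IsCont)
    (hσ : ∀ j, Tendsto (fun i => σ i j) l (𝓝 (τ j)))
    (hσI : ∀ᶠ i in l, ∀ j, σ i j ∈ couplings H V) (hτ : ∀ j, τ j ∈ couplings H V) (ψ : 𝓗) :
    Tendsto (fun i => r.pertMoi H V (σ i) ψ) l (𝓝 (r.pertMoi H V τ ψ)) := by
  obtain ⟨C, hC0, hC⟩ := r.exists_bound
  obtain ⟨D, hD0, hD⟩ := hp.exists_chain_bound r hσ hσI hτ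
  have h0 : r.pertMoi H V τ ψ = _ := r.moi_apply (fun j => hp.isSelfAdjoint (hτ j)) _ ψ
  rw [h0]
  have h1 : ∀ᶠ i in l, ∫ ω, chain (fun j => r.fam (fun j => pert H V (σ i j)) j ω)
      (fun j => pertProd H V (σ i j.succ)) ψ ∂r.ν = r.pertMoi H V (σ i) ψ := by
    filter_upwards [hσI] with i hi
    exact (r.moi_apply (fun j => hp.isSelfAdjoint (hi j)) _ ψ).symm
  refine Tendsto.congr' h1 ?_
  refine tendsto_integral_filter_of_dominated_convergence (fun _ => D * ‖ψ‖) ?_ ?_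
    (integrable_const _) (Eventually.of_forall fun ω => ?_)
  · filter_upwards [hσI] with i hi
    exact ((r.isOpFam_chain (fun j => hp.isSelfAdjoint (hi j)) _).1 ψ).aestronglyMeasurable
  · filter_upwards [hD] with i hi
    exact Eventually.of_forall fun ω => ContinuousLinearMap.le_of_opNorm_le _ (hi ω) ψ
  · exact (SConv.chain
      (fun j => hp.sConv_funCalc (hσ j) (hσI.mono fun i hi => hi j) (hτ j) (hr j ω)
        fun x => hC j x ω)
      (fun j => SConv.of_tendsto (hp.tendsto_pertProd (hσ j.succ)
        (hσI.mono fun i hi => hi j.succ) (hτ j.succ)))).2 ψ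

/-- For each ω the integrands converge in norm, and the norm of the difference is dominated by a
constant. Only this scalar norm function is integrated, so strong measurability of the family
suffices. -/
theorem tendsto_pertMoi_of_compact [l.IsCountablyGenerated] (hp : Perturbation H V)
    {φ : (Fin (n + 2) → ℝ) → ℂ} {σ : ι → Fin (n + 2) → ℝ} {τ : Fin (n + 2) → ℝ}
    {r : BSRep φ} (hr : r.IsCont)
    (hσ : ∀ j, Tendsto (fun i => σ i j) l (𝓝 (τ j)))
    (hσI : ∀ᶠ i in l, ∀ j, σ i j ∈ couplings H V) (hτ : ∀ j, τ j ∈ couplings H V)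
    (hK : ∀ t ∈ couplings H V, IsCompactOperator (pertProd H V t)) :
    Tendsto (fun i => r.pertMoi H V (σ i)) l (𝓝 (r.pertMoi H V τ)) := by
  obtain ⟨C, hC0, hC⟩ := r.exists_bound
  obtain ⟨D, hD0, hD⟩ := hp.exists_chain_bound r hσ hσI hτ
  obtain ⟨E, hE⟩ := (r.isOpFam_chain (fun j => hp.isSelfAdjoint (hτ j))
    (fun j => pertProd H V (τ j.succ))).2
  have hlim : Tendsto (fun i => ∫ ω, ‖chain (fun j => r.fam (fun j => pert H V (σ i j)) j ω)
      (fun j => pertProd H V (σ i j.succ)) - chain (fun j => r.fam (fun j => pert H V (τ j)) j ω)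
        (fun j => pertProd H V (τ j.succ))‖ ∂r.ν) l (𝓝 (∫ _, 0 ∂r.ν)) := by
    refine tendsto_integral_filter_of_dominated_convergence (fun _ => D + E) ?_ ?_
      (integrable_const _) (Eventually.of_forall fun ω => ?_)
    · filter_upwards [hσI] with i hi
      exact ((r.isOpFam_chain (fun j => hp.isSelfAdjoint (hi j)) _).sub
        (r.isOpFam_chain (fun j => hp.isSelfAdjoint (hτ j))
          _)).norm_measurable.aestronglyMeasurable
    · filter_upwards [hD] with i hi
      refine Eventually.of_forall fun ω => ?_
      rw [norm_norm]
      exact (norm_sub_le _ _).trans (add_le_add (hi ω) (hE ω))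
    · refine tendsto_zero_iff_norm_tendsto_zero.mp (tendsto_sub_nhds_zero_iff.mpr ?_)
      exact tendsto_chain_of_compact
        (fun j => hp.starSConv_funCalc (hσ j) (hσI.mono fun i hi => hi j) (hτ j) (hr j ω)
          fun x => hC j x ω)
        (fun j => hp.tendsto_pertProd (hσ j.succ) (hσI.mono fun i hi => hi j.succ) (hτ j.succ))
        (hK _ (hτ _))
  rw [integral_zero] at hlim
  refine tendsto_sub_nhds_zero_iff.mp (squeeze_zero_norm' ?_ hlim)
  filter_upwards [hσI] with i hi
  have h1 := r.isOpFam_chain (fun j => hp.isSelfAdjoint (hi j))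
    (fun j => pertProd H V (σ i j.succ))
  have h2 := r.isOpFam_chain (fun j => hp.isSelfAdjoint (hτ j)) (fun j => pertProd H V (τ j.succ))
  have h3 : r.pertMoi H V (σ i) - r.pertMoi H V τ = _ := opInt_sub h1 h2
  rw [h3]
  exact norm_opInt_le_integral (h1.sub h2)

/-- Compactness propagates from t = 0 through W_t = W_0(1 - tW_t). -/
theorem isCompactOperator_pertProd (hp : Perturbation H V)
    {K : 𝓗 →L[ℂ] 𝓗} (hK : IsBoundedProduct V (resolvent H) K)
    (hKc : IsCompactOperator K) {t : ℝ} (ht : t ∈ couplings H V) :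
    IsCompactOperator (pertProd H V t) := by
  have h0 : (0 : ℝ) ∈ couplings H V := by simp [couplings, symmInterval]
  have h1 : pert H V 0 = H := by
    rw [pert, Complex.ofReal_zero, pert_zero hp.relBounded.1]
  have h2 := hp.isBoundedProduct h0
  rw [h1] at h2
  rw [hp.pertProd_eq h0 ht, h2.eq hK]
  exact hKc.comp_clm _

end Perturbation

/-! ### Derivatives -/

/-- The point `(s, …, s, t, …, t)` with `p` entries `s`. -/
def stepPoint {n : ℕ} (p : ℕ) (s t : ℝ) (j : Fin n) : ℝ := if j.val < p then s else t

theorem stepPoint_zero {n : ℕ} (s t : ℝ) : (stepPoint 0 s t : Fin n → ℝ) = fun _ => t := by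
  ext j
  simp [stepPoint]

theorem stepPoint_self {n : ℕ} (s t : ℝ) : (stepPoint n s t : Fin n → ℝ) = fun _ => s := by
  ext j
  simp [stepPoint, j.2]

theorem stepPoint_mem {n : ℕ} {I : Set ℝ} {s t : ℝ} (hs : s ∈ I) (ht : t ∈ I) (p : ℕ) (j : Fin n) :
    stepPoint p s t j ∈ I := by
  rw [stepPoint]
  split_ifs <;> assumption

theorem tendsto_stepPoint {n : ℕ} (p : ℕ) (t : ℝ) (j : Fin n) :
    Tendsto (fun s => stepPoint p s t j) (𝓝 t) (𝓝 t) := by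
  simp only [stepPoint]
  split_ifs
  · exact tendsto_id
  · exact tendsto_const_nhds

/-- With i + 1 entries s, position i holds the last s and position i + 1 the first t. Deleting the
latter keeps i + 1 entries s, deleting the former keeps i, so the perturbation formula at i is one
telescoping step. -/
theorem stepPoint_succ_succAbove {k : ℕ} (i : Fin (k + 1)) (s t : ℝ) (j : Fin (k + 1)) :
    stepPoint (i.val + 1) s t (i.succ.succAbove j) = stepPoint (i.val + 1) s t j := by
  rcases lt_or_ge j.val (i.val + 1) with h | h
  · rw [Fin.succAbove_of_castSucc_lt _ _ (by simpa [Fin.lt_def] using h)]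
    simp [stepPoint]
  · rw [Fin.succAbove_of_le_castSucc _ _ (by simpa [Fin.le_def] using h)]
    simp only [stepPoint, Fin.val_succ]
    rw [if_neg (by omega), if_neg (by omega)]

theorem stepPoint_castSucc_succAbove {k : ℕ} (i : Fin (k + 1)) (s t : ℝ) (j : Fin (k + 1)) :
    stepPoint (i.val + 1) s t (i.castSucc.succAbove j) = stepPoint i.val s t j := by
  rcases lt_or_ge j.val i.val with h | h
  · rw [Fin.succAbove_of_castSucc_lt _ _ (Fin.castSucc_lt_castSucc_iff.mpr h)]
    simp only [stepPoint, Fin.val_castSucc]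
    rw [if_pos (by omega), if_pos h]
  · rw [Fin.succAbove_of_le_castSucc _ _ (Fin.castSucc_le_castSucc_iff.mpr h)]
    simp only [stepPoint, Fin.val_succ]
    rw [if_neg (by omega), if_neg (by omega)]

theorem isOpen_symmInterval (a : ℝ) : IsOpen (symmInterval a) :=
  isOpen_lt (by fun_prop) continuous_const

theorem hasDerivAt_of_eq_smul {E : Type*} [NormedAddCommGroup E] [NormedSpace ℝ E] {G Q : ℝ → E}
    {D : E} {t : ℝ} (h : ∀ᶠ s in 𝓝 t, G s - G t = (s - t) • Q s) (hQ : Tendsto Q (𝓝 t) (𝓝 D)) :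
    HasDerivAt G D t := by
  rw [hasDerivAt_iff_tendsto_slope]
  refine (hQ.mono_left nhdsWithin_le_nhds).congr' ?_
  filter_upwards [nhdsWithin_le_nhds h, self_mem_nhdsWithin] with s hs hne
  rw [slope_def_module, hs, smul_smul, inv_mul_cancel₀ (sub_ne_zero.mpr hne), one_smul]

namespace Perturbation

variable {H V : 𝓗 →ₗ.[ℂ] 𝓗} {f : ℝ → ℂ}

theorem pertMoi_stepPoint_sub (hp : Perturbation H V) {k : ℕ} (hf : ContDiff ℝ (k + 1) f)
    (r : BSRep (weightedDiff f k)) (r' : BSRep (weightedDiff f (k + 1))) {s t : ℝ}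
    (hs : s ∈ couplings H V) (ht : t ∈ couplings H V) {p : ℕ} (hpk : p ≤ k + 1) :
    r.pertMoi H V (stepPoint p s t) - r.pertMoi H V (fun _ => t) =
      (s - t) • ∑ q ∈ Finset.range p, r'.pertMoi H V (stepPoint (q + 1) s t) := by
  rw [← stepPoint_zero s t, ← Finset.sum_range_sub (fun q => r.pertMoi H V (stepPoint q s t)),
    Finset.smul_sum]
  refine Finset.sum_congr rfl fun q hq => ?_
  have hq' : q < k + 1 := (Finset.mem_range.mp hq).trans_le hpk
  have h := hp.pertMoi_sub hf r r' (fun j => stepPoint_mem hs ht (q + 1) j) ⟨q, hq'⟩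
  have h1 := stepPoint_succ_succAbove (k := k) ⟨q, hq'⟩ s t
  have h2 := stepPoint_castSucc_succAbove (k := k) ⟨q, hq'⟩ s t
  simp only at h1 h2
  simp only [h1, h2] at h
  refine h.trans ?_
  have h3 : stepPoint (q + 1) s t (Fin.castSucc ⟨q, hq'⟩ : Fin (k + 2)) = s := by
    simp [stepPoint]
  have h4 : stepPoint (q + 1) s t (Fin.succ ⟨q, hq'⟩ : Fin (k + 2)) = t := by
    simp [stepPoint]
  rw [h3, h4, Complex.coe_smul]

theorem mem_nhds_couplings {t : ℝ} (ht : t ∈ couplings H V) : ∀ᶠ s in 𝓝 t, s ∈ couplings H V :=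
  (isOpen_symmInterval _).mem_nhds ht

theorem pertMoi_const_sub (hp : Perturbation H V) {k : ℕ} (hf : ContDiff ℝ (k + 1) f)
    (r : BSRep (weightedDiff f k)) (r' : BSRep (weightedDiff f (k + 1))) {t : ℝ}
    (ht : t ∈ couplings H V) :
    ∀ᶠ s in 𝓝 t, r.pertMoi H V (fun _ => s) - r.pertMoi H V (fun _ => t) =
      (s - t) • ∑ q ∈ Finset.range (k + 1), r'.pertMoi H V (stepPoint (q + 1) s t) := by
  filter_upwards [Perturbation.mem_nhds_couplings ht] with s hs
  rw [← hp.pertMoi_stepPoint_sub hf r r' hs ht le_rfl, stepPoint_self]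

/-- The difference quotient is exactly a sum of k + 1 integrals of the next order at mixed points.
All of them tend strongly to the diagonal value, whence the factor k + 1. -/
theorem hasDerivAt_pertMoi_apply (hp : Perturbation H V) {k : ℕ} (hf : ContDiff ℝ (k + 1) f)
    (r : BSRep (weightedDiff f k)) {r' : BSRep (weightedDiff f (k + 1))} (hr' : r'.IsCont) {t : ℝ}
    (ht : t ∈ couplings H V) (ψ : 𝓗) :
    HasDerivAt (fun s => r.pertMoi H V (fun _ => s) ψ)
      (((k + 1 : ℕ) : ℂ) • r'.pertMoi H V (fun _ => t) ψ) t := by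
  refine hasDerivAt_of_eq_smul (Q := fun s => ∑ q ∈ Finset.range (k + 1),
    r'.pertMoi H V (stepPoint (q + 1) s t) ψ) ?_ ?_
  · filter_upwards [hp.pertMoi_const_sub hf r r' ht] with s hs
    have h := congrArg (fun A : 𝓗 →L[ℂ] 𝓗 => A ψ) hs
    simp only [sub_apply, smul_apply] at h
    rw [h, sum_apply]
  · have h : ∀ q ∈ Finset.range (k + 1), Tendsto (fun s =>
        r'.pertMoi H V (stepPoint (q + 1) s t) ψ) (𝓝 t) (𝓝 (r'.pertMoi H V (fun _ => t) ψ)) := by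
      intro q _
      refine hp.tendsto_pertMoi_apply hr' (fun j => tendsto_stepPoint (q + 1) t j) ?_
        (fun _ => ht) ψ
      filter_upwards [Perturbation.mem_nhds_couplings ht] with s hs j
      exact stepPoint_mem hs ht _ j
    have h2 := tendsto_finsetSum _ h
    rw [Finset.sum_const, Finset.card_range, ← Nat.cast_smul_eq_nsmul ℂ] at h2
    exact h2

theorem hasDerivAt_pertMoi (hp : Perturbation H V) {k : ℕ} (hf : ContDiff ℝ (k + 1) f)
    (r : BSRep (weightedDiff f k)) {r' : BSRep (weightedDiff f (k + 1))} {t : ℝ}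
    (ht : t ∈ couplings H V)
    (hlim : ∀ p ≤ k + 2, Tendsto (fun s => r'.pertMoi H V (stepPoint p s t)) (𝓝 t)
      (𝓝 (r'.pertMoi H V fun _ => t))) :
    HasDerivAt (fun s => r.pertMoi H V (fun _ => s))
      (((k + 1 : ℕ) : ℂ) • r'.pertMoi H V (fun _ => t)) t := by
  refine hasDerivAt_of_eq_smul (hp.pertMoi_const_sub hf r r' ht) ?_
  have h2 := tendsto_finsetSum (Finset.range (k + 1)) fun q hq =>
    hlim (q + 1) (by have := Finset.mem_range.mp hq; omega)
  rw [Finset.sum_const, Finset.card_range, ← Nat.cast_smul_eq_nsmul ℂ] at h2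
  exact h2

/-- A representation at the next order makes the increments O(|s - t|) in norm, because that
integral stays bounded near t. This replaces compactness when f lies in W_{n+1}. -/
theorem tendsto_stepPoint_of_rep (hp : Perturbation H V) {k : ℕ} (hf : ContDiff ℝ (k + 1) f)
    (r : BSRep (weightedDiff f k)) (r' : BSRep (weightedDiff f (k + 1))) {t : ℝ}
    (ht : t ∈ couplings H V) {p : ℕ} (hpk : p ≤ k + 1) :
    Tendsto (fun s => r.pertMoi H V (stepPoint p s t)) (𝓝 t) (𝓝 (r.pertMoi H V fun _ => t)) := by
  choose D hD using fun q => hp.exists_pertMoi_bound r'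
    (σ := fun s => stepPoint (q + 1) s t) (fun j => tendsto_stepPoint (q + 1) t j)
    ((Perturbation.mem_nhds_couplings ht).mono fun s hs j => stepPoint_mem hs ht _ j) (fun _ => ht)
  have hlim : Tendsto (fun s => |s - t| * ∑ q ∈ Finset.range p, D q) (𝓝 t) (𝓝 0) := by
    have : Continuous fun s => |s - t| * ∑ q ∈ Finset.range p, D q := by fun_prop
    simpa using this.tendsto t
  refine tendsto_sub_nhds_zero_iff.mp (squeeze_zero_norm' ?_ hlim)
  have hall : ∀ᶠ s in 𝓝 t, ∀ q ∈ Finset.range p,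
      ‖r'.pertMoi H V (stepPoint (q + 1) s t)‖ ≤ D q :=
    (Filter.eventually_all_finset _).mpr fun q _ => hD q
  filter_upwards [Perturbation.mem_nhds_couplings ht, hall] with s hs hq
  rw [hp.pertMoi_stepPoint_sub hf r r' hs ht hpk, norm_smul, Real.norm_eq_abs]
  exact mul_le_mul_of_nonneg_left ((norm_sum_le _ _).trans (Finset.sum_le_sum hq)) (abs_nonneg _)

end Perturbation

/-! ### The functional calculus as a multiple operator integral -/

theorem MemW0.exists_bound {f : ℝ → ℂ} (hf : MemW0 f) : ∃ C : ℝ, ∀ x, ‖f x‖ ≤ C := by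
  obtain ⟨hc, h0, -⟩ := hf
  let g : ZeroAtInftyContinuousMap ℝ ℂ := ⟨⟨f, hc⟩, h0⟩
  exact ⟨‖g.toBCF‖, fun x => g.toBCF.norm_coe_le_norm x⟩

theorem MemW.bddMeas {n : ℕ} {f : ℝ → ℂ} (hf : MemW n f) : BddMeas f := by
  have h := hf.2 0 (Nat.zero_le n)
  simp only [pow_zero, mul_one, iteratedDeriv_zero] at h
  exact ⟨h.1.measurable, h.exists_bound⟩

/-- The obvious representation of a function of one variable. -/
abbrev unitRep {f : ℝ → ℂ} (hf : BddMeas f) : BSRep (n := 0) fun l => f (l 0) where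
  Ω := Unit
  ν := Measure.dirac ()
  a := fun _ x _ => f x
  measurable_a := fun _ => hf.1.comp measurable_fst
  bounded_a := ⟨hf.2.choose, fun _ x _ => hf.2.choose_spec x⟩
  eq_integral := fun l => by simp

theorem pertMoi_zero {H V : 𝓗 →ₗ.[ℂ] 𝓗} (hp : Perturbation H V) {n : ℕ} {f : ℝ → ℂ}
    (hf : MemW n f) (r : BSRep (weightedDiff f 0)) {t : ℝ} (ht : t ∈ couplings H V) :
    r.pertMoi H V (fun _ => t) = funCalc (pert H V t) f := by
  have hH : ∀ _ : Fin 1, IsSelfAdjoint (pert H V t) := fun _ => hp.isSelfAdjoint ht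
  rw [BSRep.pertMoi, BSRep.moi_eq_of_eq r (unitRep hf.bddMeas) (fun l => ?_) hH]
  · ext ψ
    rw [BSRep.moi_apply _ hH, integral_dirac, chain_zero]
    rfl
  · simp [weightedDiff, avgDiff_zero f hf.1.continuous]

/-- Each differentiation multiplies by k + 1, so the factors accumulate to k!. Every intermediate
order needs its own continuous representation, supplied by membership of f in W_n. -/
theorem hasNthDerivSOT_pertMoi {H V : 𝓗 →ₗ.[ℂ] 𝓗} (hp : Perturbation H V) {n : ℕ} {f : ℝ → ℂ}
    (hf : MemW n f) (k : ℕ) (hk : k ≤ n) (r : BSRep (weightedDiff f k)) (hr : r.IsCont) :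
    HasNthDerivSOT (fun t : ℝ => funCalc (pert H V t) f) (couplings H V) k
      (fun t => (k.factorial : ℂ) • r.pertMoi H V fun _ => t) := by
  induction k with
  | zero =>
    intro t ht
    simp [pertMoi_zero hp hf r ht]
  | succ k ih =>
    obtain ⟨q, hq⟩ := hasContRep_weightedDiff hf (Nat.le_of_succ_le hk)
    refine ⟨_, ih (Nat.le_of_succ_le hk) q hq, fun t ht ψ => ?_⟩
    have hfk : ContDiff ℝ (k + 1) f := hf.1.of_le (by exact_mod_cast hk)
    have h := (hp.hasDerivAt_pertMoi_apply hfk q hr ht ψ).fun_const_smul (k.factorial : ℂ)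
    refine h.congr_deriv ?_
    rw [smul_smul, smul_apply, Nat.factorial_succ, mul_comm (k + 1)]
    push_cast
    rfl

theorem hasNthDerivNorm_pertMoi {H V : 𝓗 →ₗ.[ℂ] 𝓗} (hp : Perturbation H V) {n : ℕ} {f : ℝ → ℂ}
    (hf : MemW n f) (h : (∃ K : 𝓗 →L[ℂ] 𝓗, IsBoundedProduct V (resolvent H) K ∧
      IsCompactOperator K) ∨ MemW (n + 1) f)
    (k : ℕ) (hk : k ≤ n) (r : BSRep (weightedDiff f k)) (hr : r.IsCont) :
    HasNthDerivNorm (fun t : ℝ => funCalc (pert H V t) f) (couplings H V) k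
      (fun t => (k.factorial : ℂ) • r.pertMoi H V fun _ => t) := by
  induction k with
  | zero =>
    intro t ht
    simp [pertMoi_zero hp hf r ht]
  | succ k ih =>
    obtain ⟨q, hq⟩ := hasContRep_weightedDiff hf (Nat.le_of_succ_le hk)
    refine ⟨_, ih (Nat.le_of_succ_le hk) q hq, fun t ht => ?_⟩
    have hfk : ContDiff ℝ (k + 1) f := hf.1.of_le (by exact_mod_cast hk)
    have hlim : ∀ p ≤ k + 2, Tendsto (fun s => r.pertMoi H V (stepPoint p s t)) (𝓝 t)
        (𝓝 (r.pertMoi H V fun _ => t)) := by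
      intro p hpk
      -- Norm continuity is needed at order k + 1, where there is at least one argument to be
      -- compact. In the second case order k + 2 ≤ n + 1 is used, which is why one extra degree of
      -- regularity suffices.
      rcases h with ⟨K, hK, hKc⟩ | hf'
      · refine hp.tendsto_pertMoi_of_compact hr (fun j => tendsto_stepPoint p t j) ?_
          (fun _ => ht) fun t ht => hp.isCompactOperator_pertProd hK hKc ht
        filter_upwards [Perturbation.mem_nhds_couplings ht] with s hs j
        exact stepPoint_mem hs ht _ j
      · obtain ⟨r', -⟩ := hasContRep_weightedDiff hf' (Nat.succ_le_succ hk)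
        exact hp.tendsto_stepPoint_of_rep
          (hf'.1.of_le (by exact_mod_cast Nat.succ_le_succ hk)) r r' ht hpk
    have h := (hp.hasDerivAt_pertMoi hfk q ht hlim).fun_const_smul (k.factorial : ℂ)
    refine h.congr_deriv ?_
    rw [smul_smul, Nat.factorial_succ, mul_comm (k + 1)]
    push_cast
    rfl

/-- The exponents (1, …, 1) are admissible: V times one resolvent is bounded, and the symbol
weighted once per variable is `weightedDiff`. -/
theorem isGenMOI_pertMoi {H V : 𝓗 →ₗ.[ℂ] 𝓗} (hp : Perturbation H V) {n : ℕ} {f : ℝ → ℂ}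
    (hf : ContDiff ℝ n f) (r : BSRep (weightedDiff f n)) {t : ℝ} (ht : t ∈ couplings H V) :
    IsGenMOI (fun _ => pert H V t) (divDiff f n) (fun _ => V) (r.pertMoi H V fun _ => t) := by
  refine ⟨fun _ => 1, fun _ => pertProd H V t, fun _ => ?_, r.congr fun l => ?_, fun ψ => ?_⟩
  · rw [pow_one]
    exact hp.isBoundedProduct ht
  · simp [weightedDiff, divDiff_eq_avgDiff hf]
  · exact r.moi_apply (fun _ => hp.isSelfAdjoint ht) _ ψ

end RelMOI
end

/-! ### The derivative formula -/

theorem mainTheorem3 {𝓗 : Type*} [NormedAddCommGroup 𝓗] [InnerProductSpace ℂ 𝓗]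
    [CompleteSpace 𝓗] [TopologicalSpace.SeparableSpace 𝓗]
    (n : ℕ) (hn : 1 ≤ n) (f : ℝ → ℂ) (hf : RelMOI.MemW n f)
    (H V : 𝓗 →ₗ.[ℂ] 𝓗) (hH : IsSelfAdjoint H) (hV : V.IsFormalAdjoint V)
    (hHV : RelMOI.IsRelBounded H V) :
    -- all the objects are well defined
    (∀ t ∈ RelMOI.symmInterval (RelMOI.relBound H V),
      IsSelfAdjoint (H + (t : ℂ) • V) ∧
      ∃! T : 𝓗 →L[ℂ] 𝓗,
        RelMOI.IsGenMOI (fun _ => H + (t : ℂ) • V) (RelMOI.divDiff f n) (fun _ => V) T) ∧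
    ∃ G : ℝ → 𝓗 →L[ℂ] 𝓗,
      -- `G` is the `n`-th derivative in the strong operator topology
      RelMOI.HasNthDerivSOT (fun t : ℝ => RelMOI.funCalc (H + (t : ℂ) • V) f)
        (RelMOI.symmInterval (RelMOI.relBound H V)) n G ∧
      ((n.factorial : ℂ)⁻¹ • G 0 =
        RelMOI.genMOI (fun _ => H) (RelMOI.divDiff f n) (fun _ => V)) ∧
      (∀ t₀ ∈ RelMOI.symmInterval (RelMOI.relBound H V),
        (n.factorial : ℂ)⁻¹ • G t₀ =
          RelMOI.genMOI (fun _ => H + (t₀ : ℂ) • V) (RelMOI.divDiff f n) (fun _ => V)) ∧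
      -- the derivatives exist in operator norm under either additional assumption
      (((∃ K : 𝓗 →L[ℂ] 𝓗, RelMOI.IsBoundedProduct V (RelMOI.resolvent H) K ∧
          IsCompactOperator K) ∨ RelMOI.MemW (n + 1) f) →
        RelMOI.HasNthDerivNorm (fun t : ℝ => RelMOI.funCalc (H + (t : ℂ) • V) f)
          (RelMOI.symmInterval (RelMOI.relBound H V)) n G) := by
  have hp : RelMOI.Perturbation H V := ⟨hH, hV, hHV⟩
  obtain ⟨r, hr⟩ := RelMOI.hasContRep_weightedDiff hf le_rfl
  have hgen : ∀ t ∈ RelMOI.symmInterval (RelMOI.relBound H V),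
      ((n.factorial : ℂ)⁻¹ • (n.factorial : ℂ) • r.pertMoi H V fun _ => t) =
        RelMOI.genMOI (fun _ => H + (t : ℂ) • V) (RelMOI.divDiff f n) (fun _ => V) := by
    intro t ht
    rw [smul_smul, inv_mul_cancel₀ (by exact_mod_cast n.factorial_ne_zero), one_smul]
    exact ((RelMOI.isGenMOI_pertMoi hp hf.1 r ht).genMOI_eq fun _ => hp.isSelfAdjoint ht).symm
  refine ⟨fun t ht => ⟨hp.isSelfAdjoint ht, _, RelMOI.isGenMOI_pertMoi hp hf.1 r ht, fun T hT =>
      hT.unique (fun _ => hp.isSelfAdjoint ht) (RelMOI.isGenMOI_pertMoi hp hf.1 r ht)⟩,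
    _, RelMOI.hasNthDerivSOT_pertMoi hp hf n le_rfl r hr, ?_, hgen, fun h =>
      RelMOI.hasNthDerivNorm_pertMoi hp hf h n le_rfl r hr⟩
  have h := hgen 0 (by simp [RelMOI.symmInterval])
  rwa [Complex.ofReal_zero, RelMOI.pert_zero hHV.1] at h
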